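/- Notation. On $\mathbb R^2$, $(z_1,z_2)^\perp=(-z_2,z_1)$, $\nabla^\perp=(-\partial_2,\partial_1)$, $G(\xi)=\frac1{4\pi}e^{-|\xi|^2/4}$, $v^G(\xi)=\frac1{2\pi}\frac{\xi^\perp}{|\xi|^2}\bigl(1-e^{-|\xi|^2/4}\bigr)$, $K_{BS}(x)=\frac1{2\pi}\frac{x^\perp}{|x|^2}$, and $\|f\|_{L^p_w}=\|G^{-1/2}f\|_{L^p(\mathbb R^2)}$. For $\alpha\in\mathbb R$ consider, for $t>0$ and $\xi\in\mathbb R^2$, the system $$\begin{aligned}&\partial_t b+\bigl((v-\tfrac12\xi)\cdot\nabla\bigr)b=0,\\ &\partial_t\tilde w-(\mathcal L-\alpha\Lambda)\tilde w+(\tilde v\cdot\nabla)\tilde w=\operatorname{div}\bigl(b\,(\nabla w+\nabla^\perp\Pi)\bigr),\end{aligned}$$ where $\mathcal Lf=\Delta f+\frac12\xi\cdot\nabla f+f$, $\Lambda f=v^G\cdot\nabla f+(K_{BS}\star f)\cdot\nabla G$, $\tilde v=K_{BS}\star\tilde w$, $w=\alpha G+\tilde w$, $v=\alpha v^G+\tilde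 v$, and $\nabla\Pi(t)\in L^2(\mathbb R^2)^2$ solves $\operatorname{div}((1+b)\nabla\Pi)=\operatorname{div}((1+b)\Delta v-(v\cdot\nabla)v)$. Solutions are understood in the sense of distributions: $b(t)\in L^2_w\cap L^\infty_w$ and $\tilde w(t)\in L^2_w$ for every $t>0$, $\tilde w(t)$ has a locally integrable weak gradient for almost every $t>0$, and both evolution equations, integrated in time over $(0,t)$ from the initial data $b_0\in L^2_w\cap L^\infty_w$, $\tilde w_0\in L^2_w$, hold for every $t>0$ when tested against every function in $C_c^\infty(\mathbb R^2)$ (the pairings being integrable over $(0,t)\times\mathbb R^2$). Theorem 2 (asymptotic behaviour). Let $\alpha\in\mathbb R$, $0<\gamma<\frac12$ and $K>0$. There exist $\varepsilon_0>0$ and $K'>0$ such that the following holds. Let $(b,\tilde w)$ be a solution of the system with initial data $(b_0,\tilde w_0)$ such that $\int_{\mathbb R^2}\tilde w_0=0$, $$\|b_0\|_{L^2_w}\le\varepsilon_0,\qquad \|b_0\|_{L^\infty_w}\le\varepsilon_0,$$ and, for all $t>0$, $$\|\tilde w(t)\|_{L^2_w}^2+\int_0^t\|\nabla\tilde w(s)\|_{L^2_w}^2\,ds\le\varepsilon_0,\qquad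 \|b(t)\|_{L^2_w}\le K\|b_0\|_{L^2_w}e^{-t/2},\qquad \|b(t)\|_{L^\infty_w}\le K\|b_0\|_{L^\infty_w}.$$ Then, for all $t>0$, $$\|\tilde w(t)\|_{L^2_w}\le K'e^{-\gamma t}\bigl(\|\tilde w_0\|_{L^2_w}+\|b_0\|_{L^2_w}\bigr).$$ -/

import Mathlib

open MeasureTheory Set
open scoped ENNReal ContDiff Gradient Laplacian

noncomputable section

namespace OseenVortex

/-- The Euclidean plane `ℝ²`. -/
abbrev Plane : Type := EuclideanSpace ℝ (Fin 2)

/-- `(z₁, z₂)^⊥ = (-z₂, z₁)`. -/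
def perp (z : Plane) : Plane := !₂[-(z 1), z 0]

/-- The profile `G(ξ) = e^{-|ξ|²/4} / (4π)` of the Oseen vortex. -/
def G (ξ : Plane) : ℝ := 1 / (4 * Real.pi) * Real.exp (-‖ξ‖ ^ 2 / 4)

/-- The velocity profile `v^G(ξ) = (1/2π) (ξ^⊥ / |ξ|²) (1 - e^{-|ξ|²/4})`
(with its continuous value `0` at `ξ = 0`). -/
def vG (ξ : Plane) : Plane :=
  (1 / (2 * Real.pi) * (1 - Real.exp (-‖ξ‖ ^ 2 / 4)) / ‖ξ‖ ^ 2) • perp ξ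

/-- The Biot-Savart kernel `K_BS(x) = (1/2π) x^⊥ / |x|²`. -/
def biotSavartKernel (x : Plane) : Plane := (1 / (2 * Real.pi) / ‖x‖ ^ 2) • perp x

/-- The Biot-Savart law `K_BS ⋆ f`. -/
def biotSavart (f : Plane → ℝ) (ξ : Plane) : Plane :=
  ∫ η, f η • biotSavartKernel (ξ - η)

/-- The full velocity `v = α v^G + K_BS ⋆ w` associated with the vorticity perturbation `w`. -/
def velocity (α : ℝ) (w : Plane → ℝ) (ξ : Plane) : Plane :=
  α • vG ξ + biotSavart w ξ

/-- The weighted norm `‖G^{-1/2} f‖_{L^p}` (possibly infinite), for scalar or vector fields. -/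
def wnorm {F : Type*} [NormedAddCommGroup F] [NormedSpace ℝ F] (p : ℝ≥0∞) (f : Plane → F) :
    ℝ≥0∞ :=
  eLpNorm (fun ξ => (G ξ) ^ (-(1 / 2) : ℝ) • f ξ) p volume

/-- Membership in the weighted space `L^p_w(ℝ²) = {f | G^{-1/2} f ∈ L^p(ℝ²)}`. -/
def MemLpw {F : Type*} [NormedAddCommGroup F] [NormedSpace ℝ F] (p : ℝ≥0∞) (f : Plane → F) :
    Prop :=
  MemLp (fun ξ => (G ξ) ^ (-(1 / 2) : ℝ) • f ξ) p volume

/-- Test functions: smooth and compactly supported in the plane. -/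
def IsTestFunction (φ : Plane → ℝ) : Prop := ContDiff ℝ ∞ φ ∧ HasCompactSupport φ

/-- `g` is the gradient of `f` in the sense of distributions. -/
structure IsWeakGradient (f : Plane → ℝ) (g : Plane → Plane) : Prop where
  locInt : LocallyIntegrable f volume
  locInt_grad : LocallyIntegrable g volume
  integral_eq : ∀ φ, IsTestFunction φ → ∫ ξ, f ξ • (∇ φ) ξ = - ∫ ξ, φ ξ • g ξ

/-- `l` is the Laplacian of `f` in the sense of distributions. -/
structure IsWeakLaplacian (f l : Plane → ℝ) : Prop where
  locInt : LocallyIntegrable f volume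
  locInt_lap : LocallyIntegrable l volume
  integral_eq : ∀ φ, IsTestFunction φ → ∫ ξ, f ξ * (Δ φ) ξ = ∫ ξ, l ξ * φ ξ

/-- The vector field `(v · ∇) u`, where `Du i` is the gradient of the `i`-th component of `u`. -/
def convective (v : Plane → Plane) (Du : Fin 2 → Plane → Plane) (ξ : Plane) : Plane :=
  WithLp.toLp 2 (fun i => inner ℝ (v ξ) (Du i ξ))

/-- `P = ∇Π` is a square integrable gradient which solves (in the sense of distributions)
`div ((1 + b) ∇Π) = div ((1 + b) Δv - (v · ∇) v)`. -/
structure IsPressureGradient (b : Plane → ℝ) (v P : Plane → Plane) : Prop where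
  memLp : MemLp P 2 volume
  isGradient : ∃ p : Plane → ℝ, IsWeakGradient p P
  equation : ∃ (Dv : Fin 2 → Plane → Plane) (Lv : Plane → Plane),
    (∀ i, IsWeakGradient (fun ξ => v ξ i) (Dv i)) ∧
    (∀ i, IsWeakLaplacian (fun ξ => v ξ i) (fun ξ => Lv ξ i)) ∧
    ∀ φ, IsTestFunction φ →
      ∫ ξ, inner ℝ ((1 + b ξ) • P ξ) ((∇ φ) ξ) =
        ∫ ξ, inner ℝ ((1 + b ξ) • Lv ξ - convective v Dv ξ) ((∇ φ) ξ)

/-- The density `b (v - ξ/2) · ∇φ - b φ`, that is `b div ((v - ξ/2) φ)` for `div v = 0`: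
the pairing of `-((v - ξ/2) · ∇) b` with the test function `φ`. -/
def densityPairing (b : Plane → ℝ) (v : Plane → Plane) (φ : Plane → ℝ) (ξ : Plane) : ℝ :=
  b ξ * (inner ℝ (v ξ - (1 / 2 : ℝ) • ξ) ((∇ φ) ξ) - φ ξ)

/-- The pairing of `𝓛 f = Δf + (1/2) ξ · ∇f + f` with `φ`, where `Df` is the gradient of `f`
(`Δ` is in divergence form). -/
def LPairing (f : Plane → ℝ) (Df : Plane → Plane) (φ : Plane → ℝ) (ξ : Plane) : ℝ :=
  - inner ℝ (Df ξ) ((∇ φ) ξ) + ((1 / 2) * inner ℝ ξ (Df ξ) + f ξ) * φ ξ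

/-- `Λ f = v^G · ∇f + (K_BS ⋆ f) · ∇G`, where `Df` is the gradient of `f`. -/
def Lambda (f : Plane → ℝ) (Df : Plane → Plane) (ξ : Plane) : ℝ :=
  inner ℝ (vG ξ) (Df ξ) + inner ℝ (biotSavart f ξ) ((∇ G) ξ)

/-- The pairing with `φ` of
`(𝓛 - α Λ) w - ((K_BS ⋆ w) · ∇) w + div (b (∇(αG + w) + ∇^⊥ Π))`,
where `Dw = ∇w` and `P = ∇Π`. -/
def vorticityPairing (α : ℝ) (b w : Plane → ℝ) (Dw P : Plane → Plane) (φ : Plane → ℝ)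
    (ξ : Plane) : ℝ :=
  LPairing w Dw φ ξ - α * Lambda w Dw ξ * φ ξ - inner ℝ (biotSavart w ξ) (Dw ξ) * φ ξ
    - inner ℝ (b ξ • (α • (∇ G) ξ + Dw ξ + perp (P ξ))) ((∇ φ) ξ)

/-- `(b, w)` is a (global in time, weak) solution, with initial data `(b₀, w₀)`, of
`∂ₜ b + ((v - ξ/2) · ∇) b = 0`,
`∂ₜ w - (𝓛 - α Λ) w + ((K_BS ⋆ w) · ∇) w = div (b (∇(αG + w) + ∇^⊥ Π))`,
where `v = α v^G + K_BS ⋆ w` and `Π` is the associated pressure. The spatial gradients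
`Dw = ∇w` and `P = ∇Π`, which are determined by `(b, w)`, are recorded explicitly. -/
structure IsSolution (α : ℝ) (b₀ w₀ : Plane → ℝ) (b w : ℝ → Plane → ℝ)
    (Dw P : ℝ → Plane → Plane) : Prop where
  b₀_mem : MemLpw 2 b₀ ∧ MemLpw ∞ b₀
  w₀_mem : MemLpw 2 w₀
  b_mem : ∀ t > 0, MemLpw 2 (b t) ∧ MemLpw ∞ (b t)
  w_mem : ∀ t > 0, MemLpw 2 (w t)
  b_meas : AEStronglyMeasurable (Function.uncurry b) ((volume.restrict (Ioi 0)).prod volume)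
  w_meas : AEStronglyMeasurable (Function.uncurry w) ((volume.restrict (Ioi 0)).prod volume)
  Dw_meas : AEStronglyMeasurable (Function.uncurry Dw) ((volume.restrict (Ioi 0)).prod volume)
  P_meas : AEStronglyMeasurable (Function.uncurry P) ((volume.restrict (Ioi 0)).prod volume)
  gradient : ∀ᵐ t ∂(volume.restrict (Ioi (0 : ℝ))), IsWeakGradient (w t) (Dw t)
  pressure : ∀ᵐ t ∂(volume.restrict (Ioi (0 : ℝ))),
    IsPressureGradient (b t) (velocity α (w t)) (P t)
  density_integrable : ∀ φ, IsTestFunction φ → ∀ t > 0,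
    Integrable (fun z : ℝ × Plane => densityPairing (b z.1) (velocity α (w z.1)) φ z.2)
      ((volume.restrict (Ioc 0 t)).prod volume)
  density_eq : ∀ φ, IsTestFunction φ → ∀ t > 0,
    ∫ ξ, b t ξ * φ ξ = (∫ ξ, b₀ ξ * φ ξ) +
      ∫ s in Ioc 0 t, ∫ ξ, densityPairing (b s) (velocity α (w s)) φ ξ
  vorticity_integrable : ∀ φ, IsTestFunction φ → ∀ t > 0,
    Integrable (fun z : ℝ × Plane => vorticityPairing α (b z.1) (w z.1) (Dw z.1) (P z.1) φ z.2)
      ((volume.restrict (Ioc 0 t)).prod volume)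
  vorticity_eq : ∀ φ, IsTestFunction φ → ∀ t > 0,
    ∫ ξ, w t ξ * φ ξ = (∫ ξ, w₀ ξ * φ ξ) +
      ∫ s in Ioc 0 t, ∫ ξ, vorticityPairing α (b s) (w s) (Dw s) (P s) φ ξ

end OseenVortex

end

open OseenVortex

noncomputable section

namespace OseenVortex

open Filter Topology
open scoped Convolution

/-! The proof is an energy estimate in `L²_w`. There `𝓛` is diagonal in the functions `G Hₙ`, where
the `Hₙ` are the Hermite polynomials of the Gaussian measure `G dx`, with eigenvalues `-(n₀ +
n₁)/2`. The mean of `w` is conserved, so `w` has no component on the kernel of `𝓛`, and the spectral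
gap `1/2` makes every rate `γ < 1/2` accessible. The operator `Λ` is skew in `L²_w`, so `α` may be
large: `v^G` is divergence free and tangent to the level lines of `G` (`InV.integral_vG_transport`),
and the nonlocal part reduces to `∫ w ξ · (K_BS ⋆ w)`, which vanishes because the kernel is odd and
orthogonal to its argument (`InV.integral_bs_moment`). Two terms remain. The transport term is at
most `C ‖∇w‖² ‖w‖`. The density term is at most `C (‖b‖ + β ‖∇w‖) ‖∇w‖`, with `β` a bound for `b` in
`L^∞_w`. Small `‖w‖` and `β` let the dissipation absorb the terms in `‖∇w‖²`; Young's inequality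
turns `‖b‖ ‖∇w‖` into a forcing of size `‖b₀‖² e^{-t}`, which decays faster than `e^{-2γt}`, and a
Gronwall argument concludes.

These bounds need information on the velocity and on the pressure. A planar Hardy inequality bounds
`K_BS ⋆ w` uniformly by `‖∇w‖` (`InV.hardy`, `InV.potential`), and a Caccioppoli inequality bounds
its gradient in `L²` by `‖w‖` (`InV.exists_bs_grad`). As for `∇Π`, the field `(v^G · ∇) v^G` is a
gradient, so the pure vortex contribution, which is not small, can be split off exactly. What is
left is a curl-free `L²` field with the divergence of a controlled field, and a Liouville theorem in
`L²` shows that its norm is no larger (`l2_le_of_curl_free`, `exists_pressure_bound`). The pressure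
carries no Gaussian weight; the weight is taken from `b ∈ L^∞_w` (`exists_flux_bound`).

Since `w` is only a weak solution, `w / G` is not an admissible test function. The weak formulation
is first extended to functions of tempered growth, in particular to Hermite polynomials; each
Hermite coefficient of `w` is then absolutely continuous in time, and its square can be
differentiated. For a finite set `S` of modes this amounts to testing with a Hermite partial sum of
`w / G`; the cancellations then hold up to the remainder `rem w S` (`exists_pairing_partialSum`).
`energy_le_of_modes` lets `S` grow, and `SmallSolution.energy_inequality` and `SmallSolution.decay`
collect the constants. -/

/-! ### Coordinates on the plane -/

/-- The `i`-th partial derivative. -/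
def pd (i : Fin 2) (φ : Plane → ℝ) (x : Plane) : ℝ :=
  fderiv ℝ φ x (EuclideanSpace.single i (1 : ℝ))

theorem gradient_apply (φ : Plane → ℝ) (x : Plane) (i : Fin 2) : (∇ φ) x i = pd i φ x := by
  rw [pd, ← inner_gradient_left, EuclideanSpace.inner_single_right]
  simp

theorem inner_plane (x y : Plane) : inner ℝ x y = x 0 * y 0 + x 1 * y 1 := by
  simp [PiLp.inner_apply, Fin.sum_univ_two]; ring

theorem norm_sq_plane (x : Plane) : ‖x‖ ^ 2 = x 0 ^ 2 + x 1 ^ 2 := by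
  rw [EuclideanSpace.real_norm_sq_eq, Fin.sum_univ_two]

@[simp] theorem perp_zero (x : Plane) : perp x 0 = - x 1 := rfl
@[simp] theorem perp_one (x : Plane) : perp x 1 = x 0 := rfl

@[simp] theorem norm_perp (x : Plane) : ‖perp x‖ = ‖x‖ := by
  rw [← sq_eq_sq₀ (norm_nonneg _) (norm_nonneg _), norm_sq_plane, norm_sq_plane]
  simp; ring

theorem abs_apply_le_norm (x : Plane) (i : Fin 2) : |x i| ≤ ‖x‖ := by
  simpa using PiLp.norm_apply_le x i

theorem norm_le_abs_add_abs (x : Plane) : ‖x‖ ≤ |x 0| + |x 1| := by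
  refine le_of_sq_le_sq ?_ (by positivity)
  rw [norm_sq_plane]
  nlinarith [sq_abs (x 0), sq_abs (x 1), mul_nonneg (abs_nonneg (x 0)) (abs_nonneg (x 1))]

theorem continuous_perp : Continuous perp := by
  have : perp = fun z : Plane => !₂[-(z 1), z 0] := rfl
  rw [this]; fun_prop

/-! ### Calculus of partial derivatives -/

theorem pd_add {φ ψ : Plane → ℝ} {x : Plane} (hφ : DifferentiableAt ℝ φ x)
    (hψ : DifferentiableAt ℝ ψ x) (i : Fin 2) :
    pd i (fun y => φ y + ψ y) x = pd i φ x + pd i ψ x := by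
  simp [pd, fderiv_fun_add hφ hψ]

theorem pd_sub {φ ψ : Plane → ℝ} {x : Plane} (hφ : DifferentiableAt ℝ φ x)
    (hψ : DifferentiableAt ℝ ψ x) (i : Fin 2) :
    pd i (fun y => φ y - ψ y) x = pd i φ x - pd i ψ x := by
  simp [pd, fderiv_fun_sub hφ hψ]

theorem pd_mul {φ ψ : Plane → ℝ} {x : Plane} (hφ : DifferentiableAt ℝ φ x)
    (hψ : DifferentiableAt ℝ ψ x) (i : Fin 2) :
    pd i (fun y => φ y * ψ y) x = pd i φ x * ψ x + φ x * pd i ψ x := by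
  simp [pd, fderiv_fun_mul hφ hψ]; ring

theorem pd_neg {φ : Plane → ℝ} {x : Plane} (i : Fin 2) :
    pd i (fun y => - φ y) x = - pd i φ x := by
  simp [pd, fderiv_fun_neg]

theorem pd_const_mul {φ : Plane → ℝ} {x : Plane} (hφ : DifferentiableAt ℝ φ x) (c : ℝ)
    (i : Fin 2) : pd i (fun y => c * φ y) x = c * pd i φ x := by
  simp [pd, fderiv_const_mul hφ]

theorem pd_const (c : ℝ) (i : Fin 2) (x : Plane) : pd i (fun _ => c) x = 0 := by
  simp [pd]

theorem pd_sum {ι : Type*} (S : Finset ι) {φ : ι → Plane → ℝ} {x : Plane}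
    (hφ : ∀ n ∈ S, DifferentiableAt ℝ (φ n) x) (i : Fin 2) :
    pd i (fun y => ∑ n ∈ S, φ n y) x = ∑ n ∈ S, pd i (φ n) x := by
  simp [pd, fderiv_fun_sum hφ]

theorem pd_comp {g : ℝ → ℝ} {φ : Plane → ℝ} {x : Plane} (hg : DifferentiableAt ℝ g (φ x))
    (hφ : DifferentiableAt ℝ φ x) (i : Fin 2) :
    pd i (fun y => g (φ y)) x = deriv g (φ x) * pd i φ x := by
  have := (hg.hasDerivAt.comp_hasFDerivAt x hφ.hasFDerivAt).fderiv
  simp only [pd]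
  rw [show (fun y => g (φ y)) = g ∘ φ from rfl, this]
  simp

theorem pd_coord (i j : Fin 2) (x : Plane) :
    pd i (fun y : Plane => y j) x = if i = j then 1 else 0 := by
  have : (fun y : Plane => y j) = (EuclideanSpace.proj j : Plane →L[ℝ] ℝ) := rfl
  simp only [pd]
  rw [this, ContinuousLinearMap.fderiv]
  simp [eq_comm]

theorem hasTemperateGrowth_coord (j : Fin 2) :
    (fun y : Plane => y j).HasTemperateGrowth :=
  (EuclideanSpace.proj j : Plane →L[ℝ] ℝ).hasTemperateGrowth

theorem differentiable_coord (j : Fin 2) : Differentiable ℝ (fun y : Plane => y j) :=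
  (EuclideanSpace.proj j : Plane →L[ℝ] ℝ).differentiable

theorem contDiff_coord (j : Fin 2) : ContDiff ℝ ∞ (fun y : Plane => y j) :=
  (EuclideanSpace.proj j : Plane →L[ℝ] ℝ).contDiff

theorem continuous_coord (j : Fin 2) : Continuous (fun y : Plane => y j) :=
  (differentiable_coord j).continuous

theorem pd_norm_sq (i : Fin 2) (x : Plane) : pd i (fun y : Plane => ‖y‖ ^ 2) x = 2 * x i := by
  have : (fun y : Plane => ‖y‖ ^ 2) = fun y => y 0 * y 0 + y 1 * y 1 := by
    ext y; rw [norm_sq_plane]; ring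
  have h := fun j => (differentiable_coord j) x
  rw [this, pd_add ((h 0).fun_mul (h 0)) ((h 1).fun_mul (h 1)), pd_mul (h 0) (h 0),
    pd_mul (h 1) (h 1)]
  simp only [pd_coord]
  fin_cases i <;> simp <;> ring

theorem contDiff_pd {φ : Plane → ℝ} (hφ : ContDiff ℝ ∞ φ) (i : Fin 2) :
    ContDiff ℝ ∞ (pd i φ) := by
  have : ContDiff ℝ ∞ (fderiv ℝ φ) := hφ.fderiv_right (by simp)
  exact this.clm_apply contDiff_const

theorem differentiable_of_smooth {φ : Plane → ℝ} (hφ : ContDiff ℝ ∞ φ) : Differentiable ℝ φ :=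
  hφ.differentiable (by simp)

theorem pd_pd {φ : Plane → ℝ} (hφ : ContDiff ℝ ∞ φ) (k l : Fin 2) (x : Plane) :
    pd k (pd l φ) x = fderiv ℝ (fderiv ℝ φ) x
      (EuclideanSpace.single k 1) (EuclideanSpace.single l 1) := by
  have h1 : ContDiff ℝ ∞ (fderiv ℝ φ) := hφ.fderiv_right (by simp)
  have hd : DifferentiableAt ℝ (fderiv ℝ φ) x := (h1.differentiable (by simp)) x
  have := fderiv_clm_apply hd
    (differentiableAt_const (EuclideanSpace.single l (1 : ℝ) : Plane))
  change fderiv ℝ (fun y => fderiv ℝ φ y (EuclideanSpace.single l (1 : ℝ))) x _ = _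
  rw [this]
  simp

theorem pd_comm {φ : Plane → ℝ} (hφ : ContDiff ℝ ∞ φ) (i j : Fin 2) (x : Plane) :
    pd i (pd j φ) x = pd j (pd i φ) x := by
  rw [pd_pd hφ, pd_pd hφ]
  exact (hφ.contDiffAt.isSymmSndFDerivAt (by simp; exact WithTop.coe_le_coe.2 (le_top : (2 : ℕ∞) ≤ ⊤))) _ _

theorem laplacian_eq {φ : Plane → ℝ} (hφ : ContDiff ℝ ∞ φ) (x : Plane) :
    (Δ φ) x = pd 0 (pd 0 φ) x + pd 1 (pd 1 φ) x := by
  rw [InnerProductSpace.laplacian_eq_iteratedFDeriv_orthonormalBasis φ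
    (EuclideanSpace.basisFun (Fin 2) ℝ)]
  simp only [Fin.sum_univ_two, pd_pd hφ, iteratedFDeriv_two_apply]
  simp

theorem hasCompactSupport_pd {φ : Plane → ℝ} (hφ : HasCompactSupport φ) (i : Fin 2) :
    HasCompactSupport (pd i φ) :=
  (hφ.fderiv (𝕜 := ℝ)).comp_left (g := fun L : Plane →L[ℝ] ℝ => L (EuclideanSpace.single i 1))
    (by simp)

theorem IsTestFunction.pd {φ : Plane → ℝ} (hφ : IsTestFunction φ) (i : Fin 2) :
    IsTestFunction (pd i φ) :=
  ⟨contDiff_pd hφ.1 i, hasCompactSupport_pd hφ.2 i⟩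

theorem hasTemperateGrowth_pd {φ : Plane → ℝ} (hφ : φ.HasTemperateGrowth) (i : Fin 2) :
    (pd i φ).HasTemperateGrowth := by
  have h : (fderiv ℝ φ).HasTemperateGrowth := by
    refine ⟨hφ.1.fderiv_right (by simp), fun n => ?_⟩
    obtain ⟨k, C, h⟩ := hφ.2 (n + 1)
    refine ⟨k, C, fun x => ?_⟩
    rw [norm_iteratedFDeriv_fderiv]; exact h x
  exact (ContinuousLinearMap.apply ℝ ℝ
    (EuclideanSpace.single i (1 : ℝ) : Plane)).hasTemperateGrowth.comp h

theorem IsTestFunction.tempered {φ : Plane → ℝ} (hφ : IsTestFunction φ) :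
    φ.HasTemperateGrowth := hφ.2.hasTemperateGrowth hφ.1

theorem IsTestFunction.mul_left {φ ψ : Plane → ℝ} (hφ : IsTestFunction φ) (hψ : ContDiff ℝ ∞ ψ) :
    IsTestFunction (fun x => φ x * ψ x) :=
  ⟨hφ.1.mul hψ, hφ.2.mul_right⟩

theorem IsTestFunction.continuous {φ : Plane → ℝ} (hφ : IsTestFunction φ) : Continuous φ :=
  hφ.1.continuous

theorem IsTestFunction.differentiable {φ : Plane → ℝ} (hφ : IsTestFunction φ) :
    Differentiable ℝ φ := differentiable_of_smooth hφ.1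

theorem IsTestFunction.integrable {φ : Plane → ℝ} (hφ : IsTestFunction φ) :
    Integrable φ := hφ.continuous.integrable_of_hasCompactSupport hφ.2

theorem IsTestFunction.add {φ ψ : Plane → ℝ} (hφ : IsTestFunction φ) (hψ : IsTestFunction ψ) :
    IsTestFunction (fun x => φ x + ψ x) := ⟨hφ.1.add hψ.1, hφ.2.add hψ.2⟩

theorem IsTestFunction.const_mul {φ : Plane → ℝ} (hφ : IsTestFunction φ) (c : ℝ) :
    IsTestFunction (fun x => c * φ x) := ⟨contDiff_const.mul hφ.1, hφ.2.mul_left⟩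

theorem IsTestFunction.sub {φ ψ : Plane → ℝ} (hφ : IsTestFunction φ) (hψ : IsTestFunction ψ) :
    IsTestFunction (fun x => φ x - ψ x) := by
  simpa [sub_eq_add_neg] using hφ.add (hψ.const_mul (-1))

theorem continuous_gradient {φ : Plane → ℝ} (hφ : ContDiff ℝ ∞ φ) : Continuous (∇ φ) := by
  have : Continuous (fderiv ℝ φ) := (hφ.fderiv_right (m := ∞) (by simp)).continuous
  exact (InnerProductSpace.toDual ℝ Plane).symm.continuous.comp this

theorem hasCompactSupport_gradient {φ : Plane → ℝ} (hφ : HasCompactSupport φ) :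
    HasCompactSupport (∇ φ) :=
  (hφ.fderiv (𝕜 := ℝ)).comp_left (g := (InnerProductSpace.toDual ℝ Plane).symm) (by simp)

/-! ### Integration by parts -/

theorem integral_pd_mul {φ ψ : Plane → ℝ} (hφ : Differentiable ℝ φ) (hψ : Differentiable ℝ ψ)
    (i : Fin 2) (h1 : Integrable fun x => pd i φ x * ψ x)
    (h2 : Integrable fun x => φ x * pd i ψ x) (h3 : Integrable fun x => φ x * ψ x) :
    ∫ x, pd i φ x * ψ x = - ∫ x, φ x * pd i ψ x := by
  have := integral_mul_fderiv_eq_neg_fderiv_mul_of_integrable (μ := volume) h1 h2 h3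
    (fun x _ => hφ x) (fun x _ => hψ x)
  simp only [pd]
  rw [this, neg_neg]

theorem integral_pd_mul_test {φ ψ : Plane → ℝ} (hφ : ContDiff ℝ ∞ φ) (hψ : IsTestFunction ψ)
    (i : Fin 2) : ∫ x, pd i φ x * ψ x = - ∫ x, φ x * pd i ψ x := by
  have e : ∀ f g : Plane → ℝ, ContDiff ℝ ∞ f → IsTestFunction g →
      Integrable (fun x => f x * g x) := fun f g hf hg =>
    (hf.continuous.mul hg.continuous).integrable_of_hasCompactSupport hg.2.mul_left
  exact integral_pd_mul (differentiable_of_smooth hφ) hψ.differentiable i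
    (e _ _ (contDiff_pd hφ i) hψ) (e _ _ hφ (hψ.pd i)) (e _ _ hφ hψ)

/-! ### The Gaussian weight -/

/-- The square root `G^{1/2}` of the Gaussian. -/
def gh (x : Plane) : ℝ := Real.sqrt (1 / (4 * Real.pi)) * Real.exp (-‖x‖ ^ 2 / 8)

theorem gh_pos (x : Plane) : 0 < gh x := by unfold gh; positivity

theorem gh_ne_zero (x : Plane) : gh x ≠ 0 := (gh_pos x).ne'

theorem G_eq (x : Plane) : G x = gh x ^ 2 := by
  unfold G gh
  rw [mul_pow, Real.sq_sqrt (by positivity), ← Real.exp_nat_mul]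
  congr 2; push_cast; ring

theorem G_pos (x : Plane) : 0 < G x := by rw [G_eq]; have := gh_pos x; positivity

theorem G_rpow (x : Plane) : (G x) ^ (-(1 / 2) : ℝ) = (gh x)⁻¹ := by
  rw [G_eq, ← Real.rpow_natCast, ← Real.rpow_mul (gh_pos x).le]
  norm_num
  rw [Real.rpow_neg_one]

theorem gh_le_exp (x : Plane) : gh x ≤ Real.exp (-‖x‖ ^ 2 / 8) := by
  unfold gh
  have : Real.sqrt (1 / (4 * Real.pi)) ≤ 1 := by
    rw [Real.sqrt_le_left (by norm_num), one_pow, div_le_one (by positivity)]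
    nlinarith [Real.pi_gt_three]
  nlinarith [Real.exp_pos (-‖x‖ ^ 2 / 8)]

theorem gh_le_one (x : Plane) : gh x ≤ 1 :=
  (gh_le_exp x).trans (Real.exp_le_one_iff.2 (by nlinarith [sq_nonneg ‖x‖]))

theorem G_le_gh (x : Plane) : G x ≤ gh x := by
  rw [G_eq]; nlinarith [gh_pos x, gh_le_one x]

theorem contDiff_gh : ContDiff ℝ ∞ gh := by
  unfold gh
  exact contDiff_const.mul (((contDiff_norm_sq ℝ).neg.div_const 8).exp)

theorem continuous_gh : Continuous gh := contDiff_gh.continuous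

theorem contDiff_gh_inv : ContDiff ℝ ∞ fun x => (gh x)⁻¹ := contDiff_gh.inv gh_ne_zero

theorem G_eq' : G = fun x => gh x ^ 2 := funext G_eq

theorem contDiff_G : ContDiff ℝ ∞ G := by rw [G_eq']; exact contDiff_gh.pow 2

theorem continuous_G : Continuous G := contDiff_G.continuous

theorem pd_G (i : Fin 2) (x : Plane) : pd i G x = -(x i / 2) * G x := by
  have hd : DifferentiableAt ℝ (fun y : Plane => ‖y‖ ^ 2) x :=
    (differentiable_of_smooth (contDiff_norm_sq ℝ)) x
  have h1 : ∀ s : ℝ, HasDerivAt (fun s => 1 / (4 * Real.pi) * Real.exp (-s / 4))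
      (1 / (4 * Real.pi) * (Real.exp (-s / 4) * (-1 / 4))) s := fun s =>
    (((hasDerivAt_id s).neg.div_const 4).exp).const_mul _
  have := pd_comp (φ := fun y : Plane => ‖y‖ ^ 2) (h1 (‖x‖ ^ 2)).differentiableAt hd i
  rw [(h1 _).deriv, pd_norm_sq] at this
  change pd i (fun y => 1 / (4 * Real.pi) * Real.exp (-‖y‖ ^ 2 / 4)) x = _
  rw [this]; unfold G; ring

/-- The Bochner integral of a non-integrable function is zero, whereas the known value of this one
is positive. -/
theorem integrable_exp_neg {c : ℝ} (hc : 0 < c) :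
    Integrable fun x : Plane => Real.exp (-c * ‖x‖ ^ 2) := by
  have := GaussianFourier.integral_rexp_neg_mul_sq_norm (V := Plane) hc
  by_contra h
  rw [integral_undef h] at this
  have : (0 : ℝ) < (Real.pi / c) ^ (Module.finrank ℝ Plane / 2 : ℝ) := by positivity
  linarith

theorem integral_G : ∫ x, G x = 1 := by
  have := GaussianFourier.integral_rexp_neg_mul_sq_norm (V := Plane) (b := 1 / 4) (by norm_num)
  have h2 : ∀ x, G x = 1 / (4 * Real.pi) * Real.exp (-(1 / 4) * ‖x‖ ^ 2) := fun x => by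
    unfold G; congr 2; ring
  simp_rw [h2, integral_const_mul, this]
  simp
  have := Real.pi_pos
  field_simp

theorem one_add_pow_le (k : ℕ) : ∃ C : ℝ, 0 ≤ C ∧ ∀ r : ℝ, 0 ≤ r →
    (1 + r) ^ k ≤ C * Real.exp (r ^ 2 / 16) := by
  -- The `5` comes from `r ≤ r² / 16 + 4`, that is `(r / 4 - 2)² ≥ 0`.
  refine ⟨k.factorial * Real.exp 5, by positivity, fun r hr => ?_⟩
  have h1 := Real.pow_div_factorial_le_exp (1 + r) (by positivity) k
  rw [div_le_iff₀ (by positivity)] at h1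
  have h2 : Real.exp (1 + r) ≤ Real.exp 5 * Real.exp (r ^ 2 / 16) := by
    rw [← Real.exp_add, Real.exp_le_exp]; nlinarith [sq_nonneg (r / 4 - 2)]
  calc (1 + r) ^ k ≤ Real.exp (1 + r) * k.factorial := h1
    _ ≤ (Real.exp 5 * Real.exp (r ^ 2 / 16)) * k.factorial := by gcongr
    _ = _ := by ring

theorem exists_bound_of_tempered {φ : Plane → ℝ} (hφ : φ.HasTemperateGrowth) :
    ∃ C : ℝ, 0 ≤ C ∧ ∀ x, |φ x| ≤ C * Real.exp (‖x‖ ^ 2 / 16) := by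
  obtain ⟨k, C, hC, h⟩ := hφ.norm_iteratedFDeriv_le_uniform 0
  obtain ⟨C', hC', h'⟩ := one_add_pow_le k
  refine ⟨C * C', by positivity, fun x => ?_⟩
  have := h 0 le_rfl x
  rw [norm_iteratedFDeriv_zero, Real.norm_eq_abs] at this
  refine this.trans ?_
  rw [mul_assoc]
  exact mul_le_mul_of_nonneg_left (h' _ (norm_nonneg _)) hC

/-- The Gaussian `e^{-|x|²/16}` which dominates `G^{1/2}` times a tempered function. -/
def gd (x : Plane) : ℝ := Real.exp (-(1 / 16) * ‖x‖ ^ 2)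

theorem gd_pos (x : Plane) : 0 < gd x := Real.exp_pos _

theorem continuous_gd : Continuous gd := by unfold gd; fun_prop

theorem integrable_gd : Integrable gd := integrable_exp_neg (by norm_num)

theorem gd_le_one (x : Plane) : gd x ≤ 1 := by
  unfold gd; rw [Real.exp_le_one_iff]; nlinarith [sq_nonneg ‖x‖]

theorem memLp_gd : MemLp gd 2 := by
  rw [memLp_two_iff_integrable_sq continuous_gd.aestronglyMeasurable]
  refine integrable_gd.mono' (continuous_gd.pow 2).aestronglyMeasurable (ae_of_all _ fun x => ?_)
  rw [Real.norm_of_nonneg (by positivity)]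
  nlinarith [gd_pos x, gd_le_one x]

/-- The decay `e^{-|x|²/8}` of `G^{1/2}` is shared equally: one half absorbs the polynomial growth
of `φ`, the other half, `gd`, is left for integrability. -/
theorem exists_gh_mul_bound {φ : Plane → ℝ} (hφ : φ.HasTemperateGrowth) :
    ∃ C : ℝ, 0 ≤ C ∧ ∀ x, |gh x * φ x| ≤ C * gd x := by
  obtain ⟨C, hC, h⟩ := exists_bound_of_tempered hφ
  refine ⟨C, hC, fun x => ?_⟩
  rw [abs_mul, abs_of_pos (gh_pos x)]
  calc gh x * |φ x| ≤ Real.exp (-‖x‖ ^ 2 / 8) * (C * Real.exp (‖x‖ ^ 2 / 16)) :=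
        mul_le_mul (gh_le_exp x) (h x) (abs_nonneg _) (Real.exp_pos _).le
    _ = C * (Real.exp (-‖x‖ ^ 2 / 8) * Real.exp (‖x‖ ^ 2 / 16)) := by ring
    _ = C * gd x := by rw [← Real.exp_add, gd]; congr 2; ring

theorem memLp_gh_mul {φ : Plane → ℝ} (hφ : φ.HasTemperateGrowth) :
    MemLp (fun x => gh x * φ x) 2 := by
  obtain ⟨C, hC, h⟩ := exists_gh_mul_bound hφ
  refine (memLp_gd.const_mul C).mono (continuous_gh.mul hφ.1.continuous).aestronglyMeasurable
    (ae_of_all _ fun x => ?_)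
  rw [Real.norm_eq_abs, Real.norm_of_nonneg (by have := gd_pos x; positivity)]
  exact h x

theorem integrable_gh_mul {φ : Plane → ℝ} (hφ : φ.HasTemperateGrowth) :
    Integrable (fun x => gh x * φ x) := by
  obtain ⟨C, hC, h⟩ := exists_gh_mul_bound hφ
  exact (integrable_gd.const_mul C).mono' (continuous_gh.mul hφ.1.continuous).aestronglyMeasurable
    (ae_of_all _ h)

theorem integrable_G_mul {φ : Plane → ℝ} (hφ : φ.HasTemperateGrowth) :
    Integrable (fun x => G x * φ x) := by
  refine (integrable_gh_mul hφ).mono (continuous_G.mul hφ.1.continuous).aestronglyMeasurable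
    (ae_of_all _ fun x => ?_)
  rw [norm_mul, norm_mul, Real.norm_of_nonneg (G_pos x).le, Real.norm_of_nonneg (gh_pos x).le]
  exact mul_le_mul_of_nonneg_right (G_le_gh x) (norm_nonneg _)

theorem integrable_G : Integrable G := by
  simpa using integrable_G_mul (φ := fun _ => 1) (by simp)

/-- The adjoint of `∂ᵢ` in `L²(G dx)` is `xᵢ / 2 - ∂ᵢ`. -/
theorem integral_G_pd_mul {φ ψ : Plane → ℝ} (hφ : φ.HasTemperateGrowth)
    (hψ : ψ.HasTemperateGrowth) (i : Fin 2) :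
    ∫ x, G x * (pd i φ x * ψ x) = ∫ x, G x * (φ x * (x i / 2 * ψ x - pd i ψ x)) := by
  have dψ := differentiable_of_smooth hψ.1
  have dφ := differentiable_of_smooth hφ.1
  have dG := differentiable_of_smooth contDiff_G
  have key : ∀ x, pd i (fun x => G x * ψ x) x = G x * (-(x i / 2 * ψ x) + pd i ψ x) := fun x => by
    rw [pd_mul (dG x) (dψ x), pd_G]; ring
  have hx : (fun x : Plane => x i / 2 * ψ x).HasTemperateGrowth := by
    have : (fun x : Plane => x i / 2 * ψ x) = fun x => (x i * (1 / 2)) * ψ x := by ext; ring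
    rw [this]
    exact ((hasTemperateGrowth_coord i).fun_mul (.const _)).fun_mul hψ
  have h := integral_pd_mul dφ (dG.mul dψ) i (ψ := fun x => G x * ψ x) ?_ ?_ ?_
  · calc ∫ x, G x * (pd i φ x * ψ x) = ∫ x, pd i φ x * (G x * ψ x) := by
          congr 1; ext x; ring
      _ = _ := by
          rw [h, ← integral_neg]; congr 1; ext x; rw [key]; ring
  · exact (integrable_G_mul ((hasTemperateGrowth_pd hφ i).fun_mul hψ)).congr
      (ae_of_all _ fun x => by simp; ring)
  · refine (integrable_G_mul (hφ.fun_mul (hx.fun_neg.fun_add (hasTemperateGrowth_pd hψ i)))).congr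
      (ae_of_all _ fun x => ?_)
    simp only []; rw [key]; ring
  · exact (integrable_G_mul (hφ.fun_mul hψ)).congr (ae_of_all _ fun x => by simp; ring)

/-! ### Cut-off functions -/

/-- A smooth bump function equal to `1` on the unit ball, supported in the ball of radius `2`. -/
def bump : ContDiffBump (0 : Plane) := ⟨1, 2, by norm_num, by norm_num⟩

/-- Smooth cut-off functions at scale `R`. -/
def cutoff (R : ℝ) (x : Plane) : ℝ := bump (R⁻¹ • x)

theorem cutoff_nonneg (R : ℝ) (x : Plane) : 0 ≤ cutoff R x := bump.nonneg
theorem cutoff_le_one (R : ℝ) (x : Plane) : cutoff R x ≤ 1 := bump.le_one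
theorem abs_cutoff_le_one (R : ℝ) (x : Plane) : |cutoff R x| ≤ 1 := by
  rw [abs_of_nonneg (cutoff_nonneg R x)]; exact cutoff_le_one R x

theorem contDiff_cutoff (R : ℝ) : ContDiff ℝ ∞ (cutoff R) :=
  bump.contDiff.comp (contDiff_const_smul R⁻¹)

theorem cutoff_eq_one {R : ℝ} (hR : 0 < R) {x : Plane} (hx : ‖x‖ ≤ R) : cutoff R x = 1 := by
  apply bump.one_of_mem_closedBall
  rw [mem_closedBall_zero_iff, norm_smul, norm_inv, Real.norm_of_nonneg hR.le]
  change _ ≤ (1 : ℝ)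
  rw [inv_mul_le_iff₀ hR]; simpa using hx

theorem cutoff_eq_zero {R : ℝ} (hR : 0 < R) {x : Plane} (hx : 2 * R ≤ ‖x‖) : cutoff R x = 0 := by
  apply bump.zero_of_le_dist
  rw [dist_zero_right, norm_smul, norm_inv, Real.norm_of_nonneg hR.le]
  change (2 : ℝ) ≤ _
  rw [le_inv_mul_iff₀ hR]; linarith

theorem isTestFunction_cutoff {R : ℝ} (hR : 0 < R) : IsTestFunction (cutoff R) := by
  refine ⟨contDiff_cutoff R, HasCompactSupport.intro (isCompact_closedBall (0 : Plane) (2 * R))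
    fun x hx => cutoff_eq_zero hR ?_⟩
  rw [mem_closedBall_zero_iff, not_le] at hx; exact hx.le

theorem exists_pd_bump_bound : ∃ C : ℝ, 0 ≤ C ∧ ∀ i x, |pd i bump x| ≤ C := by
  have : ∀ i : Fin 2, ∃ C : ℝ, ∀ x, |pd i bump x| ≤ C := fun i => by
    have h : IsTestFunction bump := ⟨bump.contDiff, bump.hasCompactSupport⟩
    exact (h.pd i).continuous.bounded_above_of_compact_support (h.pd i).2
  choose C hC using this
  refine ⟨|C 0| + |C 1|, by positivity, fun i x => ?_⟩
  have := hC i x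
  fin_cases i
  · exact this.trans ((le_abs_self _).trans (by simp))
  · exact this.trans ((le_abs_self _).trans (by simp))

theorem pd_cutoff (R : ℝ) (i : Fin 2) (x : Plane) : pd i (cutoff R) x = R⁻¹ * pd i bump (R⁻¹ • x) := by
  have h1 : HasFDerivAt bump (fderiv ℝ bump (R⁻¹ • x)) (R⁻¹ • x) :=
    ((bump.contDiff (n := 1)).differentiable (by simp) _).hasFDerivAt
  have h2 : HasFDerivAt (fun y : Plane => R⁻¹ • y) (R⁻¹ • ContinuousLinearMap.id ℝ Plane) x :=
    (hasFDerivAt_id x).const_smul R⁻¹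
  have h3 : fderiv ℝ (cutoff R) x = _ := (h1.comp x h2).fderiv
  simp only [pd]
  rw [h3]; simp

/-- A bound for the gradient of the cut-off functions of scale `1`. -/
def cutoffConst : ℝ := exists_pd_bump_bound.choose

theorem cutoffConst_nonneg : 0 ≤ cutoffConst := exists_pd_bump_bound.choose_spec.1

theorem abs_pd_cutoff_le {R : ℝ} (hR : 0 < R) (i : Fin 2) (x : Plane) :
    |pd i (cutoff R) x| ≤ cutoffConst / R := by
  rw [pd_cutoff, abs_mul, abs_of_pos (by positivity), div_eq_inv_mul]
  exact mul_le_mul_of_nonneg_left (exists_pd_bump_bound.choose_spec.2 i _) (by positivity)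

theorem cutoff_eventually_one (x : Plane) : ∀ᶠ k : ℕ in atTop, cutoff (k + 1) x = 1 := by
  obtain ⟨N, hN⟩ := exists_nat_ge ‖x‖
  filter_upwards [eventually_ge_atTop N] with k hk
  have : (N : ℝ) ≤ k := by exact_mod_cast hk
  exact cutoff_eq_one (by positivity) (by linarith)

theorem tendsto_cutoff (x : Plane) : Tendsto (fun k : ℕ => cutoff (k + 1) x) atTop (𝓝 1) :=
  tendsto_const_nhds.congr' ((cutoff_eventually_one x).mono fun _ h => h.symm)

theorem tendsto_pd_cutoff (i : Fin 2) (x : Plane) :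
    Tendsto (fun k : ℕ => pd i (cutoff (k + 1)) x) atTop (𝓝 0) := by
  refine squeeze_zero_norm (a := fun k : ℕ => cutoffConst * (1 / ((k : ℝ) + 1))) (fun k => ?_) ?_
  · rw [Real.norm_eq_abs, mul_one_div]; exact abs_pd_cutoff_le (by positivity) i x
  · simpa using (tendsto_one_div_add_atTop_nhds_zero_nat (𝕜 := ℝ)).const_mul cutoffConst

theorem abs_pd_cutoff_le' (k : ℕ) (i : Fin 2) (x : Plane) :
    |pd i (cutoff (k + 1)) x| ≤ cutoffConst := by
  refine (abs_pd_cutoff_le (by positivity) i x).trans (div_le_self cutoffConst_nonneg ?_)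
  have : (0 : ℝ) ≤ k := by positivity
  linarith

theorem tendsto_integral_mul_cutoff {F : Plane → ℝ} (hF : Integrable F) :
    Tendsto (fun k : ℕ => ∫ x, F x * cutoff (k + 1) x) atTop (𝓝 (∫ x, F x)) := by
  refine tendsto_integral_of_dominated_convergence (fun x => |F x|) (fun k =>
    hF.aestronglyMeasurable.mul (contDiff_cutoff _).continuous.aestronglyMeasurable) hF.abs
    (fun k => ae_of_all _ fun x => ?_) (ae_of_all _ fun x => ?_)
  · rw [norm_mul, Real.norm_eq_abs, Real.norm_eq_abs]
    exact mul_le_of_le_one_right (abs_nonneg _) (abs_cutoff_le_one _ _)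
  · simpa using (tendsto_cutoff x).const_mul (F x)

theorem tendsto_integral_mul_pd_cutoff {F : Plane → ℝ} (hF : Integrable F) (i : Fin 2) :
    Tendsto (fun k : ℕ => ∫ x, F x * pd i (cutoff (k + 1)) x) atTop (𝓝 0) := by
  have : (0 : ℝ) = ∫ x : Plane, (0 : ℝ) := by simp
  rw [this]
  refine tendsto_integral_of_dominated_convergence (fun x => |F x| * cutoffConst) (fun k =>
    hF.aestronglyMeasurable.mul (contDiff_pd (contDiff_cutoff _) i).continuous.aestronglyMeasurable)
    (hF.abs.mul_const _)
    (fun k => ae_of_all _ fun x => ?_) (ae_of_all _ fun x => ?_)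
  · rw [norm_mul, Real.norm_eq_abs, Real.norm_eq_abs]
    exact mul_le_mul_of_nonneg_left (abs_pd_cutoff_le' _ _ _) (abs_nonneg _)
  · simpa using (tendsto_pd_cutoff i x).const_mul (F x)

/-! ### Hermite polynomials, normalized in `L²(G dx)` -/

/-- The ladder constants `√(m/2)`. -/
def ladder (m : ℕ) : ℝ := Real.sqrt (m / 2)

theorem ladder_sq (m : ℕ) : ladder m ^ 2 = m / 2 := Real.sq_sqrt (by positivity)

theorem ladder_succ_pos (m : ℕ) : 0 < ladder (m + 1) := Real.sqrt_pos.2 (by positivity)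

theorem ladder_zero : ladder 0 = 0 := by simp [ladder]

open Polynomial in
/-- Hermite polynomials, orthonormal for the Gaussian measure of variance `2`. -/
def hermitePoly : ℕ → ℝ[X]
  | 0 => 1
  | m + 1 => C (ladder (m + 1))⁻¹ *
      (C (1 / 2) * X * hermitePoly m - derivative (hermitePoly m))

open Polynomial in
theorem hermitePoly_raise (m : ℕ) :
    C (1 / 2) * X * hermitePoly m - derivative (hermitePoly m)
      = C (ladder (m + 1)) * hermitePoly (m + 1) := by
  rw [hermitePoly, ← mul_assoc, ← C_mul, mul_inv_cancel₀ (ladder_succ_pos m).ne', C_1, one_mul]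

-- The operator `x/2 - d/dx` and the derivative have commutator `1/2`, so lowering follows from
-- raising by induction. The constants close up because `ladder m ^ 2 + 1/2 = ladder (m + 1) ^ 2`.
open Polynomial in
theorem derivative_hermitePoly_succ (m : ℕ) :
    derivative (hermitePoly (m + 1)) = C (ladder (m + 1)) * hermitePoly m := by
  have hc : ∀ m : ℕ, (ladder (m + 1))⁻¹ * ((1 / 2 : ℝ) + ladder m ^ 2) = ladder (m + 1) := by
    intro m
    rw [inv_mul_eq_iff_eq_mul₀ (ladder_succ_pos m).ne', ← sq, ladder_sq, ladder_sq]
    push_cast; ring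
  induction m with
  | zero =>
    have h1 : (ladder (0 + 1))⁻¹ * (1 / 2) = ladder (0 + 1) := by simpa [ladder_zero] using hc 0
    simp only [hermitePoly, derivative_mul, derivative_C, derivative_X,
      derivative_one, zero_add, sub_zero, mul_one, zero_mul]
    rw [← C_mul]; exact congrArg C h1
  | succ m ih =>
    have h1 : derivative (hermitePoly (m + 1 + 1)) = C (ladder (m + 1 + 1))⁻¹ *
      (C (1 / 2) * hermitePoly (m + 1) + C (ladder (m + 1)) *
        (C (1 / 2) * X * hermitePoly m - derivative (hermitePoly m))) := by
      rw [hermitePoly]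
      simp only [derivative_mul, derivative_sub, derivative_C, derivative_X, zero_mul, zero_add,
        mul_one, ih]
      ring
    rw [h1, hermitePoly_raise, ← mul_assoc (C (ladder (m + 1))), ← C_mul, ← add_mul, ← C_add,
      ← mul_assoc, ← C_mul, ← sq, hc]

theorem hasTemperateGrowth_eval (p : Polynomial ℝ) (j : Fin 2) :
    (fun x : Plane => p.eval (x j)).HasTemperateGrowth := by
  induction p using Polynomial.induction_on' with
  | add p q hp hq => simpa using hp.fun_add hq
  | monomial n a =>
    simpa using (Function.HasTemperateGrowth.const a).fun_mul ((hasTemperateGrowth_coord j).fun_pow n)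

theorem pd_eval (p : Polynomial ℝ) (i j : Fin 2) (x : Plane) :
    pd i (fun x : Plane => p.eval (x j)) x
      = (Polynomial.derivative p).eval (x j) * (if i = j then 1 else 0) := by
  rw [pd_comp (g := fun s => p.eval s) p.differentiable.differentiableAt (differentiable_coord j x), pd_coord,
    Polynomial.deriv]

/-- The two-dimensional Hermite polynomials. -/
def hermite (n : Fin 2 → ℕ) (x : Plane) : ℝ :=
  (hermitePoly (n 0)).eval (x 0) * (hermitePoly (n 1)).eval (x 1)

/-- Raise the `i`-th component of a multi-index. -/
def raise (i : Fin 2) (n : Fin 2 → ℕ) : Fin 2 → ℕ := n + Pi.single i 1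

theorem raise_injective (i : Fin 2) : Function.Injective (raise i) :=
  add_left_injective _

theorem exists_eq_raise {i : Fin 2} {n : Fin 2 → ℕ} (h : n i ≠ 0) : ∃ m, n = raise i m := by
  refine ⟨n - Pi.single i 1, funext fun j => ?_⟩
  by_cases hj : j = i
  · subst hj; simp [raise]; omega
  · simp [raise, hj]

theorem hasTemperateGrowth_hermite (n : Fin 2 → ℕ) : (hermite n).HasTemperateGrowth :=
  (hasTemperateGrowth_eval _ 0).fun_mul (hasTemperateGrowth_eval _ 1)

theorem hermite_zero (x : Plane) : hermite 0 x = 1 := by simp [hermite, hermitePoly]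

theorem pd_hermite (i : Fin 2) (n : Fin 2 → ℕ) (x : Plane) : pd i (hermite n) x =
    (Polynomial.derivative (hermitePoly (n 0))).eval (x 0) * (if i = 0 then 1 else 0) *
      (hermitePoly (n 1)).eval (x 1) + (hermitePoly (n 0)).eval (x 0) *
      ((Polynomial.derivative (hermitePoly (n 1))).eval (x 1) * (if i = 1 then 1 else 0)) := by
  have h := fun p j => differentiable_of_smooth (hasTemperateGrowth_eval p j).1 x
  have := pd_mul (h (hermitePoly (n 0)) 0) (h (hermitePoly (n 1)) 1) i
  rw [pd_eval, pd_eval] at this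
  exact this

theorem pd_hermite_raise (i : Fin 2) (n : Fin 2 → ℕ) (x : Plane) :
    pd i (hermite (raise i n)) x = ladder (n i + 1) * hermite n x := by
  rw [pd_hermite]
  fin_cases i <;> simp [raise, derivative_hermitePoly_succ, hermite] <;> ring

theorem pd_hermite_of_eq_zero {i : Fin 2} {n : Fin 2 → ℕ} (h : n i = 0) (x : Plane) :
    pd i (hermite n) x = 0 := by
  rw [pd_hermite]
  fin_cases i <;> simp_all [hermitePoly]

theorem hermite_raise (i : Fin 2) (n : Fin 2 → ℕ) (x : Plane) :
    x i / 2 * hermite n x - pd i (hermite n) x = ladder (n i + 1) * hermite (raise i n) x := by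
  have h := fun m (s : ℝ) => congrArg (Polynomial.eval s) (hermitePoly_raise m)
  simp only [Polynomial.eval_sub, Polynomial.eval_mul, Polynomial.eval_C, Polynomial.eval_X] at h
  rw [pd_hermite]
  fin_cases i
  · simp [raise, hermite]
    linear_combination (hermitePoly (n 1)).eval (x 1) * h (n 0) (x 0)
  · simp [raise, hermite]
    linear_combination (hermitePoly (n 0)).eval (x 0) * h (n 1) (x 1)

theorem integral_hermite_raise (i : Fin 2) (n m : Fin 2 → ℕ) :
    ladder (m i + 1) * ∫ x, G x * (hermite n x * hermite (raise i m) x)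
      = ∫ x, G x * (pd i (hermite n) x * hermite m x) := by
  rw [integral_G_pd_mul (hasTemperateGrowth_hermite n) (hasTemperateGrowth_hermite m),
    ← integral_const_mul]
  simp_rw [hermite_raise]
  congr 1; ext x; ring

/-- Raising one factor is adjoint to differentiating the other, which lowers its degree. Induction
on the total degree thus reduces to the pairs of indices in which some component vanishes on one
side only, where the derivative is zero, and to `n = m = 0`, where `G` has mass one. -/
theorem integral_hermite_mul (n m : Fin 2 → ℕ) :
    ∫ x, G x * (hermite n x * hermite m x) = if n = m then 1 else 0 := by
  have symm : ∀ n m, ∫ x, G x * (hermite n x * hermite m x)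
      = ∫ x, G x * (hermite m x * hermite n x) := fun n m => by
    congr 1; ext x; ring
  have zero : ∀ i n m, n i = 0 → m i ≠ 0 → ∫ x, G x * (hermite n x * hermite m x) = 0 := by
    intro i n m hn hm
    obtain ⟨m, rfl⟩ := exists_eq_raise hm
    have := integral_hermite_raise i n m
    simp only [pd_hermite_of_eq_zero hn, zero_mul, mul_zero, integral_zero] at this
    exact (mul_eq_zero.1 this).resolve_left (ladder_succ_pos _).ne'
  induction hk : n 0 + n 1 using Nat.strong_induction_on generalizing n m with
  | _ k ih =>
  by_cases h : ∃ i, n i ≠ 0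
  · obtain ⟨i, hi⟩ := h
    by_cases hm : m i = 0
    · rw [symm, zero i m n hm hi, if_neg]
      rintro rfl; exact hi hm
    obtain ⟨n, rfl⟩ := exists_eq_raise hi
    obtain ⟨m, rfl⟩ := exists_eq_raise hm
    have key := integral_hermite_raise i (raise i n) m
    simp_rw [pd_hermite_raise] at key
    have e : ∫ x, G x * (ladder (n i + 1) * hermite n x * hermite m x)
        = ladder (n i + 1) * ∫ x, G x * (hermite n x * hermite m x) := by
      rw [← integral_const_mul]; congr 1; ext x; ring
    have ih' := ih (n 0 + n 1) (by rw [← hk]; fin_cases i <;> simp [raise]) n m rfl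
    rw [e, ih'] at key
    by_cases hnm : n = m
    · subst hnm
      simp only [if_true] at key ⊢
      exact mul_left_cancel₀ (ladder_succ_pos _).ne' key
    · rw [if_neg hnm, mul_zero] at key
      rw [if_neg fun h => hnm (raise_injective i h)]
      exact (mul_eq_zero.1 key).resolve_left (ladder_succ_pos _).ne'
  · push Not at h
    have hn : n = 0 := funext h
    by_cases hm : ∃ i, m i ≠ 0
    · obtain ⟨i, hi⟩ := hm
      rw [zero i n m (h i) hi, if_neg]
      rintro rfl; exact hi (h i)
    · push Not at hm
      have hm : m = 0 := funext hm
      subst hn hm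
      simp [hermite_zero, integral_G]

/-- The Hermite functions `G^{1/2} Hₙ` in `L²(ℝ²)`. -/
def hermiteLp (n : Fin 2 → ℕ) : Lp ℝ 2 (volume : Measure Plane) :=
  (memLp_gh_mul (hasTemperateGrowth_hermite n)).toLp

theorem inner_toLp {f g : Plane → ℝ} (hf : MemLp f 2) (hg : MemLp g 2) :
    inner ℝ (hf.toLp f) (hg.toLp g) = ∫ x, f x * g x := by
  rw [L2.inner_def]
  refine integral_congr_ae ?_
  filter_upwards [hf.coeFn_toLp, hg.coeFn_toLp] with x h1 h2
  rw [h1, h2]; simp [mul_comm]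

theorem orthonormal_hermiteLp : Orthonormal ℝ hermiteLp := by
  classical
  rw [orthonormal_iff_ite]
  intro n m
  rw [hermiteLp, hermiteLp, inner_toLp, ← integral_hermite_mul n m]
  congr 1; ext x; rw [G_eq]; ring

theorem integrable_mul_of_memLp {f g : Plane → ℝ} (hf : MemLp f 2) (hg : MemLp g 2) :
    Integrable fun x => f x * g x := hf.integrable_mul hg

/-! ### Completeness of the Hermite functions -/

/-- Multiplication by `x i` is twice the sum of the raising operator and of the derivative, both of
which preserve the span. This puts the powers of `⟨x, t⟩`, hence the Taylor polynomials of the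
characters, in the span. -/
theorem mul_coord_mem_span {q : Plane → ℝ} (hq : q ∈ Submodule.span ℝ (range hermite))
    (i : Fin 2) : (fun x => x i * q x) ∈ Submodule.span ℝ (range hermite) := by
  induction hq using Submodule.span_induction with
  | mem q h =>
    obtain ⟨n, rfl⟩ := h
    have h1 : pd i (hermite n) ∈ Submodule.span ℝ (range hermite) := by
      by_cases hn : n i = 0
      · rw [show pd i (hermite n) = 0 from funext fun x => pd_hermite_of_eq_zero hn x]
        exact zero_mem _
      · obtain ⟨m, rfl⟩ := exists_eq_raise hn
        rw [show pd i (hermite (raise i m)) = ladder (m i + 1) • hermite m from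
          funext fun x => pd_hermite_raise i m x]
        exact Submodule.smul_mem _ _ (Submodule.subset_span ⟨m, rfl⟩)
    have h2 : (fun x : Plane => x i * hermite n x)
        = (2 : ℝ) • (ladder (n i + 1) • hermite (raise i n) + pd i (hermite n)) := by
      ext x
      have := hermite_raise i n x
      simp only [Pi.smul_apply, Pi.add_apply, smul_eq_mul]
      linarith
    rw [h2]
    exact Submodule.smul_mem _ _ (add_mem (Submodule.smul_mem _ _
      (Submodule.subset_span ⟨_, rfl⟩)) h1)
  | zero => simpa using! zero_mem _
  | add p q _ _ hp hq => simpa [mul_add] using! add_mem hp hq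
  | smul a p _ hp =>
    have : (fun x : Plane => x i * (a • p) x) = a • fun x => x i * p x := by
      ext x; simp; ring
    rw [this]; exact Submodule.smul_mem _ _ hp

theorem inner_pow_mem_span (t : Plane) (k : ℕ) :
    (fun x : Plane => (inner ℝ x t) ^ k) ∈ Submodule.span ℝ (range hermite) := by
  induction k with
  | zero =>
    refine Submodule.subset_span ⟨0, funext fun x => ?_⟩
    rw [hermite_zero, pow_zero]
  | succ k ih =>
    have : (fun x : Plane => (inner ℝ x t) ^ (k + 1)) =
        t 0 • (fun x : Plane => x 0 * (inner ℝ x t) ^ k)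
          + t 1 • (fun x : Plane => x 1 * (inner ℝ x t) ^ k) := by
      ext x
      simp only [Pi.add_apply, Pi.smul_apply, smul_eq_mul]
      rw [pow_succ]
      conv_lhs => rw [mul_comm, inner_plane]
      rw [inner_plane]
      ring
    rw [this]
    exact add_mem (Submodule.smul_mem _ _ (mul_coord_mem_span ih 0))
      (Submodule.smul_mem _ _ (mul_coord_mem_span ih 1))

theorem memLp_gh_mul_exp (t : Plane) :
    MemLp (fun x => gh x * Real.exp |inner ℝ x t|) 2 := by
  refine (memLp_gd.const_mul (Real.exp (4 * ‖t‖ ^ 2))).mono ?_ (ae_of_all _ fun x => ?_)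
  · refine (continuous_gh.mul ?_).aestronglyMeasurable
    fun_prop
  · rw [Real.norm_of_nonneg (by have := gh_pos x; positivity),
      Real.norm_of_nonneg (by have := gd_pos x; positivity)]
    refine (mul_le_mul_of_nonneg_right (gh_le_exp x) (Real.exp_pos _).le).trans ?_
    rw [gd, ← Real.exp_add, ← Real.exp_add, Real.exp_le_exp]
    have := abs_real_inner_le_norm x t
    nlinarith [sq_nonneg (‖x‖ / 4 - 2 * ‖t‖)]

/-- The exponential is expanded in its Taylor series, each term of which is orthogonal to `f
G^{1/2}`. The series is dominated by `|f| G^{1/2} e^{|⟨x, t⟩|}`, a product of two square integrable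
functions. -/
theorem integral_cexp_eq_zero {f : Plane → ℝ} (hf : MemLp f 2)
    (h : ∀ n, ∫ x, f x * (gh x * hermite n x) = 0) (t : Plane) :
    ∫ x, ((f x * gh x : ℝ) : ℂ) * Complex.exp ((inner ℝ x t : ℝ) * Complex.I) = 0 := by
  have hspan : ∀ q ∈ Submodule.span ℝ (range hermite), Integrable (fun x => f x * (gh x * q x)) ∧
      ∫ x, f x * (gh x * q x) = 0 := by
    intro q hq
    induction hq using Submodule.span_induction with
    | mem q hq =>
      obtain ⟨n, rfl⟩ := hq
      exact ⟨integrable_mul_of_memLp hf (memLp_gh_mul (hasTemperateGrowth_hermite n)), h n⟩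
    | zero => simp
    | add p q _ _ hp hq =>
      have e : ∀ x, f x * (gh x * (p + q) x) = f x * (gh x * p x) + f x * (gh x * q x) :=
        fun x => by simp; ring
      simp_rw [e]
      exact ⟨hp.1.add hq.1, by rw [integral_add hp.1 hq.1, hp.2, hq.2, add_zero]⟩
    | smul a p _ hp =>
      have e : ∀ x, f x * (gh x * (a • p) x) = a * (f x * (gh x * p x)) :=
        fun x => by simp; ring
      simp_rw [e]
      exact ⟨hp.1.const_mul a, by rw [integral_const_mul, hp.2, mul_zero]⟩
  set F : ℕ → Plane → ℂ := fun k x => ((f x * gh x : ℝ) : ℂ) *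
    (((inner ℝ x t : ℝ) * Complex.I) ^ k / (k.factorial : ℂ)) with hF
  have hmeas : AEStronglyMeasurable (fun x => f x * gh x) volume :=
    hf.aestronglyMeasurable.mul continuous_gh.aestronglyMeasurable
  have hsum := hasSum_integral_of_dominated_convergence (μ := (volume : Measure Plane)) (F := F)
    (f := fun x => ((f x * gh x : ℝ) : ℂ) * Complex.exp ((inner ℝ x t : ℝ) * Complex.I))
    (bound := fun k x => |f x * gh x| * (|inner ℝ x t| ^ k / k.factorial)) ?_ ?_ ?_ ?_ ?_
  · refine hsum.unique ?_
    have : ∀ k, ∫ x, F k x = 0 := fun k => by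
      have e : ∀ x, F k x = (Complex.I ^ k / k.factorial) *
          ((f x * (gh x * (inner ℝ x t) ^ k) : ℝ) : ℂ) := fun x => by
        simp only [hF]; push_cast; ring
      simp_rw [e]
      rw [integral_const_mul, integral_complex_ofReal, (hspan _ (inner_pow_mem_span t k)).2]
      simp
    simp_rw [this]
    exact hasSum_zero
  · intro k
    refine (Complex.continuous_ofReal.comp_aestronglyMeasurable hmeas).mul ?_
    exact Continuous.aestronglyMeasurable (by fun_prop)
  · intro k
    refine ae_of_all _ fun x => ?_
    simp [hF, abs_mul]
  · exact ae_of_all _ fun x => (Real.summable_pow_div_factorial _).mul_left _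
  · have : ∀ x, ∑' k : ℕ, |f x * gh x| * (|inner ℝ x t| ^ k / k.factorial)
        = |f x| * (gh x * Real.exp |inner ℝ x t|) := fun x => by
      rw [tsum_mul_left, abs_mul, abs_of_pos (gh_pos x), Real.exp_eq_exp_ℝ,
        NormedSpace.exp_eq_tsum_div, mul_assoc]
    simp_rw [this]
    exact integrable_mul_of_memLp hf.abs (memLp_gh_mul_exp t)
  · refine ae_of_all _ fun x => ?_
    rw [Complex.exp_eq_exp_ℂ]
    exact (NormedSpace.expSeries_div_hasSum_exp (𝔸 := ℂ) ((inner ℝ x t : ℝ) * Complex.I)).mul_left _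

/-- The positive and negative parts of `g` are densities of two finite measures with the same
characteristic function, so these measures coincide. -/
theorem ae_eq_zero_of_integral_cexp {g : Plane → ℝ} (hg : Integrable g)
    (h : ∀ t : Plane, ∫ x, ((g x : ℝ) : ℂ) * Complex.exp ((inner ℝ x t : ℝ) * Complex.I) = 0) :
    g =ᵐ[volume] 0 := by
  set p : Plane → ℝ≥0∞ := fun x => ENNReal.ofReal (g x)
  set q : Plane → ℝ≥0∞ := fun x => ENNReal.ofReal (-g x)
  have hp : AEMeasurable p := hg.aemeasurable.ennreal_ofReal
  have hq : AEMeasurable q := hg.neg.aemeasurable.ennreal_ofReal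
  have ip : ∫⁻ x, p x ≠ ⊤ := hg.lintegral_lt_top.ne
  have iq : ∫⁻ x, q x ≠ ⊤ := hg.neg.lintegral_lt_top.ne
  have : IsFiniteMeasure (volume.withDensity p) := isFiniteMeasure_withDensity ip
  have : IsFiniteMeasure (volume.withDensity q) := isFiniteMeasure_withDensity iq
  have ibd : ∀ (r : Plane → ℝ) (t : Plane), Integrable r → Integrable fun x =>
      (r x : ℂ) * Complex.exp ((inner ℝ x t : ℝ) * Complex.I) := fun r t hr => by
    refine hr.ofReal.mul_bdd (c := 1) (Continuous.aestronglyMeasurable (by fun_prop))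
      (ae_of_all _ fun x => ?_)
    rw [Complex.norm_exp_ofReal_mul_I]
  have heq : volume.withDensity p = volume.withDensity q := by
    refine Measure.ext_of_charFun (funext fun t => ?_)
    rw [charFun_apply, charFun_apply,
      integral_withDensity_eq_integral_toReal_smul₀ hp (ae_of_all _ fun _ => ENNReal.ofReal_lt_top),
      integral_withDensity_eq_integral_toReal_smul₀ hq (ae_of_all _ fun _ => ENNReal.ofReal_lt_top),
      ← sub_eq_zero, ← integral_sub]
    · rw [← h t]
      congr 1; ext x
      simp only [p, q, ENNReal.toReal_ofReal', Complex.real_smul]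
      rw [← sub_mul, ← Complex.ofReal_sub]
      congr 2
      rcases le_total 0 (g x) with hx | hx
      · rw [max_eq_left hx, max_eq_right (by linarith)]; ring
      · rw [max_eq_right hx, max_eq_left (by linarith)]; ring
    · simpa [p, Complex.real_smul, ENNReal.toReal_ofReal'] using ibd _ t hg.pos_part
    · simpa [q, Complex.real_smul, ENNReal.toReal_ofReal'] using ibd _ t hg.neg_part
  have h2 := (withDensity_eq_iff hp hq ip).1 heq
  filter_upwards [h2] with x hx
  simp only [p, q] at hx
  rcases le_total 0 (g x) with h0 | h0
  · rw [ENNReal.ofReal_of_nonpos (by linarith : -g x ≤ 0), ENNReal.ofReal_eq_zero] at hx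
    exact le_antisymm (by simpa using hx) h0
  · rw [ENNReal.ofReal_of_nonpos h0, eq_comm, ENNReal.ofReal_eq_zero] at hx
    exact le_antisymm h0 (by simpa using hx)

theorem ae_eq_zero_of_integral_hermite {f : Plane → ℝ} (hf : MemLp f 2)
    (h : ∀ n, ∫ x, f x * (gh x * hermite n x) = 0) : f =ᵐ[volume] 0 := by
  have hi : Integrable fun x => f x * gh x := by
    have := integrable_mul_of_memLp hf (memLp_gh_mul (φ := fun _ => 1) (by simp))
    simpa using this
  filter_upwards [ae_eq_zero_of_integral_cexp hi (integral_cexp_eq_zero hf h)] with x hx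
  exact (mul_eq_zero.1 hx).resolve_right (gh_ne_zero x)

/-- The Hermite functions form a Hilbert basis of `L²(ℝ²)`. -/
def hermiteBasis : HilbertBasis (Fin 2 → ℕ) ℝ (Lp ℝ 2 (volume : Measure Plane)) :=
  HilbertBasis.mkOfOrthogonalEqBot orthonormal_hermiteLp (by
    rw [Submodule.eq_bot_iff]
    intro f hf
    have h0 : (f : Plane → ℝ) =ᵐ[volume] 0 := by
      refine ae_eq_zero_of_integral_hermite (Lp.memLp f) fun n => ?_
      have := (Submodule.mem_orthogonal' _ _).1 hf _ (Submodule.subset_span ⟨n, rfl⟩)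
      rw [← Lp.toLp_coeFn f (Lp.memLp f), hermiteLp, inner_toLp] at this
      exact this
    exact (Lp.eq_zero_iff_ae_eq_zero).2 h0)

theorem hermiteBasis_apply (n : Fin 2 → ℕ) : hermiteBasis n = hermiteLp n := by
  rw [hermiteBasis, HilbertBasis.coe_mkOfOrthogonalEqBot]

variable {F : Type*} [NormedAddCommGroup F]

/-! ### The real valued `L²` norm -/

/-- The `L²(ℝ²)` norm as a real number. -/
def l2 (f : Plane → F) : ℝ := (eLpNorm f 2 volume).toReal

theorem l2_nonneg (f : Plane → F) : 0 ≤ l2 f := ENNReal.toReal_nonneg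

theorem l2_sq {f : Plane → F} (hf : MemLp f 2) : l2 f ^ 2 = ∫ x, ‖f x‖ ^ 2 := by
  rw [l2, hf.eLpNorm_eq_integral_rpow_norm (by norm_num) (by norm_num)]
  have : 0 ≤ ∫ x, ‖f x‖ ^ 2 := integral_nonneg fun x => by positivity
  simp only [ENNReal.toReal_ofNat, Real.rpow_ofNat]
  rw [ENNReal.toReal_ofReal (by positivity), ← Real.rpow_natCast, ← Real.rpow_mul this]
  norm_num

theorem l2_add_le {f g : Plane → F} (hf : MemLp f 2) (hg : MemLp g 2) :
    l2 (fun x => f x + g x) ≤ l2 f + l2 g := by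
  rw [l2, l2, l2, ← ENNReal.toReal_add hf.2.ne hg.2.ne]
  exact ENNReal.toReal_mono (ENNReal.add_ne_top.2 ⟨hf.2.ne, hg.2.ne⟩)
    (eLpNorm_add_le hf.1 hg.1 (by norm_num))

theorem l2_sub_le {f g : Plane → F} (hf : MemLp f 2) (hg : MemLp g 2) :
    l2 (fun x => f x - g x) ≤ l2 f + l2 g := by
  rw [l2, l2, l2, ← ENNReal.toReal_add hf.2.ne hg.2.ne]
  exact ENNReal.toReal_mono (ENNReal.add_ne_top.2 ⟨hf.2.ne, hg.2.ne⟩)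
    (eLpNorm_sub_le hf.1 hg.1 (by norm_num))

theorem l2_le_mul {F' : Type*} [NormedAddCommGroup F'] {f : Plane → F}
    {g : Plane → F'} {c : ℝ} (hc : 0 ≤ c)
    (hg : MemLp g 2) (h : ∀ᵐ x, ‖f x‖ ≤ c * ‖g x‖) : l2 f ≤ c * l2 g := by
  have h1 := eLpNorm_le_mul_eLpNorm_of_ae_le_mul h 2
  have := ENNReal.toReal_mono (ENNReal.mul_ne_top ENNReal.ofReal_ne_top hg.2.ne) h1
  rwa [ENNReal.toReal_mul, ENNReal.toReal_ofReal hc] at this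

theorem l2_const_mul (c : ℝ) (f : Plane → ℝ) : l2 (fun x => c * f x) = |c| * l2 f := by
  have := eLpNorm_const_smul c f 2 (volume : Measure Plane)
  rw [l2, l2]
  change (eLpNorm (c • f) 2 volume).toReal = _
  rw [this, ENNReal.toReal_mul]
  simp

theorem abs_integral_mul_le {f g : Plane → ℝ} (hf : MemLp f 2) (hg : MemLp g 2) :
    |∫ x, f x * g x| ≤ l2 f * l2 g := by
  have h := abs_real_inner_le_norm (hf.toLp f) (hg.toLp g)
  rwa [inner_toLp, Lp.norm_toLp, Lp.norm_toLp] at h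

theorem integral_abs_mul_le {f g : Plane → ℝ} (hf : MemLp f 2) (hg : MemLp g 2) :
    ∫ x, |f x * g x| ≤ l2 f * l2 g := by
  have h := abs_integral_mul_le hf.abs hg.abs
  have e : ∀ f : Plane → ℝ, l2 (fun x => |f x|) = l2 f := fun f => by
    rw [l2, l2]; congr 1; exact eLpNorm_norm f
  change _ ≤ l2 (fun x => |f x|) * l2 (fun x => |g x|) at h
  rw [e, e] at h
  simp only [abs_mul]
  exact (le_abs_self _).trans h

/-- Dominated convergence for the squares. The factors `θ k` will be `1 - cutoff`, a derivative of
`cutoff`, or the indicator of the exterior of a large disc. -/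
theorem tendsto_l2_of_dominated [NormedSpace ℝ F] {f : Plane → F} (hf : MemLp f 2)
    {θ : ℕ → Plane → ℝ} {C : ℝ}
    (hθm : ∀ k, AEStronglyMeasurable (θ k) volume) (hθ : ∀ k x, |θ k x| ≤ C)
    (hlim : ∀ x, Tendsto (fun k => θ k x) atTop (𝓝 0)) :
    Tendsto (fun k => l2 fun x => θ k x • f x) atTop (𝓝 0) := by
  have hm : ∀ k, MemLp (fun x => θ k x • f x) 2 := fun k => by
    refine MemLp.of_le_mul (c := C) hf ((hθm k).smul hf.1) (ae_of_all _ fun x => ?_)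
    rw [norm_smul]; exact mul_le_mul_of_nonneg_right (hθ k x) (norm_nonneg _)
  have h2 : Tendsto (fun k => (l2 fun x => θ k x • f x) ^ 2) atTop (𝓝 0) := by
    have e : ∀ k, (l2 fun x => θ k x • f x) ^ 2 = ∫ x, θ k x ^ 2 * ‖f x‖ ^ 2 := fun k => by
      rw [l2_sq (hm k)]
      congr 1; ext x; rw [norm_smul, mul_pow, Real.norm_eq_abs, sq_abs]
    simp_rw [e]
    rw [show (0 : ℝ) = ∫ x : Plane, (0 : ℝ) by simp]
    refine tendsto_integral_of_dominated_convergence (fun x => C ^ 2 * ‖f x‖ ^ 2) (fun k => ?_)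
      ((hf.integrable_norm_pow (by norm_num)).const_mul _) (fun k => ae_of_all _ fun x => ?_)
      (ae_of_all _ fun x => ?_)
    · exact ((hθm k).pow 2).mul (hf.1.norm.pow 2)
    · rw [Real.norm_of_nonneg (by positivity)]
      refine mul_le_mul_of_nonneg_right ?_ (by positivity)
      rw [← sq_abs]; exact pow_le_pow_left₀ (abs_nonneg _) (hθ k x) 2
    · simpa using ((hlim x).pow 2).mul_const (‖f x‖ ^ 2)
  have := h2.sqrt
  simpa [Real.sqrt_sq (l2_nonneg _)] using this

/-! ### The weighted space -/

variable [NormedSpace ℝ F]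

/-- Division by the weight `G^{1/2}`. -/
def wt (f : Plane → F) (x : Plane) : F := (gh x)⁻¹ • f x

theorem wnorm_eq (p : ℝ≥0∞) (f : Plane → F) : wnorm p f = eLpNorm (wt f) p volume := by
  unfold wnorm wt; simp_rw [G_rpow]

theorem memLpw_iff (p : ℝ≥0∞) (f : Plane → F) : MemLpw p f ↔ MemLp (wt f) p volume := by
  unfold MemLpw wt; simp_rw [G_rpow]

/-- The norm of the weighted space `L²_w` as a real number. -/
def nX (f : Plane → F) : ℝ := l2 (wt f)

theorem nX_eq (f : Plane → F) : nX f = (wnorm 2 f).toReal := by rw [wnorm_eq]; rfl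

theorem nX_nonneg (f : Plane → F) : 0 ≤ nX f := l2_nonneg _

theorem gh_smul_wt (f : Plane → F) (x : Plane) : gh x • wt f x = f x := by
  rw [wt, smul_smul, mul_inv_cancel₀ (gh_ne_zero x), one_smul]

theorem wt_sub (f g : Plane → F) : wt (fun x => f x - g x) = fun x => wt f x - wt g x := by
  ext x; simp [wt, smul_sub]

theorem wt_add (f g : Plane → F) : wt (fun x => f x + g x) = fun x => wt f x + wt g x := by
  ext x; simp [wt, smul_add]

theorem MemLpw.sub {p : ℝ≥0∞} {f g : Plane → F} (hf : MemLpw p f) (hg : MemLpw p g) :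
    MemLpw p fun x => f x - g x := by
  rw [memLpw_iff] at *; rw [wt_sub]; exact MemLp.sub hf hg

theorem nX_sub_le {f g : Plane → F} (hf : MemLpw 2 f) (hg : MemLpw 2 g) :
    nX (fun x => f x - g x) ≤ nX f + nX g := by
  rw [memLpw_iff] at *; rw [nX, wt_sub]; exact l2_sub_le hf hg

theorem nX_add_le {f g : Plane → F} (hf : MemLpw 2 f) (hg : MemLpw 2 g) :
    nX (fun x => f x + g x) ≤ nX f + nX g := by
  rw [memLpw_iff] at *; rw [nX, wt_add]; exact l2_add_le hf hg

theorem memLpw_vec_iff {D : Plane → Plane} :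
    MemLpw 2 D ↔ ∀ i, MemLpw 2 fun x => D x i := by
  simp_rw [memLpw_iff, memLp_piLp_iff]; rfl

theorem nX_vec_sq {D : Plane → Plane} (hD : MemLpw 2 D) :
    nX D ^ 2 = nX (fun x => D x 0) ^ 2 + nX (fun x => D x 1) ^ 2 := by
  have hc := fun i => (memLpw_iff 2 _).1 (memLpw_vec_iff.1 hD i)
  rw [nX, nX, nX, l2_sq ((memLpw_iff 2 _).1 hD), l2_sq (hc 0), l2_sq (hc 1), ← integral_add]
  · congr 1; ext x
    rw [norm_sq_plane, Real.norm_eq_abs, Real.norm_eq_abs, sq_abs, sq_abs]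
    simp [wt]
  · exact (hc 0).integrable_norm_pow (by norm_num)
  · exact (hc 1).integrable_norm_pow (by norm_num)

theorem nX_comp_le {D : Plane → Plane} (hD : MemLpw 2 D) (i : Fin 2) :
    nX (fun x => D x i) ≤ nX D := by
  refine le_of_sq_le_sq ?_ (nX_nonneg _)
  rw [nX_vec_sq hD]
  fin_cases i <;> simp <;> positivity

theorem nX_vec_le {D : Plane → Plane} (hD : MemLpw 2 D) :
    nX D ≤ nX (fun x => D x 0) + nX (fun x => D x 1) := by
  refine le_of_sq_le_sq ?_ (add_nonneg (nX_nonneg _) (nX_nonneg _))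
  rw [nX_vec_sq hD]
  nlinarith [nX_nonneg (fun x => D x 0), nX_nonneg (fun x => D x 1)]

theorem MemLpw.memLp {f : Plane → F} (hf : MemLpw 2 f) : MemLp f 2 := by
  rw [memLpw_iff] at hf
  have e : f = fun x => gh x • wt f x := funext fun x => (gh_smul_wt f x).symm
  have hm : AEStronglyMeasurable f volume := by
    rw [e]; exact continuous_gh.aestronglyMeasurable.smul hf.1
  refine hf.mono hm (ae_of_all _ fun x => ?_)
  conv_lhs => rw [← gh_smul_wt f x, norm_smul, Real.norm_of_nonneg (gh_pos x).le]
  exact mul_le_of_le_one_left (norm_nonneg _) (gh_le_one x)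

theorem l2_le_nX {f : Plane → F} (hf : MemLpw 2 f) : l2 f ≤ nX f := by
  have := l2_le_mul (f := f) zero_le_one ((memLpw_iff 2 f).1 hf) (ae_of_all _ fun x => ?_)
  · rwa [one_mul] at this
  · rw [one_mul]
    conv_lhs => rw [← gh_smul_wt f x, norm_smul, Real.norm_of_nonneg (gh_pos x).le]
    exact mul_le_of_le_one_left (norm_nonneg _) (gh_le_one x)

/-- The weight is moved onto the other factor: `w φ = (G^{-1/2} w) (G^{1/2} φ)`. This is what makes
Hermite polynomials admissible against `L²_w`. -/
theorem MemLpw.integrable_mul {w φ : Plane → ℝ} (hw : MemLpw 2 w)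
    (hφ : φ.HasTemperateGrowth) : Integrable fun x => w x * φ x := by
  refine (integrable_mul_of_memLp ((memLpw_iff 2 w).1 hw) (memLp_gh_mul hφ)).congr
    (ae_of_all _ fun x => ?_)
  change _ = w x * φ x
  conv_rhs => rw [← gh_smul_wt w x]
  rw [smul_eq_mul]; ring

theorem MemLpw.integrable {w : Plane → ℝ} (hw : MemLpw 2 w) : Integrable w := by
  simpa using hw.integrable_mul (φ := fun _ => 1) (by simp)

theorem l2_gh : l2 gh = 1 := by
  have h := memLp_gh_mul (φ := fun _ => 1) (by simp)
  simp only [mul_one] at h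
  have := l2_sq h
  simp_rw [Real.norm_eq_abs, sq_abs, ← G_eq, integral_G] at this
  nlinarith [l2_nonneg gh]

theorem memLp_gh : MemLp gh 2 := by
  simpa using memLp_gh_mul (φ := fun _ => 1) (by simp)

theorem integral_abs_le_nX {w : Plane → ℝ} (hw : MemLpw 2 w) : ∫ x, |w x| ≤ nX w := by
  have := integral_abs_mul_le memLp_gh ((memLpw_iff 2 w).1 hw)
  rw [l2_gh, one_mul] at this
  refine le_of_eq_of_le ?_ this
  congr 1; ext x
  rw [← smul_eq_mul, gh_smul_wt]

/-! ### Weak gradients -/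

theorem LocallyIntegrable_comp {g : Plane → Plane} (hg : LocallyIntegrable g volume) (i : Fin 2) :
    LocallyIntegrable (fun x => g x i) volume := fun x => by
  obtain ⟨s, hs, h⟩ := hg x
  exact ⟨s, hs, (integrable_piLp_iff.1 h) i⟩

theorem integrable_mul_gradient {f φ : Plane → ℝ} (hf : LocallyIntegrable f volume)
    (hφ : IsTestFunction φ) : Integrable fun x => f x • (∇ φ) x :=
  hf.integrable_smul_right_of_hasCompactSupport (continuous_gradient hφ.1)
    (hasCompactSupport_gradient hφ.2)

theorem isWeakGradient_iff {f : Plane → ℝ} {g : Plane → Plane} : IsWeakGradient f g ↔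
    LocallyIntegrable f volume ∧ LocallyIntegrable g volume ∧
    ∀ φ, IsTestFunction φ → ∀ i, ∫ x, f x * pd i φ x = - ∫ x, φ x * g x i := by
  have key : LocallyIntegrable f volume → LocallyIntegrable g volume → ∀ φ, IsTestFunction φ →
      ((∫ ξ, f ξ • (∇ φ) ξ = - ∫ ξ, φ ξ • g ξ) ↔
        ∀ i, ∫ x, f x * pd i φ x = - ∫ x, φ x * g x i) := by
    intro hf hg φ hφ
    have h1 := integrable_mul_gradient hf hφ
    have h2 : Integrable fun x => φ x • g x :=
      hg.integrable_smul_left_of_hasCompactSupport hφ.continuous hφ.2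
    have e1 : ∀ i, (∫ ξ, f ξ • (∇ φ) ξ) i = ∫ x, f x * pd i φ x := fun i => by
      rw [eval_integral_piLp (integrable_piLp_iff.1 h1)]
      simp [gradient_apply]
    have e2 : ∀ i, (∫ ξ, φ ξ • g ξ) i = ∫ x, φ x * g x i := fun i => by
      rw [eval_integral_piLp (integrable_piLp_iff.1 h2)]
      simp
    constructor
    · intro h i
      rw [← e1, ← e2, h]; simp
    · intro h
      ext i
      rw [e1, h, ← e2]; simp
  constructor
  · rintro ⟨h1, h2, h3⟩
    exact ⟨h1, h2, fun φ hφ => (key h1 h2 φ hφ).1 (h3 φ hφ)⟩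
  · rintro ⟨h1, h2, h3⟩
    exact ⟨h1, h2, fun φ hφ => (key h1 h2 φ hφ).2 (h3 φ hφ)⟩

/-- A function of `L²_w` whose weak gradient belongs to `L²_w`. -/
structure InV (w : Plane → ℝ) (D : Plane → Plane) : Prop where
  mem : MemLpw 2 w
  memD : MemLpw 2 D
  grad : IsWeakGradient w D

theorem LocallyIntegrable.test_mul {f φ : Plane → ℝ} (hf : LocallyIntegrable f volume)
    (hφ : Continuous φ) (hc : HasCompactSupport φ) : Integrable fun x => f x * φ x :=
  hf.integrable_smul_right_of_hasCompactSupport hφ hc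

theorem IsWeakGradient.sub {f f' : Plane → ℝ} {g g' : Plane → Plane} (h : IsWeakGradient f g)
    (h' : IsWeakGradient f' g') : IsWeakGradient (fun x => f x - f' x) (fun x => g x - g' x) := by
  rw [isWeakGradient_iff] at *
  refine ⟨h.1.sub h'.1, h.2.1.sub h'.2.1, fun φ hφ i => ?_⟩
  have e1 := integral_sub (LocallyIntegrable.test_mul h.1 (hφ.pd i).continuous (hφ.pd i).2)
    (LocallyIntegrable.test_mul h'.1 (hφ.pd i).continuous (hφ.pd i).2)
  have e2 := integral_sub
    (LocallyIntegrable.test_mul (LocallyIntegrable_comp h.2.1 i) hφ.continuous hφ.2)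
    (LocallyIntegrable.test_mul (LocallyIntegrable_comp h'.2.1 i) hφ.continuous hφ.2)
  have c : ∀ g : Plane → Plane, ∫ x, g x i * φ x = ∫ x, φ x * g x i := fun g => by
    congr 1; ext x; ring
  rw [c, c] at e2
  have a1 := h.2.2 φ hφ i
  have a2 := h'.2.2 φ hφ i
  have e3 : ∫ x, φ x * (g x - g' x) i = ∫ x, (g x i * φ x - g' x i * φ x) := by
    congr 1; ext x; simp; ring
  have e4 : ∫ x, (f x - f' x) * pd i φ x = ∫ x, (f x * pd i φ x - f' x * pd i φ x) := by
    congr 1; ext x; ring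
  rw [e3, e4, e1, e2]
  linarith

theorem InV.sub {w w' : Plane → ℝ} {D D' : Plane → Plane} (h : InV w D) (h' : InV w' D') :
    InV (fun x => w x - w' x) (fun x => D x - D' x) :=
  ⟨h.mem.sub h'.mem, h.memD.sub h'.memD, h.grad.sub h'.grad⟩

/-- The weak gradient is tested with `cutoff * φ`. Both `w φ` and `D φ` are integrable, so the term
carrying the derivative of the cut-off disappears in the limit. -/
theorem InV.integral_pd {w : Plane → ℝ} {D : Plane → Plane} (h : InV w D) {φ : Plane → ℝ}
    (hφ : φ.HasTemperateGrowth) (i : Fin 2) :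
    ∫ x, w x * pd i φ x = - ∫ x, D x i * φ x := by
  have dφ := differentiable_of_smooth hφ.1
  have i1 := h.mem.integrable_mul (hasTemperateGrowth_pd hφ i)
  have i2 := h.mem.integrable_mul hφ
  have i3 := (memLpw_vec_iff.1 h.memD i).integrable_mul hφ
  have hk : ∀ k : ℕ, (∫ x, w x * pd i φ x * cutoff (k + 1) x)
      + (∫ x, w x * φ x * pd i (cutoff (k + 1)) x)
      = - ∫ x, D x i * φ x * cutoff (k + 1) x := fun k => by
    have ht := isTestFunction_cutoff (R := k + 1) (by positivity)
    have := (isWeakGradient_iff.1 h.grad).2.2 _ (ht.mul_left hφ.1) i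
    have e1 : ∫ x, cutoff (k + 1) x * φ x * D x i = ∫ x, D x i * φ x * cutoff (k + 1) x := by
      congr 1; ext x; ring
    rw [e1] at this
    rw [← this, ← integral_add]
    · congr 1; ext x
      rw [pd_mul (ht.differentiable x) (dφ x)]; ring
    · exact i1.mul_bdd (c := 1) ht.continuous.aestronglyMeasurable
        (ae_of_all _ fun x => abs_cutoff_le_one _ x)
    · exact i2.mul_bdd (c := cutoffConst) (ht.pd i).continuous.aestronglyMeasurable
        (ae_of_all _ fun x => abs_pd_cutoff_le' k i x)
  have l1 := (tendsto_integral_mul_cutoff i1).add (tendsto_integral_mul_pd_cutoff i2 i)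
  have l2 := (tendsto_integral_mul_cutoff i3).neg
  rw [add_zero] at l1
  exact tendsto_nhds_unique l1 (l2.congr fun k => (hk k).symm)

/-! ### Hermite coefficients -/

/-- The Hermite coefficients of a function of `L²_w`. -/
def coef (w : Plane → ℝ) (n : Fin 2 → ℕ) : ℝ := ∫ x, w x * hermite n x

theorem inner_hermiteBasis {w : Plane → ℝ} (hw : MemLpw 2 w) (n : Fin 2 → ℕ) :
    inner ℝ (hermiteBasis n) (((memLpw_iff 2 w).1 hw).toLp (wt w)) = coef w n := by
  rw [hermiteBasis_apply, hermiteLp, inner_toLp, coef]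
  congr 1; ext x
  conv_rhs => rw [← gh_smul_wt w x]
  simp; ring

theorem hasSum_coef_smul {w : Plane → ℝ} (hw : MemLpw 2 w) :
    HasSum (fun n => coef w n • hermiteLp n) (((memLpw_iff 2 w).1 hw).toLp (wt w)) := by
  have := hermiteBasis.hasSum_repr (((memLpw_iff 2 w).1 hw).toLp (wt w))
  simp only [HilbertBasis.repr_apply_apply, inner_hermiteBasis hw] at this
  simpa only [hermiteBasis_apply] using this

theorem hasSum_coef_sq {w : Plane → ℝ} (hw : MemLpw 2 w) :
    HasSum (fun n => coef w n ^ 2) (nX w ^ 2) := by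
  have h := hermiteBasis.hasSum_inner_mul_inner (((memLpw_iff 2 w).1 hw).toLp (wt w))
    (((memLpw_iff 2 w).1 hw).toLp (wt w))
  have e : ∀ n, inner ℝ (((memLpw_iff 2 w).1 hw).toLp (wt w)) (hermiteBasis n) = coef w n :=
    fun n => by rw [real_inner_comm, inner_hermiteBasis hw]
  simp only [e, inner_hermiteBasis hw, ← sq, real_inner_self_eq_norm_sq, Lp.norm_toLp] at h
  exact h

theorem InV.coef_grad_raise {w : Plane → ℝ} {D : Plane → Plane} (h : InV w D) (i : Fin 2)
    (n : Fin 2 → ℕ) : coef (fun x => D x i) (raise i n) = -(ladder (n i + 1) * coef w n) := by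
  have := h.integral_pd (hasTemperateGrowth_hermite (raise i n)) i
  simp_rw [pd_hermite_raise] at this
  rw [coef, ← neg_eq_iff_eq_neg.2 this, coef, ← integral_const_mul]
  congr 2; ext x; ring

theorem InV.coef_grad_of_eq_zero {w : Plane → ℝ} {D : Plane → Plane} (h : InV w D) (i : Fin 2)
    {n : Fin 2 → ℕ} (hn : n i = 0) : coef (fun x => D x i) n = 0 := by
  have := h.integral_pd (hasTemperateGrowth_hermite n) i
  simp_rw [pd_hermite_of_eq_zero hn] at this
  rw [coef]; simp at this; exact this

theorem mem_range_raise {i : Fin 2} {n : Fin 2 → ℕ} (hn : n ∉ range (raise i)) : n i = 0 := by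
  by_contra h
  obtain ⟨m, rfl⟩ := exists_eq_raise h
  exact hn ⟨m, rfl⟩

/-- Parseval for the `i`-th component of the gradient. Its coefficients vanish off the range of
`raise i` and are `-ladder (n i + 1)` times those of `w` on it, so the sum is reindexed along `raise
i`. -/
theorem InV.hasSum_grad_comp_sq {w : Plane → ℝ} {D : Plane → Plane} (h : InV w D) (i : Fin 2) :
    HasSum (fun n => ((n i + 1 : ℕ) : ℝ) / 2 * coef w n ^ 2) (nX (fun x => D x i) ^ 2) := by
  have h1 := (Function.Injective.hasSum_iff (raise_injective i) (fun n hn => by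
    rw [h.coef_grad_of_eq_zero i (mem_range_raise hn)]; simp)).2
    (hasSum_coef_sq (memLpw_vec_iff.1 h.memD i))
  refine h1.congr_fun fun n => ?_
  simp only [Function.comp, h.coef_grad_raise, neg_sq, mul_pow, ladder_sq]

/-- Subtracting `nX w ^ 2` leaves the weights `(n₀ + n₁)/2`, the eigenvalues of `-𝓛`. All the
coercivity used later comes from this identity. -/
theorem InV.hasSum_grad_sq {w : Plane → ℝ} {D : Plane → Plane} (h : InV w D) :
    HasSum (fun n => ((n 0 : ℝ) + n 1 + 2) / 2 * coef w n ^ 2) (nX D ^ 2) := by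
  rw [nX_vec_sq h.memD]
  refine ((h.hasSum_grad_comp_sq 0).add (h.hasSum_grad_comp_sq 1)).congr_fun fun n => ?_
  push_cast; ring

/-- The weights `(n₀ + n₁ + 2)/2` are at least `1`, even on the zero mode: in `L²_w` a Poincaré
inequality holds without any condition on the mean. -/
theorem InV.nX_le {w : Plane → ℝ} {D : Plane → Plane} (h : InV w D) : nX w ≤ nX D := by
  refine le_of_sq_le_sq ?_ (nX_nonneg _)
  refine hasSum_le (fun n => ?_) (hasSum_coef_sq h.mem) h.hasSum_grad_sq
  have : (0 : ℝ) ≤ n 0 := by positivity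
  have : (0 : ℝ) ≤ n 1 := by positivity
  nlinarith [sq_nonneg (coef w n)]

/-! ### Approximation by test functions -/

/-- The map `σ` is `id` for the partial sums of `w` and `raise i` for those of its derivatives. -/
theorem sum_hermiteLp (S : Finset (Fin 2 → ℕ)) (c : (Fin 2 → ℕ) → ℝ)
    (σ : (Fin 2 → ℕ) → (Fin 2 → ℕ)) (h : MemLp (fun x => gh x * ∑ n ∈ S, c n * hermite (σ n) x) 2) :
    ∑ n ∈ S, c n • hermiteLp (σ n) = h.toLp := by
  classical
  have main : ∀ S : Finset (Fin 2 → ℕ), ((∑ n ∈ S, c n • hermiteLp (σ n) : Lp ℝ 2 volume) : Plane → ℝ)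
      =ᵐ[volume]
      fun x : Plane => gh x * ∑ n ∈ S, c n * hermite (σ n) x := by
    intro S
    induction S using Finset.induction with
    | empty =>
      simp only [Finset.sum_empty, mul_zero]
      exact Lp.coeFn_zero ℝ 2 volume
    | insert a S ha ih =>
      rw [Finset.sum_insert ha]
      filter_upwards [Lp.coeFn_add (c a • hermiteLp (σ a)) (∑ n ∈ S, c n • hermiteLp (σ n)),
        Lp.coeFn_smul (c a) (hermiteLp (σ a)), ih,
        (memLp_gh_mul (hasTemperateGrowth_hermite (σ a))).coeFn_toLp] with x h1 h2 h3 h4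
      rw [h1, Pi.add_apply, h2, h3, Pi.smul_apply, hermiteLp, h4, Finset.sum_insert ha, smul_eq_mul]
      ring
  exact Lp.ext ((main S).trans h.coeFn_toLp.symm)

theorem hasTemperateGrowth_sum (S : Finset (Fin 2 → ℕ)) (c : (Fin 2 → ℕ) → ℝ)
    (σ : (Fin 2 → ℕ) → (Fin 2 → ℕ)) :
    (fun x => ∑ n ∈ S, c n * hermite (σ n) x).HasTemperateGrowth :=
  Function.HasTemperateGrowth.sum fun _ _ =>
    (Function.HasTemperateGrowth.const _).fun_mul (hasTemperateGrowth_hermite _)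

/-- A Hermite partial sum. -/
def partialSum (w : Plane → ℝ) (S : Finset (Fin 2 → ℕ)) (x : Plane) : ℝ :=
  ∑ n ∈ S, coef w n * hermite n x

theorem hasTemperateGrowth_partialSum (w : Plane → ℝ) (S : Finset (Fin 2 → ℕ)) :
    (partialSum w S).HasTemperateGrowth := hasTemperateGrowth_sum S _ id

theorem wt_G_mul (Q : Plane → ℝ) : wt (fun x => G x * Q x) = fun x => gh x * Q x := by
  ext x
  have := gh_ne_zero x
  simp only [wt, smul_eq_mul, G_eq]
  field_simp

theorem tendsto_toReal_of_toLp {ι : Type*} {l : Filter ι} {f : Plane → ℝ} {g : ι → Plane → ℝ}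
    (hf : MemLp f 2) (hg : ∀ k, MemLp (g k) 2)
    (h : Tendsto (fun k => (hg k).toLp (g k)) l (𝓝 (hf.toLp f))) :
    Tendsto (fun k => l2 fun x => f x - g k x) l (𝓝 0) := by
  rw [tendsto_iff_norm_sub_tendsto_zero] at h
  refine h.congr fun k => ?_
  rw [norm_sub_rev, ← MemLp.toLp_sub, Lp.norm_toLp]; rfl

theorem tendsto_nX_partialSum {w : Plane → ℝ} (hw : MemLpw 2 w) :
    Tendsto (fun S => nX fun x => w x - G x * partialSum w S x) atTop (𝓝 0) := by
  have hm := fun S => memLp_gh_mul (hasTemperateGrowth_partialSum w S)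
  have := hasSum_coef_smul hw
  unfold HasSum at this
  simp only [SummationFilter.unconditional_filter] at this
  have h2 := tendsto_toReal_of_toLp ((memLpw_iff 2 w).1 hw) hm
    (this.congr fun S => sum_hermiteLp S (coef w) id (hm S))
  refine h2.congr fun S => ?_
  rw [nX, wt_sub, wt_G_mul]

theorem pd_G_mul {Q : Plane → ℝ} (hQ : Differentiable ℝ Q) (i : Fin 2) (x : Plane) :
    pd i (fun x => G x * Q x) x = G x * (pd i Q x - x i / 2 * Q x) := by
  rw [pd_mul (differentiable_of_smooth contDiff_G x) (hQ x), pd_G]; ring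

theorem pd_G_partialSum (w : Plane → ℝ) (S : Finset (Fin 2 → ℕ)) (i : Fin 2) (x : Plane) :
    pd i (fun x => G x * partialSum w S x) x
      = G x * ∑ n ∈ S, -(ladder (n i + 1) * coef w n) * hermite (raise i n) x := by
  have hd := fun n => differentiable_of_smooth (hasTemperateGrowth_hermite n).1
  rw [pd_G_mul (differentiable_of_smooth (hasTemperateGrowth_partialSum w S).1)]
  congr 1
  unfold partialSum
  rw [pd_sum S (fun n _ => ((hd n) x).const_mul _), Finset.mul_sum, ← Finset.sum_sub_distrib]
  refine Finset.sum_congr rfl fun n _ => ?_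
  rw [pd_const_mul (hd n x)]
  linear_combination (- coef w n) * hermite_raise i n x

/-- Since `∂ᵢ (G Hₙ)` is a multiple of `G` times the raised Hermite polynomial, differentiating a
partial sum of `w` gives a partial sum of its gradient, and convergence is again the expansion in
the Hilbert basis. -/
theorem InV.tendsto_nX_pd_partialSum {w : Plane → ℝ} {D : Plane → Plane} (h : InV w D)
    (i : Fin 2) :
    Tendsto (fun S => nX fun x => D x i - pd i (fun x => G x * partialSum w S x) x) atTop
      (𝓝 0) := by
  have hDi := memLpw_vec_iff.1 h.memD i
  have h1 := (Function.Injective.hasSum_iff (raise_injective i) (fun n hn => by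
    rw [h.coef_grad_of_eq_zero i (mem_range_raise hn), zero_smul])).2 (hasSum_coef_smul hDi)
  have h1 : HasSum (fun n => (-(ladder (n i + 1) * coef w n)) • hermiteLp (raise i n)) _ :=
    h1.congr_fun fun n => by simp only [Function.comp, h.coef_grad_raise]
  unfold HasSum at h1
  simp only [SummationFilter.unconditional_filter] at h1
  have hm := fun S => memLp_gh_mul
    (hasTemperateGrowth_sum S (fun n => -(ladder (n i + 1) * coef w n)) (raise i))
  have h2 := tendsto_toReal_of_toLp ((memLpw_iff 2 _).1 hDi) hm
    (h1.congr fun S => sum_hermiteLp S _ (raise i) (hm S))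
  refine h2.congr fun S => ?_
  simp_rw [pd_G_partialSum]
  rw [nX, wt_sub, wt_G_mul]

theorem memLpw_G_mul {Q : Plane → ℝ} (hQ : Q.HasTemperateGrowth) :
    MemLpw 2 fun x => G x * Q x := by
  rw [memLpw_iff, wt_G_mul]; exact memLp_gh_mul hQ

theorem IsTestFunction.memLpw {φ : Plane → ℝ} (hφ : IsTestFunction φ) : MemLpw 2 φ := by
  rw [memLpw_iff]
  exact (contDiff_gh_inv.continuous.mul hφ.continuous).memLp_of_hasCompactSupport
    (hφ.2.mul_left (f := fun x => (gh x)⁻¹))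

theorem IsTestFunction.isWeakGradient {φ : Plane → ℝ} (hφ : ContDiff ℝ ∞ φ) :
    IsWeakGradient φ (∇ φ) := by
  rw [isWeakGradient_iff]
  refine ⟨hφ.continuous.locallyIntegrable, (continuous_gradient hφ).locallyIntegrable,
    fun ψ hψ i => ?_⟩
  simp_rw [gradient_apply]
  have := integral_pd_mul_test hφ hψ i
  rw [← neg_eq_iff_eq_neg, ← this]
  congr 1; ext x; ring

theorem IsTestFunction.inV {φ : Plane → ℝ} (hφ : IsTestFunction φ) : InV φ (∇ φ) :=
  ⟨hφ.memLpw, memLpw_vec_iff.2 fun i => by simp_rw [gradient_apply]; exact (hφ.pd i).memLpw,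
    IsTestFunction.isWeakGradient hφ.1⟩

theorem hasTemperateGrowth_pd_sub {Q : Plane → ℝ} (hQ : Q.HasTemperateGrowth) (i : Fin 2) :
    (fun x => pd i Q x - x i / 2 * Q x).HasTemperateGrowth := by
  have : (fun x : Plane => pd i Q x - x i / 2 * Q x) = fun x => pd i Q x - (x i * (1 / 2)) * Q x := by
    ext; ring
  rw [this]
  exact (hasTemperateGrowth_pd hQ i).fun_sub
    (((hasTemperateGrowth_coord i).fun_mul (.const _)).fun_mul hQ)

theorem tendsto_nX_cutoff {Q : Plane → ℝ} (hQ : Q.HasTemperateGrowth) :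
    Tendsto (fun k : ℕ => nX fun x => G x * Q x - cutoff (k + 1) x * (G x * Q x)) atTop (𝓝 0) := by
  have := tendsto_l2_of_dominated (memLp_gh_mul hQ) (θ := fun k x => 1 - cutoff (k + 1) x) (C := 1)
    (fun k => (continuous_const.sub (contDiff_cutoff _).continuous).aestronglyMeasurable)
    (fun k x => by
      rw [abs_le]; constructor <;> linarith [cutoff_nonneg (k + 1) x, cutoff_le_one (k + 1) x])
    (fun x => by simpa using (tendsto_cutoff x).const_sub 1)
  refine this.congr fun k => ?_
  rw [nX]; congr 1; ext x
  have := gh_ne_zero x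
  simp only [wt, smul_eq_mul, G_eq]
  field_simp

theorem tendsto_nX_pd_cutoff {Q : Plane → ℝ} (hQ : Q.HasTemperateGrowth) (i : Fin 2) :
    Tendsto (fun k : ℕ => nX fun x => pd i (fun x => G x * Q x) x -
      pd i (fun x => cutoff (k + 1) x * (G x * Q x)) x) atTop (𝓝 0) := by
  have dQ := differentiable_of_smooth hQ.1
  have h1 := tendsto_nX_cutoff (hasTemperateGrowth_pd_sub hQ i)
  have h2 := tendsto_l2_of_dominated (memLp_gh_mul hQ) (θ := fun k x => pd i (cutoff (k + 1)) x)
    (C := cutoffConst)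
    (fun k => (contDiff_pd (contDiff_cutoff _) i).continuous.aestronglyMeasurable)
    (fun k x => abs_pd_cutoff_le' k i x) (fun x => tendsto_pd_cutoff i x)
  have h3 := h1.add h2
  rw [add_zero] at h3
  refine squeeze_zero (fun k => nX_nonneg _) (fun k => ?_) h3
  have ht := isTestFunction_cutoff (R := k + 1) (by positivity)
  have e : (fun x => pd i (fun x => G x * Q x) x - pd i (fun x => cutoff (k + 1) x * (G x * Q x)) x)
    = fun x => (G x * (pd i Q x - x i / 2 * Q x) -
        cutoff (k + 1) x * (G x * (pd i Q x - x i / 2 * Q x)))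
      - pd i (cutoff (k + 1)) x * (G x * Q x) := by
    ext x
    rw [pd_mul (ht.differentiable x)
      ((differentiable_of_smooth contDiff_G x).fun_mul (dQ x)), pd_G_mul dQ]
    ring
  have e2 : (fun x => pd i (cutoff (k + 1)) x • (gh x * Q x))
      = wt fun x => pd i (cutoff (k + 1)) x * (G x * Q x) := by
    ext x
    have := gh_ne_zero x
    simp only [wt, smul_eq_mul, G_eq]
    field_simp
  rw [e, e2]
  refine nX_sub_le ((memLpw_G_mul (hasTemperateGrowth_pd_sub hQ i)).sub ?_) ?_
  · exact (ht.mul_left (contDiff_G.mul (hasTemperateGrowth_pd_sub hQ i).1)).memLpw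
  · exact ((ht.pd i).mul_left (contDiff_G.mul hQ.1)).memLpw

/-- Test functions are dense. -/
theorem InV.exists_test {w : Plane → ℝ} {D : Plane → Plane} (h : InV w D) {ε : ℝ} (hε : 0 < ε) :
    ∃ φ, IsTestFunction φ ∧ nX (fun x => w x - φ x) < ε ∧ nX (fun x => D x - (∇ φ) x) < ε := by
  -- One quarter of `ε` each: the gradient error is a sum over two components of a truncation error
  -- and a cut-off error.
  have a1 := (tendsto_nX_partialSum h.mem).eventually_lt_const (by positivity : 0 < ε / 4)
  have a2 := fun i => (h.tendsto_nX_pd_partialSum i).eventually_lt_const (by positivity : 0 < ε / 4)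
  obtain ⟨S, b1, b2, b3⟩ := (a1.and ((a2 0).and (a2 1))).exists
  have hQ := hasTemperateGrowth_partialSum w S
  set Q := partialSum w S
  have c1 := (tendsto_nX_cutoff hQ).eventually_lt_const (by positivity : 0 < ε / 4)
  have c2 := fun i => (tendsto_nX_pd_cutoff hQ i).eventually_lt_const (by positivity : 0 < ε / 4)
  obtain ⟨k, d1, d2, d3⟩ := (c1.and ((c2 0).and (c2 1))).exists
  have ht := (isTestFunction_cutoff (R := k + 1) (by positivity)).mul_left (contDiff_G.mul hQ.1)
  have mQ := memLpw_G_mul hQ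
  have mQ' : ∀ i, MemLpw 2 (pd i fun x => G x * Q x) := fun i => by
    rw [show (pd i fun x => G x * Q x) = fun x => G x * (pd i Q x - x i / 2 * Q x) from
      funext fun x => pd_G_mul (differentiable_of_smooth hQ.1) i x]
    exact memLpw_G_mul (hasTemperateGrowth_pd_sub hQ i)
  refine ⟨_, ht, ?_, ?_⟩
  · have := nX_add_le (h.mem.sub mQ) (mQ.sub ht.memLpw)
    simp only [sub_add_sub_cancel] at this
    linarith
  · have hD := fun i => memLpw_vec_iff.1 h.memD i
    refine (nX_vec_le (h.memD.sub ht.inV.memD)).trans_lt ?_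
    have := fun i => nX_add_le ((hD i).sub (mQ' i)) ((mQ' i).sub (ht.pd i).memLpw)
    simp only [sub_add_sub_cancel] at this
    simp only [PiLp.sub_apply, gradient_apply]
    linarith [this 0, this 1]

/-! ### A Hardy inequality -/

theorem norm_sub_sq_plane (ξ η : Plane) :
    ‖η - ξ‖ ^ 2 = (η 0 - ξ 0) * (η 0 - ξ 0) + (η 1 - ξ 1) * (η 1 - ξ 1) := by
  rw [norm_sq_plane]; simp; ring

theorem pd_norm_sub_sq (ξ η : Plane) (i : Fin 2) :
    pd i (fun η : Plane => ‖η - ξ‖ ^ 2) η = 2 * (η i - ξ i) := by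
  simp_rw [norm_sub_sq_plane]
  have h := fun j => ((differentiable_coord j) η).sub_const (ξ j)
  have h' : ∀ j, pd i (fun η : Plane => η j - ξ j) η = if i = j then 1 else 0 := fun j => by
    rw [pd_sub (differentiable_coord j η) (differentiableAt_const _), pd_coord, pd_const, sub_zero]
  rw [pd_add ((h 0).fun_mul (h 0)) ((h 1).fun_mul (h 1)), pd_mul (h 0) (h 0),
    pd_mul (h 1) (h 1)]
  simp only [h']
  fin_cases i <;> simp <;> ring

theorem contDiff_norm_sub_sq (ξ : Plane) : ContDiff ℝ ∞ fun η : Plane => ‖η - ξ‖ ^ 2 :=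
  (contDiff_norm_sq ℝ).comp (contDiff_id.sub contDiff_const)

/-- The regularized weight `(|η - ξ|² + δ²)^{-1/2}`. -/
def regInv (δ : ℝ) (ξ η : Plane) : ℝ := (Real.sqrt (‖η - ξ‖ ^ 2 + δ ^ 2))⁻¹

theorem regInv_pos {δ : ℝ} (hδ : 0 < δ) (ξ η : Plane) : 0 < regInv δ ξ η := by
  unfold regInv; positivity

theorem contDiff_regInv {δ : ℝ} (hδ : 0 < δ) (ξ : Plane) : ContDiff ℝ ∞ (regInv δ ξ) := by
  have h : ∀ η : Plane, ‖η - ξ‖ ^ 2 + δ ^ 2 ≠ 0 := fun η => by positivity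
  exact (((contDiff_norm_sub_sq ξ).add contDiff_const).sqrt h).inv
    fun η => (Real.sqrt_pos.2 (by positivity)).ne'

theorem pd_regInv {δ : ℝ} (hδ : 0 < δ) (ξ η : Plane) (i : Fin 2) :
    pd i (regInv δ ξ) η = - (η i - ξ i) * regInv δ ξ η ^ 3 := by
  have hp : 0 < ‖η - ξ‖ ^ 2 + δ ^ 2 := by positivity
  have hg : HasDerivAt (fun t => (Real.sqrt (t + δ ^ 2))⁻¹)
      (-(1 / (2 * Real.sqrt (‖η - ξ‖ ^ 2 + δ ^ 2))) / Real.sqrt (‖η - ξ‖ ^ 2 + δ ^ 2) ^ 2)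
      (‖η - ξ‖ ^ 2) :=
    (((hasDerivAt_id _).add_const (δ ^ 2)).sqrt hp.ne').inv (Real.sqrt_pos.2 hp).ne'
  have := pd_comp (φ := fun η : Plane => ‖η - ξ‖ ^ 2) hg.differentiableAt
    (differentiable_of_smooth (contDiff_norm_sub_sq ξ) η) i
  rw [hg.deriv, pd_norm_sub_sq] at this
  change pd i (regInv δ ξ) η = _ at this
  rw [this, regInv]
  have h := (Real.sqrt_pos.2 hp).ne'
  field_simp

theorem abs_mul_regInv_le {δ : ℝ} (hδ : 0 < δ) (ξ η : Plane) (i : Fin 2) :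
    |(η i - ξ i) * regInv δ ξ η| ≤ 1 := by
  rw [abs_mul, abs_of_pos (regInv_pos hδ ξ η), regInv, ← div_eq_mul_inv,
    div_le_one (by positivity)]
  refine Real.le_sqrt_of_sq_le ?_
  rw [sq_abs, norm_sub_sq_plane]
  fin_cases i <;> simp <;> nlinarith [sq_nonneg (η 0 - ξ 0), sq_nonneg (η 1 - ξ 1), sq_nonneg δ]

/-- With `ρ = regInv δ ξ`, the field `(η - ξ) ρ` has components bounded by `1` and divergence `2ρ -
|η - ξ|² ρ³ ≥ ρ`. Integrating `φ²` against this divergence and moving the derivatives onto `φ²`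
gives the bound. -/
theorem hardy_test {φ : Plane → ℝ} (hφ : IsTestFunction φ) {δ : ℝ} (hδ : 0 < δ) (ξ : Plane) :
    ∫ η, φ η ^ 2 * regInv δ ξ η ≤ 2 * (l2 φ * l2 (pd 0 φ) + l2 φ * l2 (pd 1 φ)) := by
  have hY : ∀ i, ContDiff ℝ ∞ fun η : Plane => (η i - ξ i) * regInv δ ξ η := fun i =>
    ((contDiff_coord i).sub contDiff_const).mul (contDiff_regInv hδ ξ)
  have hφ2 : IsTestFunction fun η => φ η * φ η := hφ.mul_left hφ.1
  have pdY : ∀ i η, pd i (fun η : Plane => (η i - ξ i) * regInv δ ξ η) η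
      = regInv δ ξ η - (η i - ξ i) ^ 2 * regInv δ ξ η ^ 3 := fun i η => by
    rw [pd_mul ((differentiable_coord i η).sub_const _)
      (differentiable_of_smooth (contDiff_regInv hδ ξ) η), pd_regInv hδ,
      pd_sub (differentiable_coord i η) (differentiableAt_const _), pd_coord, pd_const, if_pos rfl]
    ring
  have mem : ∀ {ψ : Plane → ℝ}, IsTestFunction ψ → MemLp ψ 2 := fun h => h.memLpw.memLp
  have step : ∀ i, ∫ η, pd i (fun η : Plane => (η i - ξ i) * regInv δ ξ η) η * (φ η * φ η)
      ≤ 2 * (l2 φ * l2 (pd i φ)) := fun i => by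
    rw [integral_pd_mul_test (hY i) hφ2, ← integral_neg]
    refine le_trans ?_ (mul_le_mul_of_nonneg_left (integral_abs_mul_le (mem hφ) (mem (hφ.pd i)))
      zero_le_two)
    rw [← integral_const_mul]
    refine integral_mono ?_ ((integrable_mul_of_memLp (mem hφ) (mem (hφ.pd i))).abs.const_mul 2)
      fun η => ?_
    · exact (((hφ2.pd i).continuous.mul (hY i).continuous).integrable_of_hasCompactSupport
        (hφ2.pd i).2.mul_right).neg.congr (ae_of_all _ fun η => by simp; ring)
    · simp only []
      rw [pd_mul (hφ.differentiable η) (hφ.differentiable η)]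
      have h := abs_mul_regInv_le hδ ξ η i
      refine (le_abs_self _).trans ?_
      rw [abs_neg, abs_mul, show pd i φ η * φ η + φ η * pd i φ η = 2 * (φ η * pd i φ η) by ring,
        abs_mul 2, abs_two]
      nlinarith [abs_nonneg (φ η * pd i φ η)]
  have hi : ∀ i, Integrable fun η => pd i (fun η : Plane => (η i - ξ i) * regInv δ ξ η) η *
      (φ η * φ η) := fun i =>
    ((contDiff_pd (hY i) i).continuous.mul hφ2.continuous).integrable_of_hasCompactSupport
      hφ2.2.mul_left
  calc ∫ η, φ η ^ 2 * regInv δ ξ η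
      ≤ ∫ η, (pd 0 (fun η : Plane => (η 0 - ξ 0) * regInv δ ξ η) η * (φ η * φ η)
        + pd 1 (fun η : Plane => (η 1 - ξ 1) * regInv δ ξ η) η * (φ η * φ η)) := by
        refine integral_mono ?_ ((hi 0).add (hi 1)) fun η => ?_
        · exact ((hφ2.mul_left (contDiff_regInv hδ ξ)).integrable).congr
            (ae_of_all _ fun η => by simp only []; ring)
        · simp only [pdY]
          have h1 : ((η 0 - ξ 0) ^ 2 + (η 1 - ξ 1) ^ 2) * regInv δ ξ η ^ 2 ≤ 1 := by
            rw [regInv, inv_pow, Real.sq_sqrt (by positivity), ← div_eq_mul_inv,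
              div_le_one (by positivity), norm_sub_sq_plane]
            nlinarith [sq_nonneg δ]
          have h2 := regInv_pos hδ ξ η
          have h3 := mul_le_mul_of_nonneg_right h1 h2.le
          nlinarith [mul_le_mul_of_nonneg_left h3 (sq_nonneg (φ η))]
    _ = _ := integral_add (hi 0) (hi 1)
    _ ≤ _ := by linarith [step 0, step 1]

theorem tendsto_of_dist_le {u : ℕ → ℝ} {a : ℝ} {ε : ℕ → ℝ} (h : ∀ k, |u k - a| ≤ ε k)
    (hε : Tendsto ε atTop (𝓝 0)) : Tendsto u atTop (𝓝 a) := by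
  rw [tendsto_iff_norm_sub_tendsto_zero]
  exact squeeze_zero (fun _ => norm_nonneg _) h hε

/-- Approximation by a sequence of test functions. -/
theorem InV.exists_seq {w : Plane → ℝ} {D : Plane → Plane} (h : InV w D) :
    ∃ φ : ℕ → Plane → ℝ, (∀ k, IsTestFunction (φ k)) ∧
      Tendsto (fun k => nX fun x => w x - φ k x) atTop (𝓝 0) ∧
      Tendsto (fun k => nX fun x => D x - (∇ (φ k)) x) atTop (𝓝 0) := by
  have := fun k : ℕ => h.exists_test (ε := 1 / ((k : ℝ) + 1)) (by positivity)
  choose φ h1 h2 h3 using this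
  have l := tendsto_one_div_add_atTop_nhds_zero_nat (𝕜 := ℝ)
  exact ⟨φ, h1, squeeze_zero (fun k => nX_nonneg _) (fun k => (h2 k).le) l,
    squeeze_zero (fun k => nX_nonneg _) (fun k => (h3 k).le) l⟩

theorem nX_le_add_sub {F : Type*} [NormedAddCommGroup F] [NormedSpace ℝ F] {f g : Plane → F}
    (hf : MemLpw 2 f) (hg : MemLpw 2 g) : nX g ≤ nX f + nX fun x => f x - g x := by
  have := nX_sub_le hf (hf.sub hg)
  simpa using this

theorem l2_le_add_sub {F : Type*} [NormedAddCommGroup F] {f g : Plane → F}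
    (hf : MemLp f 2) (hg : MemLp g 2) : l2 g ≤ l2 f + l2 fun x => f x - g x := by
  have := l2_sub_le hf (hf.sub hg)
  simp only [Pi.sub_apply, sub_sub_cancel] at this
  exact this

/-- For fixed `δ` the weight is bounded by `δ⁻¹`, so both sides pass to the limit along test
functions. The factor `4` is `2` from `hardy_test` times two components, each product being at most
`nX D ^ 2` by `InV.nX_le`. -/
theorem InV.hardy_reg {w : Plane → ℝ} {D : Plane → Plane} (h : InV w D) {δ : ℝ} (hδ : 0 < δ)
    (ξ : Plane) : Integrable (fun η => w η ^ 2 * regInv δ ξ η) ∧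
      ∫ η, w η ^ 2 * regInv δ ξ η ≤ 4 * nX D ^ 2 := by
  have hb : ∀ η, |regInv δ ξ η| ≤ δ⁻¹ := fun η => by
    rw [abs_of_pos (regInv_pos hδ ξ η), regInv]
    refine inv_anti₀ hδ (Real.le_sqrt_of_sq_le ?_)
    nlinarith [sq_nonneg ‖η - ξ‖]
  have hm : AEStronglyMeasurable (regInv δ ξ) volume :=
    (contDiff_regInv hδ ξ).continuous.aestronglyMeasurable
  have int : ∀ {f : Plane → ℝ}, MemLp f 2 → Integrable fun η => f η ^ 2 * regInv δ ξ η :=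
    fun hf => hf.integrable_sq.mul_bdd (c := δ⁻¹) hm (ae_of_all _ hb)
  refine ⟨int h.mem.memLp, ?_⟩
  obtain ⟨φ, h1, h2, h3⟩ := h.exists_seq
  have hw := h.mem.memLp
  have hφ := fun k => (h1 k).memLpw.memLp
  have hsub := fun k => l2_le_nX (h.mem.sub (h1 k).memLpw)
  -- the left-hand side converges
  have e0 : ∀ k, |(∫ η, φ k η ^ 2 * regInv δ ξ η) - ∫ η, w η ^ 2 * regInv δ ξ η|
      ≤ δ⁻¹ * ((nX fun x => w x - φ k x) * (2 * nX w + nX fun x => w x - φ k x)) := fun k => by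
    rw [← integral_sub (int (hφ k)) (int hw)]
    refine (abs_integral_le_integral_abs).trans ?_
    have a := integral_abs_mul_le (hw.sub (hφ k)) (hw.add (hφ k))
    have b1 : l2 (w + φ k) ≤ 2 * nX w + nX fun x => w x - φ k x := by
      have c1 := l2_add_le hw (hφ k)
      have c2 := l2_le_add_sub hw (hφ k)
      have c3 := l2_le_nX h.mem
      change l2 (fun x => w x + φ k x) ≤ _
      linarith [hsub k]
    have b2 : l2 (w - φ k) * l2 (w + φ k) ≤
        (nX fun x => w x - φ k x) * (2 * nX w + nX fun x => w x - φ k x) :=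
      mul_le_mul (hsub k) b1 (l2_nonneg _) (nX_nonneg _)
    refine le_trans ?_ (mul_le_mul_of_nonneg_left (a.trans b2) (by positivity))
    rw [← integral_const_mul]
    refine integral_mono ((int (hφ k)).sub (int hw)).abs
      ((integrable_mul_of_memLp (hw.sub (hφ k)) (hw.add (hφ k))).abs.const_mul _) fun η => ?_
    simp only [Pi.sub_apply, Pi.add_apply]
    rw [← sub_mul, abs_mul, show φ k η ^ 2 - w η ^ 2 = -((w η - φ k η) * (w η + φ k η)) by ring,
      abs_neg, mul_comm]
    exact mul_le_mul_of_nonneg_right (hb η) (abs_nonneg _)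
  have l1 := tendsto_of_dist_le e0 (by
    have := (h2.mul ((tendsto_const_nhds (x := 2 * nX w)).add h2)).const_mul δ⁻¹
    simpa using this)
  -- the right-hand side is bounded
  have e1 : ∀ k, ∫ η, φ k η ^ 2 * regInv δ ξ η
      ≤ 4 * (nX D + nX fun x => D x - (∇ (φ k)) x) ^ 2 := fun k => by
    have hV := (h1 k).inV
    have a : ∀ i, l2 (pd i (φ k)) ≤ nX (∇ (φ k)) := fun i => by
      have := nX_comp_le hV.memD i
      simp_rw [gradient_apply] at this
      exact (l2_le_nX ((h1 k).pd i).memLpw).trans this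
    have b := (l2_le_nX hV.mem).trans hV.nX_le
    have c := nX_le_add_sub h.memD hV.memD
    refine (hardy_test (h1 k) hδ ξ).trans ?_
    have d : ∀ i, l2 (φ k) * l2 (pd i (φ k)) ≤ nX (∇ (φ k)) ^ 2 := fun i => by
      rw [sq]; exact mul_le_mul b (a i) (l2_nonneg _) (nX_nonneg _)
    have e := pow_le_pow_left₀ (nX_nonneg _) c 2
    linarith [d 0, d 1]
  have l2' : Tendsto (fun k => 4 * (nX D + nX fun x => D x - (∇ (φ k)) x) ^ 2) atTop
      (𝓝 (4 * nX D ^ 2)) := by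
    simpa using (((tendsto_const_nhds (x := nX D)).add h3).pow 2).const_mul 4
  exact le_of_tendsto_of_tendsto' l1 l2' e1

/-- The bound on the regularized integral does not depend on `δ`, so Fatou's lemma applies as `δ →
0`; the weights converge away from the null set `{ξ}`. -/
theorem InV.hardy {w : Plane → ℝ} {D : Plane → Plane} (h : InV w D) (ξ : Plane) :
    Integrable (fun η => w η ^ 2 * ‖η - ξ‖⁻¹) ∧ ∫ η, w η ^ 2 * ‖η - ξ‖⁻¹ ≤ 4 * nX D ^ 2 := by
  have hm : AEStronglyMeasurable (fun η => w η ^ 2 * ‖η - ξ‖⁻¹) volume :=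
    (h.mem.memLp.1.pow 2).mul
      (((measurable_id.sub_const ξ).norm).inv.aestronglyMeasurable)
  set δ : ℕ → ℝ := fun k => 1 / ((k : ℝ) + 1)
  have hδ : ∀ k, 0 < δ k := fun k => by positivity
  have hlim : ∀ η, η ≠ ξ →
      Tendsto (fun k => w η ^ 2 * regInv (δ k) ξ η) atTop (𝓝 (w η ^ 2 * ‖η - ξ‖⁻¹)) := by
    intro η hη
    have hn : 0 < ‖η - ξ‖ := norm_pos_iff.2 (sub_ne_zero.2 hη)
    have l := ((((tendsto_one_div_add_atTop_nhds_zero_nat (𝕜 := ℝ)).pow 2).const_add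
      (‖η - ξ‖ ^ 2)).sqrt)
    rw [zero_pow two_ne_zero, add_zero, Real.sqrt_sq hn.le] at l
    exact (l.inv₀ hn.ne').const_mul _
  have key : ∫⁻ η, ENNReal.ofReal (w η ^ 2 * ‖η - ξ‖⁻¹) ≤ ENNReal.ofReal (4 * nX D ^ 2) := by
    calc ∫⁻ η, ENNReal.ofReal (w η ^ 2 * ‖η - ξ‖⁻¹)
        = ∫⁻ η, liminf (fun k => ENNReal.ofReal (w η ^ 2 * regInv (δ k) ξ η)) atTop := by
          refine lintegral_congr_ae ?_
          filter_upwards [compl_mem_ae_iff.2 (measure_singleton ξ)] with η hη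
          exact ((ENNReal.continuous_ofReal.tendsto _).comp (hlim η hη)).liminf_eq.symm
      _ ≤ liminf (fun k => ∫⁻ η, ENNReal.ofReal (w η ^ 2 * regInv (δ k) ξ η)) atTop :=
          lintegral_liminf_le' fun k =>
            ((h.hardy_reg (hδ k) ξ).1.aestronglyMeasurable.aemeasurable).ennreal_ofReal
      _ ≤ ENNReal.ofReal (4 * nX D ^ 2) := by
          refine liminf_le_of_le (by isBoundedDefault) fun b hb => ?_
          obtain ⟨k, hk⟩ := hb.exists
          refine hk.trans ?_
          rw [← ofReal_integral_eq_lintegral_ofReal (h.hardy_reg (hδ k) ξ).1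
            (ae_of_all _ fun η => mul_nonneg (sq_nonneg _) (regInv_pos (hδ k) ξ η).le)]
          exact ENNReal.ofReal_le_ofReal (h.hardy_reg (hδ k) ξ).2
  have hpos : ∀ η, 0 ≤ w η ^ 2 * ‖η - ξ‖⁻¹ := fun η => by positivity
  have hint : Integrable (fun η => w η ^ 2 * ‖η - ξ‖⁻¹) :=
    (lintegral_ofReal_ne_top_iff_integrable hm (ae_of_all _ hpos)).1
      (key.trans_lt ENNReal.ofReal_lt_top).ne
  refine ⟨hint, ?_⟩
  rw [← ofReal_integral_eq_lintegral_ofReal hint (ae_of_all _ hpos)] at key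
  exact (ENNReal.ofReal_le_ofReal_iff (by positivity)).1 key

/-! ### Uniform bound for the Biot-Savart potential -/

/-- In polar coordinates of the plane the Jacobian `r` cancels the singularity. -/
theorem integrable_ball_inv_norm :
    Integrable fun x : Plane => (Iio (1 : ℝ)).indicator (fun r => r⁻¹) ‖x‖ := by
  rw [integrable_fun_norm_addHaar volume (f := (Iio (1 : ℝ)).indicator fun r => r⁻¹)]
  have h1 : IntegrableOn (fun _ : ℝ => (1 : ℝ)) (Ioo 0 1) := by
    simp [integrableOn_const_iff]
  have h2 : Integrable ((Ioo (0 : ℝ) 1).indicator fun _ => (1 : ℝ)) :=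
    (integrable_indicator_iff measurableSet_Ioo).2 h1
  refine h2.integrableOn.congr_fun (fun y (hy : 0 < y) => ?_) measurableSet_Ioi
  simp only [finrank_euclideanSpace, Fintype.card_fin, smul_eq_mul]
  by_cases h : y < 1
  · simp [h, hy]; field_simp
  · simp [h]

/-- `∫_{|x|<1} |x|⁻¹ dx`. -/
def ballConst : ℝ := ∫ x : Plane, (Iio (1 : ℝ)).indicator (fun r => r⁻¹) ‖x‖

theorem indicator_nonneg_inv (x : Plane) : 0 ≤ (Iio (1 : ℝ)).indicator (fun r => r⁻¹) ‖x‖ := by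
  by_cases h : ‖x‖ < 1 <;> simp [h]

theorem measurable_ball_inv : Measurable fun x : Plane => (Iio (1 : ℝ)).indicator (fun r => r⁻¹) ‖x‖ :=
  ((measurable_id.inv).indicator measurableSet_Iio).comp measurable_norm

/-- The constant in the bound of the Biot-Savart potential. -/
def bsConst : ℝ := 2 * Real.sqrt ballConst + 1

theorem bsConst_pos : 0 < bsConst := by unfold bsConst; positivity

/-- On the unit disc around `ξ`, Cauchy-Schwarz is applied to `|w| |η - ξ|^{-1/2}`, controlled by
Hardy, and `|η - ξ|^{-1/2}`, whose square is integrable there. Outside, the kernel is at most `1`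
and the `L¹` norm of `w` suffices. Square integrability of `w` alone would not bound this integral.
-/
theorem InV.potential {w : Plane → ℝ} {D : Plane → Plane} (h : InV w D) (ξ : Plane) :
    Integrable (fun η => |w η| * ‖η - ξ‖⁻¹) ∧ ∫ η, |w η| * ‖η - ξ‖⁻¹ ≤ bsConst * nX D := by
  obtain ⟨hi, hle⟩ := h.hardy ξ
  set f : Plane → ℝ := fun η => |w η| * Real.sqrt ‖η - ξ‖⁻¹
  set g : Plane → ℝ := fun η => Real.sqrt ((Iio (1 : ℝ)).indicator (fun r => r⁻¹) ‖η - ξ‖)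
  have mw : AEStronglyMeasurable (fun η => |w η|) volume :=
    (continuous_abs.comp_aestronglyMeasurable h.mem.memLp.1)
  have mn : Measurable fun η : Plane => ‖η - ξ‖⁻¹ := (measurable_id.sub_const ξ).norm.inv
  have hf : MemLp f 2 := by
    refine (memLp_two_iff_integrable_sq (mw.mul mn.sqrt.aestronglyMeasurable)).2 ?_
    refine hi.congr (ae_of_all _ fun η => ?_)
    change _ = (|w η| * Real.sqrt ‖η - ξ‖⁻¹) ^ 2
    rw [mul_pow, sq_abs, Real.sq_sqrt (by positivity)]
  have hg2 : Integrable fun η : Plane => (Iio (1 : ℝ)).indicator (fun r => r⁻¹) ‖η - ξ‖ :=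
    integrable_ball_inv_norm.comp_sub_right ξ
  have hg : MemLp g 2 := by
    refine (memLp_two_iff_integrable_sq
      (measurable_ball_inv.comp (measurable_id.sub_const ξ)).sqrt.aestronglyMeasurable).2 ?_
    refine hg2.congr (ae_of_all _ fun η => ?_)
    exact (Real.sq_sqrt (indicator_nonneg_inv (η - ξ))).symm
  have lf : l2 f ≤ 2 * nX D := by
    refine le_of_sq_le_sq ?_ (by have := nX_nonneg D; positivity)
    rw [l2_sq hf]
    refine (le_of_eq ?_).trans (hle.trans (by linarith [mul_pow 2 (nX D) 2]))
    congr 1; ext η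
    simp only [f]
    rw [Real.norm_eq_abs, sq_abs, mul_pow, sq_abs, Real.sq_sqrt (by positivity)]
  have lg : l2 g = Real.sqrt ballConst := by
    rw [← Real.sqrt_sq (l2_nonneg g), l2_sq hg, ballConst,
      ← integral_sub_right_eq_self
        (fun x : Plane => (Iio (1 : ℝ)).indicator (fun r => r⁻¹) ‖x‖) ξ]
    congr 2; ext η
    simp only [g]
    rw [Real.norm_eq_abs, sq_abs, Real.sq_sqrt (indicator_nonneg_inv _)]
  have hb : ∀ η, |w η| * ‖η - ξ‖⁻¹ ≤ |f η * g η| + |w η| := fun η => by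
    by_cases hη : ‖η - ξ‖ < 1
    · have : f η * g η = |w η| * ‖η - ξ‖⁻¹ := by
        simp only [f, g]
        rw [indicator_of_mem (by exact hη), mul_assoc, Real.mul_self_sqrt (by positivity)]
      rw [this]
      have := le_abs_self (|w η| * ‖η - ξ‖⁻¹)
      linarith [abs_nonneg (w η)]
    · have : ‖η - ξ‖⁻¹ ≤ 1 := inv_le_one_of_one_le₀ (not_lt.1 hη)
      have := mul_le_mul_of_nonneg_left this (abs_nonneg (w η))
      linarith [abs_nonneg (f η * g η)]
  have ifg := (integrable_mul_of_memLp hf hg).abs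
  have iw := h.mem.integrable.abs
  have hint : Integrable (fun η => |w η| * ‖η - ξ‖⁻¹) :=
    (ifg.add iw).mono' (mw.mul mn.aestronglyMeasurable) (ae_of_all _ fun η => by
      rw [Real.norm_of_nonneg (by positivity)]; exact hb η)
  refine ⟨hint, (integral_mono hint (ifg.add iw) hb).trans ?_⟩
  simp only [Pi.add_apply]
  rw [integral_add ifg iw]
  have a := integral_abs_mul_le hf hg
  have b := (integral_abs_le_nX h.mem).trans h.nX_le
  rw [lg] at a
  have c := mul_le_mul_of_nonneg_right lf (Real.sqrt_nonneg ballConst)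
  unfold bsConst
  nlinarith

/-! ### The Biot-Savart law -/

theorem norm_biotSavartKernel_le (x : Plane) : ‖biotSavartKernel x‖ ≤ ‖x‖⁻¹ := by
  unfold biotSavartKernel
  rw [norm_smul, norm_perp]
  rcases eq_or_ne x 0 with rfl | hx
  · simp
  have hx : 0 < ‖x‖ := norm_pos_iff.2 hx
  rw [Real.norm_of_nonneg (by positivity)]
  have : 1 / (2 * Real.pi) / ‖x‖ ^ 2 * ‖x‖ = (1 / (2 * Real.pi)) * ‖x‖⁻¹ := by
    field_simp
  rw [this]
  refine mul_le_of_le_one_left (by positivity) ?_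
  rw [div_le_one (by positivity)]
  nlinarith [Real.pi_gt_three]

theorem measurable_biotSavartKernel : Measurable biotSavartKernel := by
  unfold biotSavartKernel
  exact (measurable_const.div (measurable_norm.pow_const 2)).smul continuous_perp.measurable

theorem InV.integrable_bs {w : Plane → ℝ} {D : Plane → Plane} (h : InV w D) (ξ : Plane) :
    Integrable fun η => w η • biotSavartKernel (ξ - η) := by
  refine (h.potential ξ).1.mono' (h.mem.memLp.1.smul
    (measurable_biotSavartKernel.comp (measurable_const.sub measurable_id)).aestronglyMeasurable)
    (ae_of_all _ fun η => ?_)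
  rw [norm_smul, Real.norm_eq_abs, ← norm_sub_rev ξ η]
  exact mul_le_mul_of_nonneg_left (norm_biotSavartKernel_le _) (abs_nonneg _)

theorem InV.norm_bs_le {w : Plane → ℝ} {D : Plane → Plane} (h : InV w D) (ξ : Plane) :
    ‖biotSavart w ξ‖ ≤ bsConst * nX D := by
  refine (norm_integral_le_integral_norm _).trans ((integral_mono (h.integrable_bs ξ).norm
    (h.potential ξ).1 fun η => ?_).trans (h.potential ξ).2)
  simp only []
  rw [norm_smul, Real.norm_eq_abs, ← norm_sub_rev ξ η]
  exact mul_le_mul_of_nonneg_left (norm_biotSavartKernel_le _) (abs_nonneg _)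

theorem InV.bs_sub {w w' : Plane → ℝ} {D D' : Plane → Plane} (h : InV w D) (h' : InV w' D')
    (ξ : Plane) : biotSavart (fun x => w x - w' x) ξ = biotSavart w ξ - biotSavart w' ξ := by
  unfold biotSavart
  rw [← integral_sub (h.integrable_bs ξ) (h'.integrable_bs ξ)]
  congr 1; ext1 η; rw [sub_smul]

theorem InV.norm_bs_sub_le {w w' : Plane → ℝ} {D D' : Plane → Plane} (h : InV w D)
    (h' : InV w' D') (ξ : Plane) :
    ‖biotSavart w ξ - biotSavart w' ξ‖ ≤ bsConst * nX fun x => D x - D' x := by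
  rw [← h.bs_sub h']; exact (h.sub h').norm_bs_le ξ

/-! ### The Biot-Savart law for test functions -/

theorem biotSavartKernel_zero_comp (x : Plane) :
    biotSavartKernel x 0 = 1 / (2 * Real.pi) * (-(x 1) * (‖x‖ ^ 2)⁻¹) := by
  simp [biotSavartKernel]; ring

theorem biotSavartKernel_one_comp (x : Plane) :
    biotSavartKernel x 1 = 1 / (2 * Real.pi) * (x 0 * (‖x‖ ^ 2)⁻¹) := by
  simp [biotSavartKernel]; ring

theorem InV.bs_apply {w : Plane → ℝ} {D : Plane → Plane} (h : InV w D) (ξ : Plane) (i : Fin 2) :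
    biotSavart w ξ i = ∫ η, w η * biotSavartKernel (ξ - η) i := by
  unfold biotSavart
  rw [eval_integral_piLp (integrable_piLp_iff.1 (h.integrable_bs ξ))]
  simp

theorem inv_norm_le (x : Plane) : ‖x‖⁻¹ ≤ (Iio (1 : ℝ)).indicator (fun r => r⁻¹) ‖x‖ + 1 := by
  by_cases h : ‖x‖ < 1
  · simp [h]
  · have := inv_le_one_of_one_le₀ (not_lt.1 h)
    simp [h, this]

theorem locallyIntegrable_inv_norm : LocallyIntegrable (fun x : Plane => ‖x‖⁻¹) volume := by
  refine LocallyIntegrable.mono (integrable_ball_inv_norm.locallyIntegrable.add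
    (locallyIntegrable_const (1 : ℝ))) (measurable_norm.inv.aestronglyMeasurable)
    (ae_of_all _ fun x => ?_)
  rw [Real.norm_of_nonneg (by positivity), Pi.add_apply]
  exact (inv_norm_le x).trans (le_abs_self _)

theorem locallyIntegrable_kernel (i : Fin 2) :
    LocallyIntegrable (fun x => biotSavartKernel x i) volume := by
  refine LocallyIntegrable.mono locallyIntegrable_inv_norm
    (((continuous_coord i).measurable.comp measurable_biotSavartKernel).aestronglyMeasurable)
    (ae_of_all _ fun x => ?_)
  rw [norm_inv, norm_norm]
  exact (abs_apply_le_norm _ i).trans (norm_biotSavartKernel_le x)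

theorem bs_eq_convolution {φ : Plane → ℝ} (hφ : IsTestFunction φ) (i : Fin 2) :
    (fun x => biotSavart φ x i) =
      (φ ⋆[ContinuousLinearMap.mul ℝ ℝ, volume] fun x => biotSavartKernel x i) := by
  ext x
  rw [hφ.inV.bs_apply, convolution_def]; rfl

theorem contDiff_bs {φ : Plane → ℝ} (hφ : IsTestFunction φ) (i : Fin 2) :
    ContDiff ℝ ∞ fun x => biotSavart φ x i := by
  rw [bs_eq_convolution hφ]
  exact hφ.2.contDiff_convolution_left (n := ⊤) _ hφ.1 (locallyIntegrable_kernel i)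

theorem pd_bs {φ : Plane → ℝ} (hφ : IsTestFunction φ) (i j : Fin 2) (x : Plane) :
    pd i (fun x => biotSavart φ x j) x = biotSavart (pd i φ) x j := by
  have h := (hφ.2.hasFDerivAt_convolution_left (ContinuousLinearMap.mul ℝ ℝ)
    (hφ.1.of_le (by exact_mod_cast le_top)) (locallyIntegrable_kernel j) x).fderiv
  rw [← bs_eq_convolution hφ] at h
  rw [pd, h, (hφ.pd i).inV.bs_apply, convolution_def, ContinuousLinearMap.integral_apply]
  · rfl
  · exact (hφ.2.fderiv (𝕜 := ℝ)).convolutionExists_left _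
      (hφ.1.fderiv_right (m := ∞) (by simp)).continuous (locallyIntegrable_kernel j) x

/-! ### The kernel is the rotated gradient of a fundamental solution, up to a constant -/

/-- The regularized radial profile `1 / (|y|² + δ²)`. -/
def hk (δ : ℝ) (y : Plane) : ℝ := (‖y‖ ^ 2 + δ ^ 2)⁻¹

theorem contDiff_hk {δ : ℝ} (hδ : 0 < δ) : ContDiff ℝ ∞ (hk δ) :=
  ((contDiff_norm_sq ℝ).add contDiff_const).inv fun y => by positivity

theorem pd_hk {δ : ℝ} (hδ : 0 < δ) (i : Fin 2) (y : Plane) :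
    pd i (hk δ) y = -2 * y i * hk δ y ^ 2 := by
  have hp : 0 < ‖y‖ ^ 2 + δ ^ 2 := by positivity
  have hg : HasDerivAt (fun t => (t + δ ^ 2)⁻¹) (-1 / (‖y‖ ^ 2 + δ ^ 2) ^ 2) (‖y‖ ^ 2) :=
    ((hasDerivAt_id _).add_const (δ ^ 2)).inv hp.ne'
  have := pd_comp (φ := fun y : Plane => ‖y‖ ^ 2) hg.differentiableAt
    (differentiable_of_smooth (contDiff_norm_sq ℝ) y) i
  rw [hg.deriv, pd_norm_sq] at this
  change pd i (hk δ) y = _ at this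
  rw [this, hk]; field_simp

theorem pd_hk_mul {δ : ℝ} (hδ : 0 < δ) (i j : Fin 2) (y : Plane) :
    pd i (fun y => hk δ y * y j) y
      = -2 * y i * hk δ y ^ 2 * y j + hk δ y * (if i = j then 1 else 0) := by
  rw [pd_mul (differentiable_of_smooth (contDiff_hk hδ) y) (differentiable_coord j y), pd_hk hδ,
    pd_coord]

theorem integral_hk_mul {δ : ℝ} (hδ : 0 < δ) {ψ : Plane → ℝ} (hψ : IsTestFunction ψ)
    (i j : Fin 2) : ∫ y, hk δ y * y j * pd i ψ y
      = - ∫ y, (-2 * y i * hk δ y ^ 2 * y j + hk δ y * (if i = j then 1 else 0)) * ψ y := by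
  have := integral_pd_mul_test ((contDiff_hk hδ).mul (contDiff_coord j)) hψ i
  simp_rw [pd_hk_mul hδ] at this
  rw [this, neg_neg]

theorem tendsto_integral_hk_mul {ψ : Plane → ℝ} (hψ : IsTestFunction ψ) (j : Fin 2) :
    Tendsto (fun k : ℕ => ∫ y, hk (1 / ((k : ℝ) + 1)) y * y j * ψ y) atTop
      (𝓝 (∫ y, y j * (‖y‖ ^ 2)⁻¹ * ψ y)) := by
  refine tendsto_integral_of_dominated_convergence (fun y => ‖y‖⁻¹ * |ψ y|) (fun k => ?_) ?_
    (fun k => ae_of_all _ fun y => ?_) (ae_of_all _ fun y => ?_)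
  · exact (((contDiff_hk (by positivity)).continuous.mul (continuous_coord j)).mul
      hψ.continuous).aestronglyMeasurable
  · exact locallyIntegrable_inv_norm.integrable_smul_right_of_hasCompactSupport
      hψ.continuous.abs hψ.2.abs
  · rw [norm_mul, Real.norm_eq_abs, Real.norm_eq_abs]
    refine mul_le_mul_of_nonneg_right ?_ (abs_nonneg _)
    rw [abs_mul, abs_of_pos (by unfold hk; positivity), hk]
    rcases eq_or_ne y 0 with rfl | hy
    · simp
    have hy : 0 < ‖y‖ := norm_pos_iff.2 hy
    calc (‖y‖ ^ 2 + (1 / ((k : ℝ) + 1)) ^ 2)⁻¹ * |y j| ≤ (‖y‖ ^ 2)⁻¹ * ‖y‖ := by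
          refine mul_le_mul (inv_anti₀ (by positivity) ?_) (abs_apply_le_norm y j)
            (abs_nonneg _) (by positivity)
          have : 0 ≤ (1 / ((k : ℝ) + 1)) ^ 2 := by positivity
          linarith
      _ = ‖y‖⁻¹ := by field_simp
  · rcases eq_or_ne y 0 with rfl | hy
    · simp
    have hy : 0 < ‖y‖ := norm_pos_iff.2 hy
    have l := ((tendsto_one_div_add_atTop_nhds_zero_nat (𝕜 := ℝ)).pow 2).const_add (‖y‖ ^ 2)
    rw [zero_pow two_ne_zero, add_zero] at l
    have := ((l.inv₀ (by positivity)).mul_const (y j)).mul_const (ψ y)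
    rw [mul_comm (y j)]
    exact this

theorem integrable_hk_mul {δ : ℝ} (hδ : 0 < δ) {ψ f : Plane → ℝ} (hψ : IsTestFunction ψ)
    (hf : Continuous f) : Integrable fun y => hk δ y * f y * ψ y :=
  (((contDiff_hk hδ).continuous.mul hf).mul hψ.continuous).integrable_of_hasCompactSupport
    hψ.2.mul_left

theorem integral_kernel_zero (ψ : Plane → ℝ) : ∫ y, biotSavartKernel y 0 * ψ y =
    -(1 / (2 * Real.pi)) * ∫ y, y 1 * (‖y‖ ^ 2)⁻¹ * ψ y := by
  rw [← integral_const_mul]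
  congr 1; ext y; rw [biotSavartKernel_zero_comp]; ring

theorem integral_kernel_one (ψ : Plane → ℝ) : ∫ y, biotSavartKernel y 1 * ψ y =
    1 / (2 * Real.pi) * ∫ y, y 0 * (‖y‖ ^ 2)⁻¹ * ψ y := by
  rw [← integral_const_mul]
  congr 1; ext y; rw [biotSavartKernel_one_comp]; ring

/-- The kernel is approximated by a multiple of `hk δ y • perp y`, which is divergence free because
the mixed derivatives `-2 yᵢ yⱼ hk²` are symmetric in `i` and `j`. -/
theorem kernel_div {ψ : Plane → ℝ} (hψ : IsTestFunction ψ) :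
    (∫ y, biotSavartKernel y 0 * pd 0 ψ y) + ∫ y, biotSavartKernel y 1 * pd 1 ψ y = 0 := by
  have l := (tendsto_integral_hk_mul (hψ.pd 1) 0).sub (tendsto_integral_hk_mul (hψ.pd 0) 1)
  have z : ∀ k : ℕ, (∫ y, hk (1 / ((k : ℝ) + 1)) y * y 0 * pd 1 ψ y) -
      ∫ y, hk (1 / ((k : ℝ) + 1)) y * y 1 * pd 0 ψ y = 0 := fun k => by
    rw [integral_hk_mul (by positivity) hψ, integral_hk_mul (by positivity) hψ, sub_eq_zero]
    congr 2; ext y; simp only [zero_ne_one, one_ne_zero, if_false]; ring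
  simp_rw [z] at l
  have := tendsto_nhds_unique l tendsto_const_nhds
  rw [integral_kernel_zero, integral_kernel_one]
  linear_combination (1 / (2 * Real.pi)) * this

theorem integrable_inv_one_add_sq : Integrable fun z : Plane => ((1 + ‖z‖ ^ 2) ^ 2)⁻¹ := by
  have := integrable_rpow_neg_one_add_norm_sq (E := Plane) (μ := volume) (r := 4) (by simp; norm_num)
  refine this.congr (ae_of_all _ fun z => ?_)
  simp only []
  rw [show (-4 / 2 : ℝ) = -(2 : ℕ) by norm_num, Real.rpow_neg (by positivity), Real.rpow_natCast]

/-- The (normalization) constant `κ` such that `curl (K_BS ⋆ φ) = κ φ`. -/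
def curlConst : ℝ := 1 / Real.pi * ∫ z : Plane, ((1 + ‖z‖ ^ 2) ^ 2)⁻¹

theorem curlConst_nonneg : 0 ≤ curlConst :=
  mul_nonneg (by positivity) (integral_nonneg fun z => by positivity)

/-- The curl of the rotated field is the divergence of `hk δ y • y`, which equals `2 δ² hk²`: an
approximate Dirac mass of fixed total mass. The substitution `y = δ z` turns it into `(1 + |z|²)⁻²`
against `ψ (δ z)`, and `δ → 0` is dominated convergence. The mass is left unevaluated in
`curlConst`, of which only the nonnegativity is needed. -/
theorem kernel_curl {ψ : Plane → ℝ} (hψ : IsTestFunction ψ) :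
    (∫ y, biotSavartKernel y 1 * pd 0 ψ y) - ∫ y, biotSavartKernel y 0 * pd 1 ψ y
      = - curlConst * ψ 0 := by
  have l := (tendsto_integral_hk_mul (hψ.pd 0) 0).add (tendsto_integral_hk_mul (hψ.pd 1) 1)
  have z : ∀ k : ℕ, (∫ y, hk (1 / ((k : ℝ) + 1)) y * y 0 * pd 0 ψ y) +
      ∫ y, hk (1 / ((k : ℝ) + 1)) y * y 1 * pd 1 ψ y
      = -2 * ∫ z, ((1 + ‖z‖ ^ 2) ^ 2)⁻¹ * ψ ((1 / ((k : ℝ) + 1)) • z) := fun k => by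
    set δ : ℝ := 1 / ((k : ℝ) + 1) with hδ
    have hδ0 : 0 < δ := by positivity
    have sc := Measure.integral_comp_smul (volume : Measure Plane)
      (fun y => δ ^ 2 * hk δ y ^ 2 * ψ y) δ
    have e1 : ∀ x : Plane, δ ^ 2 * hk δ (δ • x) ^ 2 * ψ (δ • x)
        = (δ ^ 2)⁻¹ * (((1 + ‖x‖ ^ 2) ^ 2)⁻¹ * ψ (δ • x)) := fun x => by
      rw [hk, norm_smul, Real.norm_of_nonneg hδ0.le]
      have : (0 : ℝ) < 1 + ‖x‖ ^ 2 := by positivity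
      have e : (δ * ‖x‖) ^ 2 + δ ^ 2 = δ ^ 2 * (1 + ‖x‖ ^ 2) := by ring
      rw [e]; field_simp
    simp_rw [e1] at sc
    rw [integral_const_mul] at sc
    simp only [finrank_euclideanSpace, Fintype.card_fin, smul_eq_mul] at sc
    rw [abs_of_pos (by positivity)] at sc
    have sc := mul_left_cancel₀ (by positivity) sc
    rw [sc, integral_hk_mul hδ0 hψ, integral_hk_mul hδ0 hψ, ← neg_add, ← integral_add,
      ← integral_const_mul, ← integral_neg]
    · congr 1; ext y
      have hp : 0 < ‖y‖ ^ 2 + δ ^ 2 := by positivity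
      have : hk δ y = hk δ y ^ 2 * (y 0 ^ 2 + y 1 ^ 2 + δ ^ 2) := by
        rw [← norm_sq_plane, hk]; field_simp
      simp only [if_true]
      linear_combination (-2 * ψ y) * this
    · have := integrable_hk_mul hδ0 hψ (f := fun y => -2 * y 0 * hk δ y * y 0 + 1)
        ((((continuous_const.mul (continuous_coord 0)).mul (contDiff_hk hδ0).continuous).mul
          (continuous_coord 0)).add continuous_const)
      exact this.congr (ae_of_all _ fun y => by simp only [if_true]; ring)
    · have := integrable_hk_mul hδ0 hψ (f := fun y => -2 * y 1 * hk δ y * y 1 + 1)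
        ((((continuous_const.mul (continuous_coord 1)).mul (contDiff_hk hδ0).continuous).mul
          (continuous_coord 1)).add continuous_const)
      exact this.congr (ae_of_all _ fun y => by simp only [if_true]; ring)
  simp_rw [z] at l
  have l2 : Tendsto (fun k : ℕ => -2 * ∫ z : Plane, ((1 + ‖z‖ ^ 2) ^ 2)⁻¹ *
      ψ ((1 / ((k : ℝ) + 1)) • z)) atTop
      (𝓝 (-2 * ∫ z : Plane, ((1 + ‖z‖ ^ 2) ^ 2)⁻¹ * ψ 0)) := by
    refine Tendsto.const_mul _ ?_
    obtain ⟨C, hC⟩ := hψ.continuous.bounded_above_of_compact_support hψ.2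
    refine tendsto_integral_of_dominated_convergence (fun z => ((1 + ‖z‖ ^ 2) ^ 2)⁻¹ * C)
      (fun k => ?_) (integrable_inv_one_add_sq.mul_const C) (fun k => ae_of_all _ fun z => ?_)
      (ae_of_all _ fun z => ?_)
    · exact integrable_inv_one_add_sq.aestronglyMeasurable.mul
        (hψ.continuous.comp (continuous_const_smul _)).aestronglyMeasurable
    · rw [norm_mul, Real.norm_of_nonneg (by positivity)]
      exact mul_le_mul_of_nonneg_left (hC _) (by positivity)
    · have := (tendsto_one_div_add_atTop_nhds_zero_nat (𝕜 := ℝ)).smul_const z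
      rw [zero_smul] at this
      exact ((hψ.continuous.tendsto 0).comp this).const_mul _
  have := tendsto_nhds_unique l l2
  rw [integral_kernel_zero, integral_kernel_one, curlConst]
  rw [integral_mul_const] at this
  linear_combination (1 / (2 * Real.pi)) * this

theorem pd_reflect {φ : Plane → ℝ} (hφ : Differentiable ℝ φ) (i : Fin 2) (x y : Plane) :
    pd i (fun y => φ (x - y)) y = - pd i φ (x - y) := by
  have h1 : HasFDerivAt (fun y : Plane => x - y) (-ContinuousLinearMap.id ℝ Plane) y := by
    simpa using (hasFDerivAt_id y).const_sub x
  have := ((hφ (x - y)).hasFDerivAt.comp y h1).fderiv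
  change fderiv ℝ (fun y => φ (x - y)) y = _ at this
  rw [pd, this]; simp [pd]

theorem IsTestFunction.reflect {φ : Plane → ℝ} (hφ : IsTestFunction φ) (x : Plane) :
    IsTestFunction fun y => φ (x - y) :=
  ⟨hφ.1.comp (contDiff_const.sub contDiff_id), hφ.2.comp_homeomorph (Homeomorph.subLeft x)⟩

theorem bs_apply_reflect {φ : Plane → ℝ} (hφ : IsTestFunction φ) (i j : Fin 2) (x : Plane) :
    biotSavart (pd i φ) x j = - ∫ y, biotSavartKernel y j * pd i (fun y => φ (x - y)) y := by
  rw [(hφ.pd i).inV.bs_apply, ← integral_sub_left_eq_self _ volume x, ← integral_neg]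
  congr 1; ext y
  rw [pd_reflect hφ.differentiable, sub_sub_cancel]; ring

theorem bs_div {φ : Plane → ℝ} (hφ : IsTestFunction φ) (x : Plane) :
    biotSavart (pd 0 φ) x 0 + biotSavart (pd 1 φ) x 1 = 0 := by
  rw [bs_apply_reflect hφ, bs_apply_reflect hφ]
  linear_combination - kernel_div (hφ.reflect x)

theorem bs_curl {φ : Plane → ℝ} (hφ : IsTestFunction φ) (x : Plane) :
    biotSavart (pd 0 φ) x 1 - biotSavart (pd 1 φ) x 0 = curlConst * φ x := by
  rw [bs_apply_reflect hφ, bs_apply_reflect hφ]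
  have := kernel_curl (hφ.reflect x)
  simp only [sub_zero] at this
  linear_combination - this

/-! ### A Caccioppoli inequality -/

theorem integrable_test_mul {χ f : Plane → ℝ} (hχ : IsTestFunction χ) (hf : Continuous f) :
    Integrable fun x => χ x * f x :=
  (hχ.continuous.mul hf).integrable_of_hasCompactSupport hχ.2.mul_right

/-- The second derivative of `u` is integrated by parts against `χ² u`; the cross term is absorbed
through `(χ ∂ᵢu + 2 u ∂ᵢχ)² ≥ 0`. -/
theorem caccioppoli {u χ : Plane → ℝ} (hu : ContDiff ℝ ∞ u) (hχ : IsTestFunction χ) (i : Fin 2) :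
    ∫ x, χ x * (χ x * pd i u x ^ 2) ≤ -2 * (∫ x, χ x * (χ x * u x * pd i (pd i u) x))
      + 4 * ∫ x, pd i χ x * (pd i χ x * u x ^ 2) := by
  have du := differentiable_of_smooth hu
  have cu := hu.continuous
  have cpu := (contDiff_pd hu i).continuous
  have ht : IsTestFunction fun x => χ x * (χ x * u x) := hχ.mul_left (hχ.1.mul hu)
  have key := integral_pd_mul_test (contDiff_pd hu i) ht i
  have e : ∀ x, pd i u x * pd i (fun x => χ x * (χ x * u x)) x
      = pd i χ x * (2 * χ x * u x * pd i u x) + χ x * (χ x * pd i u x ^ 2) := fun x => by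
    rw [pd_mul (hχ.differentiable x) ((hχ.differentiable x).fun_mul (du x)),
      pd_mul (hχ.differentiable x) (du x)]
    ring
  simp_rw [e] at key
  have i1 : Integrable fun x => pd i χ x * (2 * χ x * u x * pd i u x) + χ x * (χ x * pd i u x ^ 2) :=
    (integrable_test_mul (hχ.pd i)
      (((continuous_const (y := (2 : ℝ))).mul hχ.continuous).mul cu |>.mul cpu)).add
      (integrable_test_mul hχ (hχ.continuous.mul (cpu.pow 2)))
  have i2 : Integrable fun x => χ x * (χ x * pd i u x ^ 2) :=
    integrable_test_mul hχ (hχ.continuous.mul (cpu.pow 2))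
  have i3 : Integrable fun x => pd i χ x * (pd i χ x * u x ^ 2) :=
    integrable_test_mul (hχ.pd i) ((hχ.pd i).continuous.mul (cu.pow 2))
  have e2 : ∫ x, pd i (pd i u) x * (χ x * (χ x * u x)) = ∫ x, χ x * (χ x * u x * pd i (pd i u) x) := by
    congr 1; ext x; ring
  rw [e2] at key
  rw [key]
  have : ∫ x, χ x * (χ x * pd i u x ^ 2) ≤ ∫ x, (2 * (pd i χ x * (2 * χ x * u x * pd i u x)
      + χ x * (χ x * pd i u x ^ 2)) + 4 * (pd i χ x * (pd i χ x * u x ^ 2))) := by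
    refine integral_mono i2 ((i1.const_mul 2).add (i3.const_mul 4)) fun x => ?_
    simp only []
    nlinarith [sq_nonneg (χ x * pd i u x + 2 * (pd i χ x * u x))]
  refine this.trans (le_of_eq ?_)
  rw [integral_add (i1.const_mul 2) (i3.const_mul 4), integral_const_mul,
    integral_const_mul]
  ring

/-! ### Square integrability of the velocity gradient -/

theorem exists_cutoff_eq_one {φ : Plane → ℝ} (hφ : HasCompactSupport φ) :
    ∃ R₀ : ℝ, 0 < R₀ ∧ ∀ x, R₀ ≤ ‖x‖ → φ x = 0 := by
  obtain ⟨R, hR⟩ := hφ.isCompact.isBounded.exists_norm_le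
  refine ⟨|R| + 1, by positivity, fun x hx => ?_⟩
  by_contra h
  have := hR x (subset_tsupport _ h)
  linarith [le_abs_self R]

theorem bs_decay {φ : Plane → ℝ} (hφ : IsTestFunction φ) {R₀ R : ℝ} (hR₀ : 0 < R₀)
    (h0 : ∀ x, R₀ ≤ ‖x‖ → φ x = 0) (hR : 2 * R₀ ≤ R) {x : Plane} (hx : R ≤ ‖x‖) :
    ‖biotSavart φ x‖ ≤ 2 / R * ∫ y, |φ y| := by
  unfold biotSavart
  refine (norm_integral_le_integral_norm _).trans ?_
  rw [← integral_const_mul]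
  refine integral_mono (hφ.inV.integrable_bs x).norm (hφ.integrable.abs.const_mul _) fun y => ?_
  simp only []
  rw [norm_smul, Real.norm_eq_abs, mul_comm]
  rcases le_or_gt R₀ ‖y‖ with hy | hy
  · rw [h0 y hy]; simp
  · refine mul_le_mul_of_nonneg_right ((norm_biotSavartKernel_le _).trans ?_) (abs_nonneg _)
    have h1 : R / 2 ≤ ‖x - y‖ := by linarith [norm_sub_norm_le x y]
    rw [show 2 / R = (R / 2)⁻¹ by rw [inv_div]]
    exact inv_anti₀ (by linarith) h1

/-- The Dirichlet integral of the bump function. -/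
def bumpEnergy (i : Fin 2) : ℝ := ∫ x, pd i bump x ^ 2

/-- The Dirichlet integral is scale invariant in dimension two. Hence the cut-off errors tend to
zero as soon as the function tends to zero at infinity, at whatever rate. -/
theorem integral_pd_cutoff_sq {R : ℝ} (hR : 0 < R) (i : Fin 2) :
    ∫ x, pd i (cutoff R) x ^ 2 = bumpEnergy i := by
  have sc := Measure.integral_comp_smul (volume : Measure Plane) (fun y => pd i bump y ^ 2) R⁻¹
  simp only [finrank_euclideanSpace, Fintype.card_fin, smul_eq_mul] at sc
  simp_rw [pd_cutoff, mul_pow]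
  rw [integral_const_mul, sc, bumpEnergy, abs_of_pos (by positivity)]
  field_simp

theorem pd_cutoff_eq_zero {R : ℝ} (hR : 0 < R) (i : Fin 2) {x : Plane} (hx : ‖x‖ < R) :
    pd i (cutoff R) x = 0 := by
  have : cutoff R =ᶠ[𝓝 x] fun _ => 1 := by
    filter_upwards [Metric.isOpen_ball.mem_nhds (mem_ball_zero_iff.2 hx)] with y hy
    exact cutoff_eq_one hR (mem_ball_zero_iff.1 hy).le
  rw [pd, this.fderiv_eq]; simp

/-- The sum of the squares of the first derivatives of the velocity field. -/
def bsEnergy (φ : Plane → ℝ) (x : Plane) : ℝ :=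
  biotSavart (pd 0 φ) x 0 ^ 2 + biotSavart (pd 1 φ) x 0 ^ 2 +
    (biotSavart (pd 0 φ) x 1 ^ 2 + biotSavart (pd 1 φ) x 1 ^ 2)

theorem continuous_bsEnergy {φ : Plane → ℝ} (hφ : IsTestFunction φ) :
    Continuous (bsEnergy φ) := by
  have := fun i j => (contDiff_bs (hφ.pd i) j).continuous
  exact (((this 0 0).pow 2).add ((this 1 0).pow 2)).add (((this 0 1).pow 2).add ((this 1 1).pow 2))

theorem bs_pd_pd {φ : Plane → ℝ} (hφ : IsTestFunction φ) (i j : Fin 2) (x : Plane) :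
    pd i (pd i fun x => biotSavart φ x j) x = biotSavart (pd i (pd i φ)) x j := by
  rw [show (pd i fun x => biotSavart φ x j) = fun x => biotSavart (pd i φ) x j from
    funext fun x => pd_bs hφ i j x, pd_bs (hφ.pd i)]

theorem bs_laplacian {φ : Plane → ℝ} (hφ : IsTestFunction φ) (x : Plane) :
    biotSavart (pd 0 (pd 0 φ)) x 0 + biotSavart (pd 1 (pd 1 φ)) x 0 = - curlConst * pd 1 φ x ∧
    biotSavart (pd 0 (pd 0 φ)) x 1 + biotSavart (pd 1 (pd 1 φ)) x 1 = curlConst * pd 0 φ x := by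
  have c : pd 0 (pd 1 φ) = pd 1 (pd 0 φ) := funext fun x => pd_comm hφ.1 0 1 x
  have d0 := bs_div (hφ.pd 0) x
  have d1 := bs_div (hφ.pd 1) x
  have c0 := bs_curl (hφ.pd 0) x
  have c1 := bs_curl (hφ.pd 1) x
  rw [c] at d1 c1
  constructor
  · linear_combination d0 - c1
  · linear_combination c0 + d1

/-- The Caccioppoli inequality is summed over the components of `K_BS ⋆ φ`, whose Laplacian is
`curlConst` times the rotated gradient of `φ`. Integrating by parts once more, the main term becomes
`curlConst² ∫ φ²`. The derivatives of the cut-off live in `|x| ≥ R`, where the velocity is `O(1/R)`.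
-/
theorem integral_cutoff_bsEnergy_le {φ : Plane → ℝ} (hφ : IsTestFunction φ) {R₀ R : ℝ}
    (hR₀ : 0 < R₀) (h0 : ∀ x, R₀ ≤ ‖x‖ → φ x = 0) (hR : 2 * R₀ ≤ R) :
    ∫ x, cutoff R x * (cutoff R x * bsEnergy φ x) ≤ 2 * curlConst ^ 2 * (∫ x, φ x ^ 2)
      + 8 * (2 / R * ∫ y, |φ y|) ^ 2 * (bumpEnergy 0 + bumpEnergy 1) := by
  have hR' : 0 < R := by linarith
  have hχ := isTestFunction_cutoff hR'
  have sv := fun j => contDiff_bs hφ j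
  have cv := fun j => (sv j).continuous
  have cpd := fun i j => (contDiff_bs (hφ.pd i) j).continuous
  have cpp := fun i j => (contDiff_bs ((hφ.pd i).pd i) j).continuous
  have cac := fun i j => caccioppoli (sv j) hχ i
  simp_rw [bs_pd_pd hφ, pd_bs hφ] at cac
  set M := 2 / R * ∫ y, |φ y| with hM
  -- the error terms
  have err : ∀ i j, ∫ x, pd i (cutoff R) x * (pd i (cutoff R) x * biotSavart φ x j ^ 2)
      ≤ M ^ 2 * bumpEnergy i := fun i j => by
    rw [← integral_pd_cutoff_sq hR' i, ← integral_const_mul]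
    refine integral_mono (integrable_test_mul (hχ.pd i) ((hχ.pd i).continuous.mul ((cv j).pow 2)))
      ?_ fun x => ?_
    · exact (integrable_test_mul (hχ.pd i) ((hχ.pd i).continuous.const_mul (M ^ 2))).congr
        (ae_of_all _ fun x => by simp only []; ring)
    · simp only []
      rcases lt_or_ge ‖x‖ R with hx | hx
      · rw [pd_cutoff_eq_zero hR' i hx]; simp
      · have h1 := (abs_apply_le_norm (biotSavart φ x) j).trans (bs_decay hφ hR₀ h0 hR hx)
        have h2 : biotSavart φ x j ^ 2 ≤ M ^ 2 := by
          rw [← sq_abs]; exact pow_le_pow_left₀ (abs_nonneg _) h1 2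
        nlinarith [mul_le_mul_of_nonneg_left h2 (sq_nonneg (pd i (cutoff R) x))]
  -- The support of `φ` lies in the disc of radius `R₀ < R`, on which the cut-off is `1`; the
  -- cut-offs therefore disappear from the main term.
  have one : ∀ i x, cutoff R x * pd i φ x = pd i φ x := fun i x => by
    rcases lt_or_ge ‖x‖ R with hx | hx
    · rw [cutoff_eq_one hR' hx.le, one_mul]
    · have : φ =ᶠ[𝓝 x] fun _ => 0 := by
        have : {y : Plane | R₀ < ‖y‖} ∈ 𝓝 x :=
          (isOpen_lt continuous_const continuous_norm).mem_nhds (by change R₀ < ‖x‖; linarith)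
        filter_upwards [this] with y hy using h0 y hy.le
      rw [pd, this.fderiv_eq]; simp
  -- the main term
  have iu : ∀ i j, Integrable fun x => cutoff R x * (cutoff R x * biotSavart φ x j *
      biotSavart (pd i (pd i φ)) x j) := fun i j =>
    integrable_test_mul hχ ((hχ.continuous.mul (cv j)).mul (cpp i j))
  have main : (∫ x, cutoff R x * (cutoff R x * biotSavart φ x 0 * biotSavart (pd 0 (pd 0 φ)) x 0))
      + (∫ x, cutoff R x * (cutoff R x * biotSavart φ x 0 * biotSavart (pd 1 (pd 1 φ)) x 0))
      + ((∫ x, cutoff R x * (cutoff R x * biotSavart φ x 1 * biotSavart (pd 0 (pd 0 φ)) x 1))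
      + (∫ x, cutoff R x * (cutoff R x * biotSavart φ x 1 * biotSavart (pd 1 (pd 1 φ)) x 1)))
      = - curlConst ^ 2 * ∫ x, φ x ^ 2 := by
    rw [← integral_add (iu 0 0) (iu 1 0), ← integral_add (iu 0 1) (iu 1 1)]
    have a0 := integral_pd_mul_test (sv 0) hφ 1
    have a1 := integral_pd_mul_test (sv 1) hφ 0
    simp_rw [pd_bs hφ] at a0 a1
    have e0 : ∫ x, (cutoff R x * (cutoff R x * biotSavart φ x 0 * biotSavart (pd 0 (pd 0 φ)) x 0) +
        cutoff R x * (cutoff R x * biotSavart φ x 0 * biotSavart (pd 1 (pd 1 φ)) x 0))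
        = - curlConst * ∫ x, biotSavart φ x 0 * pd 1 φ x := by
      rw [← integral_const_mul]; congr 1; ext x
      linear_combination (cutoff R x * cutoff R x * biotSavart φ x 0) * (bs_laplacian hφ x).1
        - curlConst * biotSavart φ x 0 * (cutoff R x + 1) * one 1 x
    have e1 : ∫ x, (cutoff R x * (cutoff R x * biotSavart φ x 1 * biotSavart (pd 0 (pd 0 φ)) x 1) +
        cutoff R x * (cutoff R x * biotSavart φ x 1 * biotSavart (pd 1 (pd 1 φ)) x 1))
        = curlConst * ∫ x, biotSavart φ x 1 * pd 0 φ x := by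
      rw [← integral_const_mul]; congr 1; ext x
      linear_combination (cutoff R x * cutoff R x * biotSavart φ x 1) * (bs_laplacian hφ x).2
        + curlConst * biotSavart φ x 1 * (cutoff R x + 1) * one 0 x
    have e2 : (∫ x, biotSavart (pd 0 φ) x 1 * φ x) - ∫ x, biotSavart (pd 1 φ) x 0 * φ x
        = curlConst * ∫ x, φ x ^ 2 := by
      rw [← integral_sub, ← integral_const_mul]
      · congr 1; ext x
        linear_combination φ x * bs_curl hφ x
      · exact (integrable_test_mul hφ (cpd 0 1)).congr (ae_of_all _ fun x => mul_comm _ _)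
      · exact (integrable_test_mul hφ (cpd 1 0)).congr (ae_of_all _ fun x => mul_comm _ _)
    rw [e0, e1]
    linear_combination (-curlConst) * e2 - curlConst * a0 + curlConst * a1
  have ie : ∀ i j, Integrable fun x => cutoff R x * (cutoff R x * biotSavart (pd i φ) x j ^ 2) :=
    fun i j => integrable_test_mul hχ (hχ.continuous.mul ((cpd i j).pow 2))
  have split : ∫ x, cutoff R x * (cutoff R x * bsEnergy φ x) =
      (∫ x, cutoff R x * (cutoff R x * biotSavart (pd 0 φ) x 0 ^ 2)) +
      (∫ x, cutoff R x * (cutoff R x * biotSavart (pd 1 φ) x 0 ^ 2)) +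
      ((∫ x, cutoff R x * (cutoff R x * biotSavart (pd 0 φ) x 1 ^ 2)) +
      (∫ x, cutoff R x * (cutoff R x * biotSavart (pd 1 φ) x 1 ^ 2))) := by
    rw [← integral_add (ie 0 0) (ie 1 0), ← integral_add (ie 0 1) (ie 1 1),
      ← integral_add (by exact (ie 0 0).add (ie 1 0)) (by exact (ie 0 1).add (ie 1 1))]
    congr 1; ext x; simp only [bsEnergy]; ring
  rw [split]
  linarith [cac 0 0, cac 1 0, cac 0 1, cac 1 1, err 0 0, err 1 0, err 0 1, err 1 1, main]

theorem bsEnergy_nonneg (φ : Plane → ℝ) (x : Plane) : 0 ≤ bsEnergy φ x := by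
  unfold bsEnergy; positivity

/-- Fatou's lemma as the radius of the cut-off tends to infinity, the error term being `O(R⁻²)`. -/
theorem bsEnergy_integral {φ : Plane → ℝ} (hφ : IsTestFunction φ) :
    Integrable (bsEnergy φ) ∧ ∫ x, bsEnergy φ x ≤ 2 * curlConst ^ 2 * ∫ x, φ x ^ 2 := by
  obtain ⟨R₀, hR₀, h0⟩ := exists_cutoff_eq_one hφ.2
  have hc := continuous_bsEnergy hφ
  set B : ℝ := 2 * curlConst ^ 2 * ∫ x, φ x ^ 2
  have hB : 0 ≤ B := mul_nonneg (by positivity) (integral_nonneg fun x => by positivity)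
  have int : ∀ k : ℕ, Integrable fun x =>
      cutoff ((k : ℝ) + 1) x * (cutoff ((k : ℝ) + 1) x * bsEnergy φ x) := fun k =>
    integrable_test_mul (isTestFunction_cutoff (by positivity))
      ((contDiff_cutoff _).continuous.mul hc)
  have key : ∫⁻ x, ENNReal.ofReal (bsEnergy φ x) ≤ ENNReal.ofReal B := by
    calc ∫⁻ x, ENNReal.ofReal (bsEnergy φ x)
        = ∫⁻ x, liminf (fun k : ℕ => ENNReal.ofReal
            (cutoff ((k : ℝ) + 1) x * (cutoff ((k : ℝ) + 1) x * bsEnergy φ x))) atTop := by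
          refine lintegral_congr fun x => ?_
          have := (tendsto_cutoff x).mul ((tendsto_cutoff x).mul_const (bsEnergy φ x))
          rw [one_mul, one_mul] at this
          exact ((ENNReal.continuous_ofReal.tendsto _).comp this).liminf_eq.symm
      _ ≤ liminf (fun k : ℕ => ∫⁻ x, ENNReal.ofReal
            (cutoff ((k : ℝ) + 1) x * (cutoff ((k : ℝ) + 1) x * bsEnergy φ x))) atTop :=
          lintegral_liminf_le' fun k => ((int k).aestronglyMeasurable.aemeasurable).ennreal_ofReal
      _ ≤ liminf (fun k : ℕ => ENNReal.ofReal (B + 8 * (2 / ((k : ℝ) + 1) * ∫ y, |φ y|) ^ 2 *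
            (bumpEnergy 0 + bumpEnergy 1))) atTop := by
          refine liminf_le_liminf ?_
          obtain ⟨N, hN⟩ := exists_nat_ge (2 * R₀)
          filter_upwards [eventually_ge_atTop N] with k hk
          have hk' : (N : ℝ) ≤ k := by exact_mod_cast hk
          rw [← ofReal_integral_eq_lintegral_ofReal (int k) (ae_of_all _ fun x =>
            mul_nonneg (cutoff_nonneg _ _) (mul_nonneg (cutoff_nonneg _ _) (bsEnergy_nonneg φ x)))]
          exact ENNReal.ofReal_le_ofReal (integral_cutoff_bsEnergy_le hφ hR₀ h0 (by linarith))
      _ = ENNReal.ofReal B := by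
          refine ((ENNReal.continuous_ofReal.tendsto _).comp ?_).liminf_eq
          have l := (tendsto_one_div_add_atTop_nhds_zero_nat (𝕜 := ℝ)).const_mul 2
          have l2 := ((((l.mul_const (∫ y, |φ y|)).pow 2).const_mul 8).mul_const
            (bumpEnergy 0 + bumpEnergy 1)).const_add B
          simp only [mul_one_div] at l2
          simpa using l2
  have hint : Integrable (bsEnergy φ) :=
    (lintegral_ofReal_ne_top_iff_integrable hc.aestronglyMeasurable
      (ae_of_all _ (bsEnergy_nonneg φ))).1 (key.trans_lt ENNReal.ofReal_lt_top).ne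
  refine ⟨hint, ?_⟩
  rw [← ofReal_integral_eq_lintegral_ofReal hint (ae_of_all _ (bsEnergy_nonneg φ))] at key
  exact (ENNReal.ofReal_le_ofReal_iff hB).1 key

theorem bs_grad_test {φ : Plane → ℝ} (hφ : IsTestFunction φ) (i j : Fin 2) :
    MemLp (fun x => biotSavart (pd i φ) x j) 2 ∧
      l2 (fun x => biotSavart (pd i φ) x j) ≤ 2 * curlConst * l2 φ := by
  obtain ⟨h1, h2⟩ := bsEnergy_integral hφ
  have hc := (contDiff_bs (hφ.pd i) j).continuous
  have hle : ∀ x, biotSavart (pd i φ) x j ^ 2 ≤ bsEnergy φ x := fun x => by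
    unfold bsEnergy
    fin_cases i <;> fin_cases j <;> simp <;> nlinarith [sq_nonneg (biotSavart (pd 0 φ) x 0),
      sq_nonneg (biotSavart (pd 1 φ) x 0), sq_nonneg (biotSavart (pd 0 φ) x 1),
      sq_nonneg (biotSavart (pd 1 φ) x 1)]
  have hsq : Integrable fun x => biotSavart (pd i φ) x j ^ 2 :=
    h1.mono' (hc.pow 2).aestronglyMeasurable (ae_of_all _ fun x => by
      rw [Real.norm_of_nonneg (by positivity)]; exact hle x)
  have hm : MemLp (fun x => biotSavart (pd i φ) x j) 2 :=
    (memLp_two_iff_integrable_sq hc.aestronglyMeasurable).2 hsq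
  refine ⟨hm, le_of_sq_le_sq ?_ (mul_nonneg (mul_nonneg zero_le_two curlConst_nonneg)
    (l2_nonneg _))⟩
  rw [l2_sq hm, mul_pow, l2_sq hφ.memLpw.memLp]
  simp_rw [Real.norm_eq_abs, sq_abs]
  refine (integral_mono hsq h1 hle).trans (h2.trans ?_)
  have : 0 ≤ ∫ x, φ x ^ 2 := integral_nonneg fun x => by positivity
  nlinarith [mul_nonneg (sq_nonneg curlConst) this]

/-! ### The Biot-Savart velocity in the energy space -/

/-- By the uniform bound `InV.norm_bs_sub_le`, the velocity is a uniform limit of the smooth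
velocities of test functions. -/
theorem InV.continuous_bs {w : Plane → ℝ} {D : Plane → Plane} (h : InV w D) :
    Continuous (biotSavart w) := by
  obtain ⟨φ, hφ, -, h2⟩ := h.exists_seq
  have hc : ∀ k, Continuous (biotSavart (φ k)) := fun k =>
    (PiLp.continuous_toLp 2 _).comp (continuous_pi fun j => (contDiff_bs (hφ k) j).continuous)
  refine TendstoUniformly.continuous (F := fun k => biotSavart (φ k)) (p := atTop)
    (Metric.tendstoUniformly_iff.2 fun ε hε => ?_) (Frequently.of_forall hc)
  have := h2.const_mul bsConst
  rw [mul_zero] at this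
  filter_upwards [this.eventually_lt_const hε] with k hk ξ
  rw [dist_eq_norm]
  exact (h.norm_bs_sub_le (hφ k).inV ξ).trans_lt hk

theorem InV.bs_apply_sub_le {w w' : Plane → ℝ} {D D' : Plane → Plane} (h : InV w D)
    (h' : InV w' D') (j : Fin 2) (ξ : Plane) :
    |biotSavart w' ξ j - biotSavart w ξ j| ≤ bsConst * nX fun x => D x - D' x := by
  rw [abs_sub_comm]
  exact (abs_apply_le_norm (biotSavart w ξ - biotSavart w' ξ) j).trans (h.norm_bs_sub_le h' ξ)

theorem InV.bs_apply_le {w : Plane → ℝ} {D : Plane → Plane} (h : InV w D) (j : Fin 2) (ξ : Plane) :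
    |biotSavart w ξ j| ≤ bsConst * nX D :=
  (abs_apply_le_norm _ j).trans (h.norm_bs_le ξ)

theorem InV.continuous_bs_apply {w : Plane → ℝ} {D : Plane → Plane} (h : InV w D) (j : Fin 2) :
    Continuous fun ξ => biotSavart w ξ j := (continuous_coord j).comp h.continuous_bs

theorem InV.integrable_bs_mul {w : Plane → ℝ} {D : Plane → Plane} (h : InV w D) (j : Fin 2)
    {f : Plane → ℝ} (hf : Integrable f) : Integrable fun ξ => biotSavart w ξ j * f ξ :=
  hf.bdd_mul (c := bsConst * nX D) (h.continuous_bs_apply j).aestronglyMeasurable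
    (ae_of_all _ fun ξ => h.bs_apply_le j ξ)

/-- Pairings of the velocity field with an integrable function pass to the limit. -/
theorem InV.tendsto_bs_mul {w : Plane → ℝ} {D : Plane → Plane} (h : InV w D)
    {φ : ℕ → Plane → ℝ} (hφ : ∀ k, IsTestFunction (φ k))
    (h2 : Tendsto (fun k => nX fun x => D x - (∇ (φ k)) x) atTop (𝓝 0)) (j : Fin 2)
    {f : Plane → ℝ} (hf : Integrable f) :
    Tendsto (fun k => ∫ ξ, biotSavart (φ k) ξ j * f ξ) atTop
      (𝓝 (∫ ξ, biotSavart w ξ j * f ξ)) := by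
  refine tendsto_of_dist_le (ε := fun k => bsConst * (nX fun x => D x - (∇ (φ k)) x) * ∫ ξ, |f ξ|)
    (fun k => ?_) (by simpa using (h2.const_mul bsConst).mul_const (∫ ξ, |f ξ|))
  rw [← integral_sub ((hφ k).inV.integrable_bs_mul j hf) (h.integrable_bs_mul j hf),
    ← integral_const_mul]
  refine abs_integral_le_integral_abs.trans (integral_mono_of_nonneg
    (ae_of_all _ fun _ => abs_nonneg _) (hf.abs.const_mul _) (ae_of_all _ fun ξ => ?_))
  simp only []
  rw [← sub_mul, abs_mul]
  exact mul_le_mul_of_nonneg_right (h.bs_apply_sub_le (hφ k).inV j ξ) (abs_nonneg _)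

theorem integral_bs_pd {φ ψ : Plane → ℝ} (hφ : IsTestFunction φ) (hψ : ContDiff ℝ ∞ ψ)
    (i j : Fin 2) (h1 : Integrable ψ) (h2 : Integrable (pd i ψ)) (h3 : MemLp ψ 2) :
    ∫ ξ, biotSavart φ ξ j * pd i ψ ξ = - ∫ ξ, biotSavart (pd i φ) ξ j * ψ ξ := by
  have e : ∀ ξ, pd i (fun x => biotSavart φ x j) ξ = biotSavart (pd i φ) ξ j :=
    pd_bs hφ i j
  have := integral_pd_mul (i := i) (differentiable_of_smooth (contDiff_bs hφ j)) (differentiable_of_smooth hψ)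
    (by simp_rw [e]; exact integrable_mul_of_memLp (bs_grad_test hφ i j).1 h3)
    (hφ.inV.integrable_bs_mul j h2) (hφ.inV.integrable_bs_mul j h1)
  simp_rw [e] at this
  rw [this, neg_neg]

/-- Compact support of `ψ` is not required, so that `ψ = G` is allowed in the proof that the mean is
conserved. -/
theorem InV.bs_weak_div {w : Plane → ℝ} {D : Plane → Plane} (h : InV w D) {ψ : Plane → ℝ}
    (hψ : ContDiff ℝ ∞ ψ) (h1 : Integrable ψ) (h2 : ∀ i, Integrable (pd i ψ)) (h3 : MemLp ψ 2) :
    (∫ ξ, biotSavart w ξ 0 * pd 0 ψ ξ) + ∫ ξ, biotSavart w ξ 1 * pd 1 ψ ξ = 0 := by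
  obtain ⟨φ, hφ, -, hD⟩ := h.exists_seq
  refine tendsto_nhds_unique ((h.tendsto_bs_mul hφ hD 0 (h2 0)).add
    (h.tendsto_bs_mul hφ hD 1 (h2 1))) (tendsto_const_nhds.congr fun k => ?_)
  rw [integral_bs_pd (hφ k) hψ 0 0 h1 (h2 0) h3, integral_bs_pd (hφ k) hψ 1 1 h1 (h2 1) h3,
    ← neg_add, ← integral_add (integrable_mul_of_memLp (bs_grad_test (hφ k) 0 0).1 h3)
      (integrable_mul_of_memLp (bs_grad_test (hφ k) 1 1).1 h3)]
  simp_rw [← add_mul, bs_div (hφ k)]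
  simp

theorem InV.bs_weak_curl {w : Plane → ℝ} {D : Plane → Plane} (h : InV w D) {ψ : Plane → ℝ}
    (hψ : IsTestFunction ψ) :
    (∫ ξ, biotSavart w ξ 0 * pd 1 ψ ξ) - ∫ ξ, biotSavart w ξ 1 * pd 0 ψ ξ
      = curlConst * ∫ ξ, w ξ * ψ ξ := by
  obtain ⟨φ, hφ, hw, hD⟩ := h.exists_seq
  have h1 := hψ.integrable
  have h2 := fun i => (hψ.pd i).integrable
  have h3 := hψ.memLpw.memLp
  have lim : Tendsto (fun k => ∫ ξ, φ k ξ * ψ ξ) atTop (𝓝 (∫ ξ, w ξ * ψ ξ)) := by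
    refine tendsto_of_dist_le (ε := fun k => (nX fun x => w x - φ k x) * l2 ψ) (fun k => ?_)
      (by simpa using hw.mul_const (l2 ψ))
    have m1 := h.mem.sub (hφ k).memLpw
    rw [abs_sub_comm, ← integral_sub (integrable_mul_of_memLp h.mem.memLp h3)
      (integrable_mul_of_memLp (hφ k).memLpw.memLp h3)]
    simp_rw [← sub_mul]
    exact (abs_integral_mul_le m1.memLp h3).trans
      (mul_le_mul_of_nonneg_right (l2_le_nX m1) (l2_nonneg _))
  refine tendsto_nhds_unique ((h.tendsto_bs_mul hφ hD 0 (h2 1)).sub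
    (h.tendsto_bs_mul hφ hD 1 (h2 0))) ((lim.const_mul curlConst).congr fun k => ?_)
  rw [integral_bs_pd (hφ k) hψ.1 1 0 h1 (h2 1) h3, integral_bs_pd (hφ k) hψ.1 0 1 h1 (h2 0) h3,
    neg_sub_neg, ← integral_sub (integrable_mul_of_memLp (bs_grad_test (hφ k) 0 1).1 h3)
      (integrable_mul_of_memLp (bs_grad_test (hφ k) 1 0).1 h3), ← integral_const_mul]
  simp_rw [← sub_mul, bs_curl (hφ k), mul_assoc]

theorem pd_sub_fun {f g : Plane → ℝ} (hf : Differentiable ℝ f) (hg : Differentiable ℝ g)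
    (i : Fin 2) : pd i (fun x => f x - g x) = fun x => pd i f x - pd i g x :=
  funext fun x => pd_sub (hf x) (hg x) i

/-- By `bs_grad_test` applied to differences, the velocity gradients of approximating test functions
form a Cauchy sequence in `L²`. The limit inherits the bound, and it is the weak derivative because
the velocities converge uniformly. -/
theorem InV.exists_bs_pd {w : Plane → ℝ} {D : Plane → Plane} (h : InV w D) (i j : Fin 2) :
    ∃ g : Plane → ℝ, MemLp g 2 ∧ l2 g ≤ 2 * curlConst * nX w ∧
      ∀ ψ, IsTestFunction ψ → ∫ ξ, biotSavart w ξ j * pd i ψ ξ = - ∫ ξ, ψ ξ * g ξ := by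
  obtain ⟨φ, hφ, hw, hD⟩ := h.exists_seq
  set f : ℕ → Plane → ℝ := fun k x => biotSavart (pd i (φ k)) x j
  have hf : ∀ k, MemLp (f k) 2 := fun k => (bs_grad_test (hφ k) i j).1
  set e : ℕ → ℝ := fun k => nX fun x => w x - φ k x
  have κ0 : 0 ≤ 2 * curlConst := mul_nonneg zero_le_two curlConst_nonneg
  have bound : ∀ k l, dist ((hf k).toLp (f k)) ((hf l).toLp (f l)) ≤
      2 * curlConst * e k + 2 * curlConst * e l := fun k l => by
    have hkl : IsTestFunction fun x => φ k x - φ l x := (hφ k).sub (hφ l)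
    have b := (bs_grad_test hkl i j).2
    rw [dist_eq_norm, ← MemLp.toLp_sub, Lp.norm_toLp]
    have e1 : (fun x => biotSavart (pd i fun x => φ k x - φ l x) x j) = f k - f l := by
      ext x
      rw [pd_sub_fun (hφ k).differentiable (hφ l).differentiable,
        ((hφ k).pd i).inV.bs_sub ((hφ l).pd i).inV]
      rfl
    rw [e1] at b
    refine b.trans ?_
    rw [← mul_add]
    refine mul_le_mul_of_nonneg_left ((l2_le_nX hkl.memLpw).trans ?_) κ0
    have := nX_sub_le (h.mem.sub (hφ l).memLpw) (h.mem.sub (hφ k).memLpw)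
    simp only [sub_sub_sub_cancel_left] at this
    linarith
  have cau : CauchySeq fun k => (hf k).toLp (f k) := by
    refine Metric.cauchySeq_iff'.2 fun ε hε => ?_
    have : Tendsto (fun k => 2 * curlConst * e k) atTop (𝓝 0) := by
      simpa using hw.const_mul (2 * curlConst)
    obtain ⟨N, hN⟩ := eventually_atTop.1 (this.eventually_lt_const (half_pos hε))
    exact ⟨N, fun n hn => (bound n N).trans_lt (by linarith [hN n hn, hN N le_rfl])⟩
  obtain ⟨g, hg⟩ := cauchySeq_tendsto_of_complete cau
  have gm := Lp.memLp g
  have hl2 : Tendsto (fun k => l2 fun x => g x - f k x) atTop (𝓝 0) :=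
    tendsto_toReal_of_toLp gm hf (by rwa [Lp.toLp_coeFn])
  refine ⟨g, gm, ?_, fun ψ hψ => ?_⟩
  · have lim : Tendsto (fun k => 2 * curlConst * (nX w + e k) + l2 fun x => g x - f k x) atTop
        (𝓝 (2 * curlConst * (nX w + 0) + 0)) := ((hw.const_add _).const_mul _).add hl2
    rw [add_zero, add_zero] at lim
    refine ge_of_tendsto' lim fun k => ?_
    have h1 := l2_add_le (hf k) (gm.sub (hf k))
    simp only [Pi.sub_apply, add_sub_cancel] at h1
    refine h1.trans (add_le_add ((bs_grad_test (hφ k) i j).2.trans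
      (mul_le_mul_of_nonneg_left ?_ κ0)) le_rfl)
    exact (l2_le_nX (hφ k).memLpw).trans (nX_le_add_sub h.mem (hφ k).memLpw)
  · have h3 := hψ.memLpw.memLp
    refine tendsto_nhds_unique (h.tendsto_bs_mul hφ hD j (hψ.pd i).integrable) ?_
    refine tendsto_of_dist_le (ε := fun k => (l2 fun x => g x - f k x) * l2 ψ) (fun k => ?_)
      (by simpa using hl2.mul_const (l2 ψ))
    rw [integral_bs_pd (hφ k) hψ.1 i j hψ.integrable (hψ.pd i).integrable h3, neg_sub_neg]
    have e1 : ∫ ξ, ψ ξ * g ξ = ∫ ξ, g ξ * ψ ξ := by simp_rw [mul_comm]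
    rw [e1, ← integral_sub (integrable_mul_of_memLp gm h3) (integrable_mul_of_memLp (hf k) h3)]
    simp_rw [← sub_mul]
    exact abs_integral_mul_le (gm.sub (hf k)) h3

theorem l2_vec_sq {D : Plane → Plane} (hD : MemLp D 2) :
    l2 D ^ 2 = l2 (fun x => D x 0) ^ 2 + l2 (fun x => D x 1) ^ 2 := by
  have hc := memLp_piLp_iff.1 hD
  rw [l2_sq hD, l2_sq (hc 0), l2_sq (hc 1), ← integral_add (hc 0).norm.integrable_sq
    (hc 1).norm.integrable_sq]
  congr 1; ext x
  rw [norm_sq_plane, Real.norm_eq_abs, Real.norm_eq_abs, sq_abs, sq_abs]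

theorem l2_vec_le {D : Plane → Plane} (hD : MemLp D 2) :
    l2 D ≤ l2 (fun x => D x 0) + l2 (fun x => D x 1) := by
  refine le_of_sq_le_sq ?_ (add_nonneg (l2_nonneg _) (l2_nonneg _))
  rw [l2_vec_sq hD]
  nlinarith [l2_nonneg (fun x => D x 0), l2_nonneg (fun x => D x 1)]

/-- The velocity field has a square integrable weak gradient. -/
theorem InV.exists_bs_grad {w : Plane → ℝ} {D : Plane → Plane} (h : InV w D) (j : Fin 2) :
    ∃ B : Plane → Plane, IsWeakGradient (fun ξ => biotSavart w ξ j) B ∧ MemLp B 2 ∧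
      l2 B ≤ 4 * curlConst * nX w := by
  choose g h1 h2 h3 using fun i => h.exists_bs_pd i j
  have hm : MemLp (fun x => (WithLp.toLp 2 fun i => g i x : Plane)) 2 :=
    memLp_piLp_iff.2 fun i => h1 i
  refine ⟨_, isWeakGradient_iff.2 ⟨(h.continuous_bs_apply j).locallyIntegrable,
    hm.locallyIntegrable (by norm_num), fun ψ hψ i => h3 i ψ hψ⟩, hm, ?_⟩
  exact (l2_vec_le hm).trans (by have := h2 0; have := h2 1; simp only []; linarith)

/-- The velocity is divergence free, and `D` is a limit of gradients of test functions in `L²_w`,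
hence in `L¹`. This makes the transport term preserve the mean. -/
theorem InV.integral_bs_grad {w : Plane → ℝ} {D : Plane → Plane} (h : InV w D) :
    (∫ ξ, biotSavart w ξ 0 * D ξ 0) + ∫ ξ, biotSavart w ξ 1 * D ξ 1 = 0 := by
  obtain ⟨φ, hφ, hw, hD⟩ := h.exists_seq
  have hDi := fun i => memLpw_vec_iff.1 h.memD i
  have lim : ∀ i, Tendsto (fun k => ∫ ξ, biotSavart w ξ i * pd i (φ k) ξ) atTop
      (𝓝 (∫ ξ, biotSavart w ξ i * D ξ i)) := fun i => by
    refine tendsto_of_dist_le (ε := fun k => bsConst * nX D * nX fun x => D x - (∇ (φ k)) x)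
      (fun k => ?_) (by simpa using hD.const_mul (bsConst * nX D))
    have m := (hDi i).sub ((hφ k).pd i).memLpw
    rw [abs_sub_comm, ← integral_sub (h.integrable_bs_mul i (hDi i).integrable)
      (h.integrable_bs_mul i ((hφ k).pd i).integrable)]
    simp_rw [← mul_sub]
    calc |∫ ξ, biotSavart w ξ i * (D ξ i - pd i (φ k) ξ)|
        ≤ ∫ ξ, bsConst * nX D * |D ξ i - pd i (φ k) ξ| := by
          refine abs_integral_le_integral_abs.trans (integral_mono_of_nonneg
            (ae_of_all _ fun _ => abs_nonneg _) (m.integrable.abs.const_mul _)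
            (ae_of_all _ fun ξ => ?_))
          simp only []
          rw [abs_mul]
          exact mul_le_mul_of_nonneg_right (h.bs_apply_le i ξ) (abs_nonneg _)
      _ ≤ _ := by
          rw [integral_const_mul]
          refine mul_le_mul_of_nonneg_left ((integral_abs_le_nX m).trans ?_)
            (mul_nonneg bsConst_pos.le (nX_nonneg _))
          have := nX_comp_le (h.memD.sub (hφ k).inV.memD) i
          simpa only [PiLp.sub_apply, gradient_apply] using this
  refine tendsto_nhds_unique ((lim 0).add (lim 1)) (tendsto_const_nhds.congr fun k => ?_)
  exact (h.bs_weak_div (hφ k).1 (hφ k).integrable (fun i => ((hφ k).pd i).integrable)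
    (hφ k).memLpw.memLp).symm

theorem kernel_neg (x : Plane) : biotSavartKernel (-x) = - biotSavartKernel x := by
  ext i
  fin_cases i <;> simp [biotSavartKernel]

theorem inner_kernel_self (x : Plane) : inner ℝ x (biotSavartKernel x) = 0 := by
  rw [inner_plane, biotSavartKernel_zero_comp, biotSavartKernel_one_comp]; ring

/-- The angular momentum identity `∫ w ξ · (K_BS ⋆ w) = 0`. -/
theorem InV.integral_bs_moment {w : Plane → ℝ} {D : Plane → Plane} (h : InV w D) :
    ∫ ξ, w ξ * inner ℝ ξ (biotSavart w ξ) = 0 := by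
  set F : Plane → Plane → ℝ := fun ξ η => w ξ * inner ℝ ξ (w η • biotSavartKernel (ξ - η)) with hF
  have e : ∀ ξ, w ξ * inner ℝ ξ (biotSavart w ξ) = ∫ η, F ξ η := fun ξ => by
    rw [hF, integral_const_mul, biotSavart, integral_inner (h.integrable_bs ξ)]
  have wm : AEStronglyMeasurable w volume := h.mem.memLp.1
  have mF : AEStronglyMeasurable (Function.uncurry F) (volume.prod volume) := by
    have k : Measurable fun z : Plane × Plane => biotSavartKernel (z.1 - z.2) :=
      measurable_biotSavartKernel.comp (measurable_fst.sub measurable_snd)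
    exact wm.comp_fst.mul (measurable_fst.aestronglyMeasurable.inner
      (wm.comp_snd.smul k.aestronglyMeasurable))
  have bF : ∀ ξ η, ‖F ξ η‖ ≤ (|w ξ| * ‖ξ‖) * (|w η| * ‖η - ξ‖⁻¹) := fun ξ η => by
    rw [hF, norm_mul, Real.norm_eq_abs, mul_assoc]
    refine mul_le_mul_of_nonneg_left ((norm_inner_le_norm _ _).trans
      (mul_le_mul_of_nonneg_left ?_ (norm_nonneg _))) (abs_nonneg _)
    rw [norm_smul, norm_sub_rev]
    exact mul_le_mul_of_nonneg_left (norm_biotSavartKernel_le _) (norm_nonneg _)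
  have i1 : ∀ ξ, Integrable (F ξ) := fun ξ =>
    ((h.integrable_bs ξ).const_inner ξ).const_mul (w ξ)
  have iw : Integrable fun ξ => |w ξ| * ‖ξ‖ := by
    have j := fun i => (h.mem.integrable_mul (hasTemperateGrowth_coord i)).abs
    refine ((j 0).add (j 1)).mono' (wm.norm.mul continuous_norm.aestronglyMeasurable)
      (ae_of_all _ fun ξ => ?_)
    rw [Real.norm_of_nonneg (by positivity), Pi.add_apply, abs_mul, abs_mul, ← mul_add]
    exact mul_le_mul_of_nonneg_left (norm_le_abs_add_abs ξ) (abs_nonneg _)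
  have hint : Integrable (Function.uncurry F) (volume.prod volume) := by
    refine (integrable_prod_iff mF).2 ⟨ae_of_all _ i1, ?_⟩
    refine (iw.mul_const (bsConst * nX D)).mono' mF.norm.integral_prod_right'
      (ae_of_all _ fun ξ => ?_)
    rw [Real.norm_of_nonneg (integral_nonneg fun _ => norm_nonneg _)]
    refine (integral_mono (i1 ξ).norm ((h.potential ξ).1.const_mul _) (bF ξ)).trans ?_
    rw [integral_const_mul]
    exact mul_le_mul_of_nonneg_left (h.potential ξ).2 (by positivity)
  have sw := integral_integral_swap hint
  simp_rw [e]
  have i2 : Integrable (fun z : Plane × Plane => F z.2 z.1) (volume.prod volume) := hint.swap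
  -- After symmetrization the integrand is `w ξ * w η` times `(ξ - η) · K_BS(ξ - η)`, which is zero
  -- because the kernel is orthogonal to its argument.
  have : (∫ ξ, ∫ η, F ξ η) + ∫ ξ, ∫ η, F η ξ = 0 := by
    have a1 : Integrable fun ξ => ∫ η, F ξ η := hint.integral_prod_left
    have a2 : Integrable fun ξ => ∫ η, F η ξ := i2.integral_prod_left
    rw [← integral_add a1 a2]
    refine (integral_congr_ae ?_).trans (integral_zero _ _)
    filter_upwards [i2.prod_right_ae] with ξ h2
    rw [← integral_add (i1 ξ) h2]
    refine (integral_congr_ae (ae_of_all _ fun η => ?_)).trans (integral_zero _ _)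
    have k := inner_kernel_self (ξ - η)
    have n : biotSavartKernel (η - ξ) = - biotSavartKernel (ξ - η) := by
      rw [← kernel_neg, neg_sub]
    rw [inner_sub_left] at k
    simp only [hF, n, inner_smul_right, inner_neg_right]
    linear_combination w ξ * w η * k
  rw [← sw] at this
  linarith

/-! ### The Oseen vortex -/

/-- The function `s ↦ (1 - e^{-s}) / s`, extended by continuity at the origin. -/
def expRatio (s : ℝ) : ℝ := dslope Real.exp 0 (-s)

theorem expRatio_zero : expRatio 0 = 1 := by simp [expRatio]

theorem expRatio_mul (s : ℝ) : s * expRatio s = 1 - Real.exp (-s) := by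
  have := sub_smul_dslope Real.exp 0 (-s)
  simp only [sub_zero, Real.exp_zero, smul_eq_mul] at this
  rw [expRatio]; linarith

theorem expRatio_eq {s : ℝ} (hs : s ≠ 0) : expRatio s = (1 - Real.exp (-s)) / s := by
  rw [← expRatio_mul, mul_div_cancel_left₀ _ hs]

theorem contDiff_expRatio : ContDiff ℝ ∞ expRatio := by
  refine contDiff_iff_contDiffAt.2 fun s => ?_
  rcases eq_or_ne s 0 with rfl | hs
  · obtain ⟨p, hp⟩ := (analyticAt_rexp (x := 0))
    have := hp.has_fpower_series_dslope_fslope.analyticAt.contDiffAt (n := ∞)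
    have h0 : (-(0 : ℝ)) = 0 := neg_zero
    exact ContDiffAt.comp (g := dslope Real.exp 0) (f := fun s : ℝ => -s) 0 (by rwa [h0])
      contDiff_neg.contDiffAt
  · have : expRatio =ᶠ[𝓝 s] fun s => (1 - Real.exp (-s)) / s := by
      filter_upwards [isOpen_ne.mem_nhds hs] with r hr using expRatio_eq hr
    refine ContDiffAt.congr_of_eventuallyEq ?_ this
    exact (contDiffAt_const.sub (contDiff_neg.exp.contDiffAt)).div contDiffAt_id hs

theorem expRatio_nonneg {s : ℝ} (hs : 0 ≤ s) : 0 ≤ expRatio s := by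
  rcases hs.eq_or_lt with rfl | hs
  · rw [expRatio_zero]; norm_num
  · rw [expRatio_eq hs.ne']
    exact div_nonneg (by linarith [Real.exp_le_one_iff.2 (neg_nonpos.2 hs.le)]) hs.le

theorem expRatio_le {s : ℝ} (hs : 0 ≤ s) : (1 + s) * expRatio s ≤ 2 := by
  have h1 : expRatio s ≤ 1 := by
    rcases hs.eq_or_lt with rfl | hs
    · rw [expRatio_zero]
    · rw [expRatio_eq hs.ne', div_le_one hs]
      linarith [Real.add_one_le_exp (-s)]
  have := expRatio_mul s
  have := Real.exp_pos (-s)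
  linarith

theorem mul_deriv_expRatio (s : ℝ) : s * deriv expRatio s = Real.exp (-s) - expRatio s := by
  have d : DifferentiableAt ℝ expRatio s := (contDiff_expRatio.differentiable (by simp)) s
  have h1 : HasDerivAt (fun s => s * expRatio s) (1 * expRatio s + s * deriv expRatio s) s :=
    (hasDerivAt_id s).mul d.hasDerivAt
  have h2 : HasDerivAt (fun s => s * expRatio s) (0 - Real.exp (-s) * -1) s := by
    simp_rw [expRatio_mul]
    exact (hasDerivAt_const s (1 : ℝ)).sub ((hasDerivAt_neg s).exp)
  linarith [h1.unique h2]

/-- The angular velocity of the Oseen vortex. -/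
def angVel (x : Plane) : ℝ := 1 / (8 * Real.pi) * expRatio (‖x‖ ^ 2 / 4)

theorem contDiff_angVel : ContDiff ℝ ∞ angVel :=
  contDiff_const.mul (contDiff_expRatio.comp ((contDiff_norm_sq ℝ).div_const 4))

theorem vG_eq (x : Plane) : vG x = angVel x • perp x := by
  rcases eq_or_ne x 0 with rfl | hx
  · have : perp 0 = 0 := by ext i; fin_cases i <;> simp
    simp [vG, this]
  · have hx : 0 < ‖x‖ := norm_pos_iff.2 hx
    rw [vG, angVel, expRatio_eq (by positivity), neg_div]
    congr 1
    field_simp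
    ring

theorem vG_zero_comp (x : Plane) : vG x 0 = -(angVel x * x 1) := by rw [vG_eq]; simp
theorem vG_one_comp (x : Plane) : vG x 1 = angVel x * x 0 := by rw [vG_eq]; simp

theorem contDiff_vG (i : Fin 2) : ContDiff ℝ ∞ fun x => vG x i := by
  fin_cases i
  · simp only [Fin.zero_eta, vG_zero_comp]
    exact (contDiff_angVel.mul (contDiff_coord 1)).neg
  · simp only [Fin.mk_one, vG_one_comp]
    exact contDiff_angVel.mul (contDiff_coord 0)

/-- The radial derivative factor of the angular velocity. -/
def angVel' (x : Plane) : ℝ := 1 / (16 * Real.pi) * deriv expRatio (‖x‖ ^ 2 / 4)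

theorem pd_angVel (i : Fin 2) (x : Plane) : pd i angVel x = angVel' x * x i := by
  have dn : Differentiable ℝ fun y : Plane => ‖y‖ ^ 2 :=
    differentiable_of_smooth (contDiff_norm_sq ℝ)
  have d1 : DifferentiableAt ℝ (fun y : Plane => (1 / 4 : ℝ) * ‖y‖ ^ 2) x := (dn x).const_mul _
  have d2 : DifferentiableAt ℝ expRatio ((1 / 4 : ℝ) * ‖x‖ ^ 2) :=
    (contDiff_expRatio.differentiable (by simp)) _
  have e : angVel = fun x => 1 / (8 * Real.pi) * expRatio ((1 / 4 : ℝ) * ‖x‖ ^ 2) := by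
    ext y; rw [angVel, div_eq_inv_mul (‖y‖ ^ 2)]; norm_num
  rw [e, pd_const_mul (φ := fun x : Plane => expRatio ((1 / 4 : ℝ) * ‖x‖ ^ 2)) (DifferentiableAt.comp (g := expRatio) x d2 d1), pd_comp d2 d1, pd_const_mul (dn x), pd_norm_sq, angVel',
    div_eq_inv_mul (‖x‖ ^ 2), one_div (4 : ℝ)]
  field_simp
  ring

/-- This is `curl v^G = G` in radial form: for an angular velocity `Ω(r)` the curl is `2Ω + r Ω'`,
and `angVel'` stands for `Ω' / r`. -/
theorem angVel'_eq (x : Plane) :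
    2 * angVel x + angVel' x * ‖x‖ ^ 2 = G x := by
  have := mul_deriv_expRatio (‖x‖ ^ 2 / 4)
  have h : angVel' x * ‖x‖ ^ 2 = 1 / (4 * Real.pi) * (‖x‖ ^ 2 / 4 * deriv expRatio (‖x‖ ^ 2 / 4)) := by
    rw [angVel']; field_simp; ring
  rw [h, this, G, angVel, neg_div]
  field_simp
  ring

theorem pd_vG_zero (i : Fin 2) (x : Plane) : pd i (fun x => vG x 0) x
    = -(angVel' x * x i * x 1 + angVel x * if i = 1 then 1 else 0) := by
  simp_rw [vG_zero_comp]
  rw [pd_neg, pd_mul (differentiable_of_smooth contDiff_angVel x) (differentiable_coord 1 x),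
    pd_angVel, pd_coord]

theorem pd_vG_one (i : Fin 2) (x : Plane) : pd i (fun x => vG x 1) x
    = angVel' x * x i * x 0 + angVel x * if i = 0 then 1 else 0 := by
  simp_rw [vG_one_comp]
  rw [pd_mul (differentiable_of_smooth contDiff_angVel x) (differentiable_coord 0 x),
    pd_angVel, pd_coord]

theorem vG_div (x : Plane) : pd 0 (fun x => vG x 0) x + pd 1 (fun x => vG x 1) x = 0 := by
  rw [pd_vG_zero, pd_vG_one]; simp; ring

theorem vG_curl (x : Plane) : pd 0 (fun x => vG x 1) x - pd 1 (fun x => vG x 0) x = G x := by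
  rw [pd_vG_zero, pd_vG_one, ← angVel'_eq, norm_sq_plane]; simp; ring

theorem angVel_nonneg (x : Plane) : 0 ≤ angVel x :=
  mul_nonneg (by positivity) (expRatio_nonneg (by positivity))

theorem angVel_le (x : Plane) : angVel x ≤ 1 / (1 + ‖x‖ ^ 2 / 4) := by
  have := expRatio_le (s := ‖x‖ ^ 2 / 4) (by positivity)
  rw [le_div_iff₀ (by positivity), angVel]
  have h : 1 / (8 * Real.pi) ≤ 1 / 8 := by
    rw [one_div_le_one_div (by positivity) (by norm_num)]; linarith [Real.pi_gt_three]
  have e := expRatio_nonneg (s := ‖x‖ ^ 2 / 4) (by positivity)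
  calc 1 / (8 * Real.pi) * expRatio (‖x‖ ^ 2 / 4) * (1 + ‖x‖ ^ 2 / 4)
      = 1 / (8 * Real.pi) * ((1 + ‖x‖ ^ 2 / 4) * expRatio (‖x‖ ^ 2 / 4)) := by ring
    _ ≤ 1 / 8 * 2 := mul_le_mul h this (mul_nonneg (by positivity) e) (by norm_num)
    _ ≤ 1 := by norm_num

theorem G_le (x : Plane) : G x ≤ 1 / (1 + ‖x‖ ^ 2 / 4) := by
  have h1 : Real.exp (-‖x‖ ^ 2 / 4) ≤ 1 / (1 + ‖x‖ ^ 2 / 4) := by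
    rw [neg_div, Real.exp_neg, ← one_div]
    exact one_div_le_one_div_of_le (by positivity) (by linarith [Real.add_one_le_exp (‖x‖ ^ 2 / 4)])
  have h2 : 1 / (4 * Real.pi) ≤ 1 := by
    rw [div_le_one (by positivity)]; linarith [Real.pi_gt_three]
  rw [G]
  exact (mul_le_of_le_one_left (Real.exp_pos _).le h2).trans h1

/-- The curl identity expresses this quantity through `G` and `angVel`, so the derivative of
`expRatio` need not be estimated. -/
theorem abs_angVel'_mul_le (x : Plane) : |angVel' x| * ‖x‖ ^ 2 ≤ 3 / (1 + ‖x‖ ^ 2 / 4) := by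
  have h := angVel'_eq x
  have e : |angVel' x| * ‖x‖ ^ 2 = |G x - 2 * angVel x| := by
    rw [← h, add_sub_cancel_left, abs_mul, abs_of_nonneg (by positivity : 0 ≤ ‖x‖ ^ 2)]
  have h1 := angVel_le x
  have h2 := G_le x
  rw [e, show (3 : ℝ) / (1 + ‖x‖ ^ 2 / 4) = 3 * (1 / (1 + ‖x‖ ^ 2 / 4)) by ring, abs_le]
  constructor <;> linarith [angVel_nonneg x, (G_pos x).le]

theorem abs_mul_le_norm_sq (x : Plane) (i j : Fin 2) : |x i * x j| ≤ ‖x‖ ^ 2 := by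
  rw [abs_mul, sq]
  exact mul_le_mul (abs_apply_le_norm x i) (abs_apply_le_norm x j) (abs_nonneg _) (norm_nonneg _)

theorem abs_pd_vG_le (i j : Fin 2) (x : Plane) :
    |pd i (fun x => vG x j) x| ≤ 4 / (1 + ‖x‖ ^ 2 / 4) := by
  have key : ∀ (a b : Fin 2) (c : ℝ), |c| ≤ 1 →
      |angVel' x * x a * x b + angVel x * c| ≤ 4 / (1 + ‖x‖ ^ 2 / 4) := fun a b c hc => by
    have h1 := abs_angVel'_mul_le x
    have h2 := angVel_le x
    have e1 : |angVel' x * x a * x b| ≤ |angVel' x| * ‖x‖ ^ 2 := by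
      rw [mul_assoc, abs_mul]
      exact mul_le_mul_of_nonneg_left (abs_mul_le_norm_sq x a b) (abs_nonneg _)
    have e2 : |angVel x * c| ≤ angVel x := by
      rw [abs_mul, abs_of_nonneg (angVel_nonneg x)]
      exact mul_le_of_le_one_right (angVel_nonneg x) hc
    have e3 : (4 : ℝ) / (1 + ‖x‖ ^ 2 / 4) = 3 / (1 + ‖x‖ ^ 2 / 4) + 1 / (1 + ‖x‖ ^ 2 / 4) := by ring
    linarith [abs_add_le (angVel' x * x a * x b) (angVel x * c)]
  have c1 : ∀ a b : Fin 2, |if a = b then (1 : ℝ) else 0| ≤ 1 := fun a b => by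
    split_ifs <;> simp
  fin_cases j
  · simp only [Fin.zero_eta, pd_vG_zero, abs_neg]; exact key _ _ _ (c1 _ _)
  · simp only [Fin.mk_one, pd_vG_one]; exact key _ _ _ (c1 _ _)

theorem norm_vG_le (x : Plane) : ‖vG x‖ ≤ 1 := by
  rw [vG_eq, norm_smul, norm_perp, Real.norm_of_nonneg (angVel_nonneg x)]
  calc angVel x * ‖x‖ ≤ 1 / (1 + ‖x‖ ^ 2 / 4) * ‖x‖ :=
        mul_le_mul_of_nonneg_right (angVel_le x) (norm_nonneg _)
    _ ≤ 1 := by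
        rw [one_div, inv_mul_le_iff₀ (by positivity)]
        nlinarith [sq_nonneg (‖x‖ / 2 - 1)]

theorem continuous_vG : Continuous vG :=
  (PiLp.continuous_toLp 2 _).comp (continuous_pi fun j => (contDiff_vG j).continuous)

/-- `v^G` decays like `1/|x|` and is not square integrable, but its gradient decays like `1/|x|²`,
which is enough in the plane. -/
theorem memLp_pd_vG (i j : Fin 2) : MemLp (pd i fun x => vG x j) 2 := by
  have hc := (contDiff_pd (contDiff_vG j) i).continuous
  refine (memLp_two_iff_integrable_sq hc.aestronglyMeasurable).2 ?_
  refine (integrable_inv_one_add_sq.const_mul (256 : ℝ)).mono' (hc.pow 2).aestronglyMeasurable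
    (ae_of_all _ fun x => ?_)
  rw [Real.norm_of_nonneg (by positivity), ← sq_abs]
  refine (pow_le_pow_left₀ (abs_nonneg _) (abs_pd_vG_le i j x) 2).trans ?_
  have h : 4 / (1 + ‖x‖ ^ 2 / 4) ≤ 16 * (1 + ‖x‖ ^ 2)⁻¹ := by
    rw [div_eq_mul_inv, show (16 : ℝ) * (1 + ‖x‖ ^ 2)⁻¹ = 4 * ((1 + ‖x‖ ^ 2) / 4)⁻¹ by
      rw [inv_div]; ring]
    refine mul_le_mul_of_nonneg_left (inv_anti₀ (by positivity) (by linarith)) (by norm_num)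
  calc (4 / (1 + ‖x‖ ^ 2 / 4)) ^ 2 ≤ (16 * (1 + ‖x‖ ^ 2)⁻¹) ^ 2 :=
        pow_le_pow_left₀ (by positivity) h 2
    _ = 256 * ((1 + ‖x‖ ^ 2) ^ 2)⁻¹ := by rw [mul_pow, inv_pow]; norm_num

/-- The field `(v^G · ∇) v^G`. -/
def convG (x : Plane) : Plane := convective vG (fun i => ∇ fun y => vG y i) x

theorem convG_apply (x : Plane) (i : Fin 2) : convG x i =
    vG x 0 * pd 0 (fun y => vG y i) x + vG x 1 * pd 1 (fun y => vG y i) x := by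
  change inner ℝ (vG x) ((∇ fun y => vG y i) x) = _
  rw [inner_plane, gradient_apply, gradient_apply]

theorem convG_eq (x : Plane) (i : Fin 2) : convG x i = -(angVel x ^ 2 * x i) := by
  rw [convG_apply, vG_zero_comp, vG_one_comp]
  fin_cases i
  · simp only [Fin.zero_eta, pd_vG_zero]; simp; ring
  · simp only [Fin.mk_one, pd_vG_one]; simp; ring

theorem contDiff_convG (i : Fin 2) : ContDiff ℝ ∞ fun x => convG x i := by
  simp_rw [convG_eq]
  exact ((contDiff_angVel.pow 2).mul (contDiff_coord i)).neg

theorem continuous_convG : Continuous convG :=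
  (PiLp.continuous_toLp 2 _).comp (continuous_pi fun j => (contDiff_convG j).continuous)

theorem norm_convG_le (x : Plane) : ‖convG x‖ ≤ 1 := by
  have e : convG x = -((angVel x ^ 2) • x) := by ext i; simp [convG_eq]
  have h := norm_vG_le x
  rw [vG_eq, norm_smul, norm_perp, Real.norm_of_nonneg (angVel_nonneg x)] at h
  have h1 : angVel x ≤ 1 := (angVel_le x).trans (by
    rw [div_le_one (by positivity)]; nlinarith [sq_nonneg ‖x‖])
  rw [e, norm_neg, norm_smul, Real.norm_of_nonneg (by positivity), sq, mul_assoc]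
  exact mul_le_one₀ h1 (mul_nonneg (angVel_nonneg x) (norm_nonneg _)) h

theorem memLp_bdd_mul {a f : Plane → ℝ} {C : ℝ} (ha : AEStronglyMeasurable a volume)
    (hC : ∀ x, |a x| ≤ C) (hf : MemLp f 2) : MemLp (fun x => a x * f x) 2 :=
  hf.of_le_mul (c := C) (ha.mul hf.1) (ae_of_all _ fun x => by
    rw [norm_mul]; exact mul_le_mul_of_nonneg_right (hC x) (norm_nonneg _))

theorem abs_vG_apply_le (x : Plane) (i : Fin 2) : |vG x i| ≤ 1 :=
  (abs_apply_le_norm _ i).trans (norm_vG_le x)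

theorem memLp_convG : MemLp convG 2 := by
  refine memLp_piLp_iff.2 fun i => ?_
  simp_rw [convG_apply]
  have m := fun j => memLp_bdd_mul (contDiff_vG j).continuous.aestronglyMeasurable
    (fun x => abs_vG_apply_le x j) (memLp_pd_vG j i)
  exact (m 0).add (m 1)

/-- By `convG_eq` the field is the centripetal acceleration `-Ω² x`, radial with radial coefficient.
Being curl free, it can be combined with the pressure gradient. -/
theorem convG_curl {φ : Plane → ℝ} (hφ : IsTestFunction φ) :
    (∫ x, convG x 0 * pd 1 φ x) - ∫ x, convG x 1 * pd 0 φ x = 0 := by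
  have h0 := integral_pd_mul_test (contDiff_convG 0) hφ 1
  have h1 := integral_pd_mul_test (contDiff_convG 1) hφ 0
  have da := differentiable_of_smooth contDiff_angVel
  have e : ∀ x, pd 1 (fun x => convG x 0) x = pd 0 (fun x => convG x 1) x := fun x => by
    simp_rw [convG_eq, sq]
    rw [pd_neg, pd_neg, pd_mul ((da x).fun_mul (da x)) (differentiable_coord 0 x),
      pd_mul ((da x).fun_mul (da x)) (differentiable_coord 1 x), pd_mul (da x) (da x), pd_mul (da x) (da x),
      pd_coord, pd_coord, pd_angVel, pd_angVel]
    simp; ring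
  simp_rw [e] at h0
  linarith

/-! ### Cancellations involving the Oseen vortex -/

theorem abs_integral_wt_le {a f g : Plane → ℝ} {C : ℝ} (ha : AEStronglyMeasurable a volume)
    (hC : ∀ x, |a x| ≤ C) (hf : MemLpw 2 f) (hg : MemLpw 2 g) :
    Integrable (fun x => a x * (wt f x * wt g x)) ∧
      |∫ x, a x * (wt f x * wt g x)| ≤ C * (nX f * nX g) := by
  rw [memLpw_iff] at hf hg
  have i1 := integrable_mul_of_memLp hf hg
  refine ⟨i1.bdd_mul (c := C) ha (ae_of_all _ hC), ?_⟩
  have C0 : 0 ≤ C := (abs_nonneg _).trans (hC 0)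
  calc |∫ x, a x * (wt f x * wt g x)| ≤ ∫ x, C * |wt f x * wt g x| := by
        refine abs_integral_le_integral_abs.trans (integral_mono_of_nonneg
          (ae_of_all _ fun _ => abs_nonneg _) (i1.abs.const_mul _) (ae_of_all _ fun x => ?_))
        simp only []
        rw [abs_mul]
        exact mul_le_mul_of_nonneg_right (hC x) (abs_nonneg _)
    _ ≤ _ := by
        rw [integral_const_mul]
        exact mul_le_mul_of_nonneg_left (integral_abs_mul_le hf hg) C0

theorem tendsto_integral_wt {a f g : Plane → ℝ} {C : ℝ} (ha : AEStronglyMeasurable a volume)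
    (hC : ∀ x, |a x| ≤ C) (hf : MemLpw 2 f) (hg : MemLpw 2 g) {fk gk : ℕ → Plane → ℝ}
    (hfk : ∀ k, MemLpw 2 (fk k)) (hgk : ∀ k, MemLpw 2 (gk k))
    (lf : Tendsto (fun k => nX fun x => f x - fk k x) atTop (𝓝 0))
    (lg : Tendsto (fun k => nX fun x => g x - gk k x) atTop (𝓝 0)) :
    Tendsto (fun k => ∫ x, a x * (wt (fk k) x * wt (gk k) x)) atTop
      (𝓝 (∫ x, a x * (wt f x * wt g x))) := by
  refine tendsto_of_dist_le (ε := fun k => C * ((nX fun x => f x - fk k x) * nX g) +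
    C * ((nX f + nX fun x => f x - fk k x) * nX fun x => g x - gk k x)) (fun k => ?_) ?_
  · obtain ⟨i1, b1⟩ := abs_integral_wt_le ha hC (hf.sub (hfk k)) hg
    obtain ⟨i2, b2⟩ := abs_integral_wt_le ha hC (hfk k) (hg.sub (hgk k))
    have C0 : 0 ≤ C := (abs_nonneg _).trans (hC 0)
    have e : ∫ x, a x * (wt f x * wt g x) - a x * (wt (fk k) x * wt (gk k) x) =
        (∫ x, a x * (wt (fun x => f x - fk k x) x * wt g x)) +
        ∫ x, a x * (wt (fk k) x * wt (fun x => g x - gk k x) x) := by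
      rw [← integral_add i1 i2]
      congr 1; ext x; rw [wt_sub, wt_sub]; ring
    rw [abs_sub_comm, ← integral_sub (abs_integral_wt_le ha hC hf hg).1
      (abs_integral_wt_le ha hC (hfk k) (hgk k)).1, e]
    refine (abs_add_le _ _).trans (add_le_add b1 (b2.trans ?_))
    exact mul_le_mul_of_nonneg_left (mul_le_mul_of_nonneg_right
      (nX_le_add_sub hf (hfk k)) (nX_nonneg _)) C0
  · simpa using ((lf.mul_const (nX g)).const_mul C).add (((lf.const_add (nX f)).mul lg).const_mul C)

/-- The integrand is `v^G · ∇(w²) / (2G)`. Since `v^G` is divergence free and orthogonal to `x`,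
hence to `∇(1/G)`, the field `v^G / G` is divergence free as well. -/
theorem InV.integral_vG_transport {w : Plane → ℝ} {D : Plane → Plane} (h : InV w D) :
    ∫ x, (wt w x * wt (fun x => D x 0) x * vG x 0 + wt w x * wt (fun x => D x 1) x * vG x 1)
      = 0 := by
  obtain ⟨φ, hφ, hw, hD⟩ := h.exists_seq
  have hDi := memLpw_vec_iff.1 h.memD
  have hm := fun i => (contDiff_vG i).continuous.aestronglyMeasurable (μ := volume)
  have hv := fun (i : Fin 2) (x : Plane) => abs_vG_apply_le x i
  have lD : ∀ i, Tendsto (fun k => nX fun x => D x i - pd i (φ k) x) atTop (𝓝 0) := fun i => by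
    refine squeeze_zero (fun _ => nX_nonneg _) (fun k => ?_) hD
    have := nX_comp_le (h.memD.sub (hφ k).inV.memD) i
    simpa only [PiLp.sub_apply, gradient_apply] using this
  have lim := fun i => tendsto_integral_wt (hm i) (hv i) h.mem (hDi i)
    (fun k => (hφ k).memLpw) (fun k => ((hφ k).pd i).memLpw) hw (lD i)
  have e : ∫ x, (wt w x * wt (fun x => D x 0) x * vG x 0 + wt w x * wt (fun x => D x 1) x * vG x 1)
      = (∫ x, vG x 0 * (wt w x * wt (fun x => D x 0) x)) +
        ∫ x, vG x 1 * (wt w x * wt (fun x => D x 1) x) := by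
    rw [← integral_add (abs_integral_wt_le (hm 0) (hv 0) h.mem (hDi 0)).1
      (abs_integral_wt_le (hm 1) (hv 1) h.mem (hDi 1)).1]
    congr 1; ext x; ring
  rw [e]
  refine tendsto_nhds_unique ((lim 0).add (lim 1)) (tendsto_const_nhds.congr fun k => ?_)
  have sg : ContDiff ℝ ∞ fun x => (gh x)⁻¹ * (gh x)⁻¹ := contDiff_gh_inv.mul contDiff_gh_inv
  have sa := fun i => (contDiff_vG i).mul sg
  have ht : IsTestFunction fun x => φ k x * φ k x := (hφ k).mul_left (hφ k).1
  have a0 := integral_pd_mul_test (sa 0) ht 0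
  have a1 := integral_pd_mul_test (sa 1) ht 1
  have pdt : ∀ i x, pd i (fun x => φ k x * φ k x) x = 2 * (φ k x * pd i (φ k) x) := fun i x => by
    rw [pd_mul ((hφ k).differentiable x) ((hφ k).differentiable x)]; ring
  -- The gradient of `1/G` is read off from the product rule for `G * (1/G) = 1`.
  have pdg : ∀ i x, pd i (fun x => (gh x)⁻¹ * (gh x)⁻¹) x = x i / 2 * ((gh x)⁻¹ * (gh x)⁻¹) :=
    fun i x => by
      have h1 : (fun x => G x * ((gh x)⁻¹ * (gh x)⁻¹)) = fun _ => 1 := by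
        ext x; rw [G_eq]; have := gh_ne_zero x; field_simp
      have h2 := pd_G_mul (differentiable_of_smooth sg) i x
      rw [h1, pd_const] at h2
      have := (mul_eq_zero.1 h2.symm).resolve_left (G_pos x).ne'
      linarith
  have dv := fun i => differentiable_of_smooth (contDiff_vG i)
  have dg := differentiable_of_smooth sg
  have I : ∀ i, Integrable fun x => pd i (fun x => vG x i * ((gh x)⁻¹ * (gh x)⁻¹)) x *
      (φ k x * φ k x) := fun i =>
    ((contDiff_pd (sa i) i).continuous.mul ht.continuous).integrable_of_hasCompactSupport
      ht.2.mul_left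
  have s : (∫ x, pd 0 (fun x => vG x 0 * ((gh x)⁻¹ * (gh x)⁻¹)) x * (φ k x * φ k x)) +
      ∫ x, pd 1 (fun x => vG x 1 * ((gh x)⁻¹ * (gh x)⁻¹)) x * (φ k x * φ k x) = 0 := by
    rw [← integral_add (I 0) (I 1)]
    refine (integral_congr_ae (ae_of_all _ fun x => ?_)).trans (integral_zero _ _)
    simp only []
    rw [pd_mul (dv 0 x) (dg x), pd_mul (dv 1 x) (dg x), pdg, pdg]
    have := vG_div x
    have p : vG x 0 * x 0 + vG x 1 * x 1 = 0 := by rw [vG_zero_comp, vG_one_comp]; ring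
    linear_combination (gh x)⁻¹ * (gh x)⁻¹ * (φ k x * φ k x) * (this + p / 2)
  rw [a0, a1] at s
  simp_rw [pdt] at s
  have f : ∀ i, ∫ x, vG x i * ((gh x)⁻¹ * (gh x)⁻¹) * (2 * (φ k x * pd i (φ k) x)) =
      2 * ∫ x, vG x i * (wt (φ k) x * wt (pd i (φ k)) x) := fun i => by
    rw [← integral_const_mul]; congr 1; ext x; simp only [wt, smul_eq_mul]; ring
  rw [f, f] at s
  linarith

theorem InV.integral_vG_grad {w : Plane → ℝ} {D : Plane → Plane} (h : InV w D) :
    ∫ x, inner ℝ (vG x) (D x) = 0 := by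
  obtain ⟨φ, hφ, hw, hD⟩ := h.exists_seq
  have hDi := memLpw_vec_iff.1 h.memD
  have hm := fun i => (contDiff_vG i).continuous.aestronglyMeasurable (μ := volume)
  have I : ∀ i {f : Plane → ℝ}, Integrable f → Integrable fun x => vG x i * f x := fun i f hf =>
    hf.bdd_mul (c := 1) (hm i) (ae_of_all _ fun x => abs_vG_apply_le x i)
  have lim : ∀ i, Tendsto (fun k => ∫ x, vG x i * pd i (φ k) x) atTop
      (𝓝 (∫ x, vG x i * D x i)) := fun i => by
    refine tendsto_of_dist_le (ε := fun k => nX fun x => D x - (∇ (φ k)) x) (fun k => ?_) hD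
    have m := (hDi i).sub ((hφ k).pd i).memLpw
    rw [abs_sub_comm, ← integral_sub (I i (hDi i).integrable) (I i ((hφ k).pd i).integrable)]
    simp_rw [← mul_sub]
    calc |∫ x, vG x i * (D x i - pd i (φ k) x)| ≤ ∫ x, |D x i - pd i (φ k) x| := by
          refine abs_integral_le_integral_abs.trans (integral_mono_of_nonneg
            (ae_of_all _ fun _ => abs_nonneg _) m.integrable.abs (ae_of_all _ fun x => ?_))
          simp only []
          rw [abs_mul]
          exact mul_le_of_le_one_left (abs_nonneg _) (abs_vG_apply_le x i)
      _ ≤ _ := by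
          refine (integral_abs_le_nX m).trans ?_
          have := nX_comp_le (h.memD.sub (hφ k).inV.memD) i
          simpa only [PiLp.sub_apply, gradient_apply] using this
  simp_rw [inner_plane]
  rw [integral_add (I 0 (hDi 0).integrable) (I 1 (hDi 1).integrable)]
  refine tendsto_nhds_unique ((lim 0).add (lim 1)) (tendsto_const_nhds.congr fun k => ?_)
  have a := fun i => integral_pd_mul_test (contDiff_vG i) (hφ k) i
  have J : ∀ i, Integrable fun x => pd i (fun x => vG x i) x * φ k x := fun i =>
    ((contDiff_pd (contDiff_vG i) i).continuous.mul
      (hφ k).continuous).integrable_of_hasCompactSupport (hφ k).2.mul_left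
  have s := integral_add (J 0) (J 1)
  simp_rw [← add_mul, vG_div, zero_mul, integral_zero] at s
  linarith [a 0, a 1]

/-! ### A Liouville theorem for square integrable functions -/

theorem contDiff_convolution_test {ρ h : Plane → ℝ} (hρ : IsTestFunction ρ)
    (hh : LocallyIntegrable h volume) :
    ContDiff ℝ ∞ (ρ ⋆[ContinuousLinearMap.mul ℝ ℝ, volume] h) :=
  hρ.2.contDiff_convolution_left (n := ⊤) _ hρ.1 hh

theorem pd_convolution_test {ρ h : Plane → ℝ} (hρ : IsTestFunction ρ)
    (hh : LocallyIntegrable h volume) (i : Fin 2) :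
    pd i (ρ ⋆[ContinuousLinearMap.mul ℝ ℝ, volume] h) =
      (pd i ρ ⋆[ContinuousLinearMap.mul ℝ ℝ, volume] h) := by
  ext x
  have e := (hρ.2.hasFDerivAt_convolution_left (ContinuousLinearMap.mul ℝ ℝ)
    (hρ.1.of_le (by exact_mod_cast le_top)) hh x).fderiv
  rw [pd, e, convolution_def, convolution_def, ContinuousLinearMap.integral_apply]
  · rfl
  · exact (hρ.2.fderiv (𝕜 := ℝ)).convolutionExists_left _
      (hρ.1.fderiv_right (m := ∞) (by simp)).continuous hh x

theorem convolution_test_eq (ρ h : Plane → ℝ) (x : Plane) :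
    (ρ ⋆[ContinuousLinearMap.mul ℝ ℝ, volume] h) x = ∫ t, h t * ρ (x - t) := by
  rw [convolution_eq_swap]
  congr 1; ext t; simp [mul_comm]

/-- The function `h` is harmonic in the sense of distributions. -/
def IsWeakHarmonic (h : Plane → ℝ) : Prop :=
  ∀ φ, IsTestFunction φ → ∫ x, h x * (pd 0 (pd 0 φ) x + pd 1 (pd 1 φ) x) = 0

theorem pd_pd_reflect {ρ : Plane → ℝ} (hρ : IsTestFunction ρ) (i : Fin 2)
    (x y : Plane) : pd i (pd i fun y => ρ (x - y)) y = pd i (pd i ρ) (x - y) := by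
  have : (pd i fun y => ρ (x - y)) = fun y => - pd i ρ (x - y) :=
    funext fun y => pd_reflect hρ.differentiable i x y
  rw [this, pd_neg, pd_reflect (hρ.pd i).differentiable, neg_neg]

theorem IsWeakHarmonic.laplacian_convolution {h ρ : Plane → ℝ} (hh : IsWeakHarmonic h)
    (hm : LocallyIntegrable h volume) (hρ : IsTestFunction ρ) (x : Plane) :
    pd 0 (pd 0 (ρ ⋆[ContinuousLinearMap.mul ℝ ℝ, volume] h)) x +
      pd 1 (pd 1 (ρ ⋆[ContinuousLinearMap.mul ℝ ℝ, volume] h)) x = 0 := by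
  rw [pd_convolution_test hρ hm, pd_convolution_test hρ hm, pd_convolution_test (hρ.pd 0) hm,
    pd_convolution_test (hρ.pd 1) hm, convolution_test_eq, convolution_test_eq, ← integral_add]
  · have := hh _ (hρ.reflect x)
    simp_rw [pd_pd_reflect hρ] at this
    rw [← this]; congr 1; ext t; ring
  · have t := ((hρ.pd 0).pd 0).reflect x
    exact LocallyIntegrable.test_mul hm t.continuous t.2
  · have t := ((hρ.pd 1).pd 1).reflect x
    exact LocallyIntegrable.test_mul hm t.continuous t.2

/-- The mollification of a square integrable function vanishes at infinity. -/
theorem exists_convolution_decay {h ρ : Plane → ℝ} (hh : MemLp h 2) (hρ : IsTestFunction ρ) :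
    ∃ M : ℕ → ℝ, Tendsto M atTop (𝓝 0) ∧ ∀ (k : ℕ) (x : Plane), (k : ℝ) + 1 ≤ ‖x‖ →
      |(ρ ⋆[ContinuousLinearMap.mul ℝ ℝ, volume] h) x| ≤ M k := by
  obtain ⟨r, hr, h0⟩ := exists_cutoff_eq_one hρ.2
  set θ : ℕ → Plane → ℝ := fun k => {y : Plane | (k : ℝ) + 1 - r ≤ ‖y‖}.indicator fun _ => 1
  have ms : ∀ k : ℕ, MeasurableSet {y : Plane | (k : ℝ) + 1 - r ≤ ‖y‖} := fun k =>
    measurableSet_le measurable_const measurable_norm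
  have hθ1 : ∀ k x, |θ k x| ≤ 1 := fun k x => by
    by_cases hx : x ∈ {y : Plane | (k : ℝ) + 1 - r ≤ ‖y‖}
    · simp only [θ, indicator_of_mem hx, abs_one, le_refl]
    · simp only [θ, indicator_of_notMem hx, abs_zero, zero_le_one]
  have lim := tendsto_l2_of_dominated hh (θ := θ) (C := 1)
    (fun k => (measurable_const.indicator (ms k)).aestronglyMeasurable) hθ1 (fun x => by
      refine tendsto_const_nhds.congr' ?_
      obtain ⟨N, hN⟩ := exists_nat_gt (‖x‖ + r)
      filter_upwards [eventually_ge_atTop N] with k hk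
      have hk' : (N : ℝ) ≤ k := by exact_mod_cast hk
      have : x ∉ {y : Plane | (k : ℝ) + 1 - r ≤ ‖y‖} := fun h => by
        have : (k : ℝ) + 1 - r ≤ ‖x‖ := h
        linarith
      simp only [θ, indicator_of_notMem this])
  refine ⟨fun k => (l2 fun x => θ k x • h x) * l2 ρ, by simpa using lim.mul_const (l2 ρ),
    fun k x hx => ?_⟩
  have mθ : MemLp (fun x => θ k x • h x) 2 := memLp_bdd_mul
    (measurable_const.indicator (ms k)).aestronglyMeasurable (hθ1 k) hh
  have mr : MemLp (fun t => ρ (x - t)) 2 := (hρ.reflect x).memLpw.memLp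
  have el : l2 (fun t => ρ (x - t)) = l2 ρ := by
    rw [l2, l2]
    congr 1
    exact eLpNorm_comp_measurePreserving (g := ρ) (f := fun t => x - t)
      hρ.continuous.aestronglyMeasurable (Measure.measurePreserving_sub_left volume x)
  rw [convolution_test_eq, ← el]
  refine le_of_eq_of_le ?_ (abs_integral_mul_le mθ mr)
  congr 2; ext t
  by_cases ht : (k : ℝ) + 1 - r ≤ ‖t‖
  · have : t ∈ {y : Plane | (k : ℝ) + 1 - r ≤ ‖y‖} := ht
    simp only [θ, indicator_of_mem this, one_smul]
  · have : ρ (x - t) = 0 := h0 _ (by linarith [norm_sub_norm_le x t])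
    simp [this]

theorem fderiv_eq_zero_of_pd {u : Plane → ℝ} {x : Plane} (h : ∀ i, pd i u x = 0) :
    fderiv ℝ u x = 0 := by
  refine ContinuousLinearMap.coe_injective ((EuclideanSpace.basisFun (Fin 2) ℝ).toBasis.ext fun i => ?_)
  simpa [pd] using h i

/-- Caccioppoli for a harmonic function: only the cut-off error survives, and it involves `u` in
`|x| ≥ R` alone. -/
theorem integral_cutoff_grad_le {u : Plane → ℝ} (hu : ContDiff ℝ ∞ u)
    (harm : ∀ x, pd 0 (pd 0 u) x + pd 1 (pd 1 u) x = 0) {R M : ℝ} (hR : 0 < R)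
    (hM : ∀ x, R ≤ ‖x‖ → |u x| ≤ M) :
    ∫ x, cutoff R x * (cutoff R x * (pd 0 u x ^ 2 + pd 1 u x ^ 2)) ≤
      4 * M ^ 2 * (bumpEnergy 0 + bumpEnergy 1) := by
  have hχ := isTestFunction_cutoff hR
  have cu := hu.continuous
  have c1 := fun i => (contDiff_pd hu i).continuous
  have c2 := fun i => (contDiff_pd (contDiff_pd hu i) i).continuous
  have cac := fun i => caccioppoli hu hχ i
  have err : ∀ i, ∫ x, pd i (cutoff R) x * (pd i (cutoff R) x * u x ^ 2)
      ≤ M ^ 2 * bumpEnergy i := fun i => by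
    rw [← integral_pd_cutoff_sq hR i, ← integral_const_mul]
    refine integral_mono (integrable_test_mul (hχ.pd i) ((hχ.pd i).continuous.mul (cu.pow 2)))
      ?_ fun x => ?_
    · exact (integrable_test_mul (hχ.pd i) ((hχ.pd i).continuous.const_mul (M ^ 2))).congr
        (ae_of_all _ fun x => by simp only []; ring)
    · simp only []
      rcases lt_or_ge ‖x‖ R with hx | hx
      · rw [pd_cutoff_eq_zero hR i hx]; simp
      · have h2 : u x ^ 2 ≤ M ^ 2 := by
          rw [← sq_abs]; exact pow_le_pow_left₀ (abs_nonneg _) (hM x hx) 2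
        nlinarith [mul_le_mul_of_nonneg_left h2 (sq_nonneg (pd i (cutoff R) x))]
  have main : (∫ x, cutoff R x * (cutoff R x * u x * pd 0 (pd 0 u) x)) +
      ∫ x, cutoff R x * (cutoff R x * u x * pd 1 (pd 1 u) x) = 0 := by
    have I : ∀ i, Integrable fun x => cutoff R x * (cutoff R x * u x * pd i (pd i u) x) :=
      fun i => integrable_test_mul hχ ((hχ.continuous.mul cu).mul (c2 i))
    rw [← integral_add (I 0) (I 1)]
    refine (integral_congr_ae (ae_of_all _ fun x => ?_)).trans (integral_zero _ _)
    linear_combination cutoff R x * cutoff R x * u x * harm x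
  have split : ∫ x, cutoff R x * (cutoff R x * (pd 0 u x ^ 2 + pd 1 u x ^ 2)) =
      (∫ x, cutoff R x * (cutoff R x * pd 0 u x ^ 2)) +
      ∫ x, cutoff R x * (cutoff R x * pd 1 u x ^ 2) := by
    have I : ∀ i, Integrable fun x => cutoff R x * (cutoff R x * pd i u x ^ 2) := fun i =>
      integrable_test_mul hχ (hχ.continuous.mul ((c1 i).pow 2))
    rw [← integral_add (I 0) (I 1)]
    congr 1; ext x; ring
  rw [split]
  linarith [cac 0, cac 1, err 0, err 1]

/-- Letting the radius grow in the Caccioppoli bound, the Dirichlet integral of `u` vanishes; `u` is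
then constant, and it tends to zero at infinity. -/
theorem eq_zero_of_harmonic_of_decay {u : Plane → ℝ} (hu : ContDiff ℝ ∞ u)
    (harm : ∀ x, pd 0 (pd 0 u) x + pd 1 (pd 1 u) x = 0) {M : ℕ → ℝ}
    (hM : Tendsto M atTop (𝓝 0)) (hMu : ∀ (k : ℕ) (x : Plane), (k : ℝ) + 1 ≤ ‖x‖ → |u x| ≤ M k) (x : Plane) :
    u x = 0 := by
  set g : Plane → ℝ := fun x => pd 0 u x ^ 2 + pd 1 u x ^ 2 with hg
  have hc : Continuous g := ((contDiff_pd hu 0).continuous.pow 2).add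
    ((contDiff_pd hu 1).continuous.pow 2)
  have g0 : ∀ x, 0 ≤ g x := fun x => by positivity
  have int : ∀ k : ℕ, Integrable fun x =>
      cutoff ((k : ℝ) + 1) x * (cutoff ((k : ℝ) + 1) x * g x) := fun k =>
    integrable_test_mul (isTestFunction_cutoff (by positivity))
      ((contDiff_cutoff _).continuous.mul hc)
  have key : ∫⁻ x, ENNReal.ofReal (g x) ≤ 0 := by
    calc ∫⁻ x, ENNReal.ofReal (g x)
        = ∫⁻ x, liminf (fun k : ℕ => ENNReal.ofReal
            (cutoff ((k : ℝ) + 1) x * (cutoff ((k : ℝ) + 1) x * g x))) atTop := by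
          refine lintegral_congr fun x => ?_
          have := (tendsto_cutoff x).mul ((tendsto_cutoff x).mul_const (g x))
          rw [one_mul, one_mul] at this
          exact ((ENNReal.continuous_ofReal.tendsto _).comp this).liminf_eq.symm
      _ ≤ liminf (fun k : ℕ => ∫⁻ x, ENNReal.ofReal
            (cutoff ((k : ℝ) + 1) x * (cutoff ((k : ℝ) + 1) x * g x))) atTop :=
          lintegral_liminf_le' fun k => ((int k).aestronglyMeasurable.aemeasurable).ennreal_ofReal
      _ ≤ liminf (fun k : ℕ => ENNReal.ofReal (4 * M k ^ 2 * (bumpEnergy 0 + bumpEnergy 1)))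
            atTop := by
          refine liminf_le_liminf (Eventually.of_forall fun k => ?_)
          rw [← ofReal_integral_eq_lintegral_ofReal (int k) (ae_of_all _ fun x =>
            mul_nonneg (cutoff_nonneg _ _) (mul_nonneg (cutoff_nonneg _ _) (g0 x)))]
          exact ENNReal.ofReal_le_ofReal (integral_cutoff_grad_le hu harm (by positivity) (hMu k))
      _ = 0 := by
          have l := ((hM.pow 2).const_mul 4).mul_const (bumpEnergy 0 + bumpEnergy 1)
          have := ((ENNReal.continuous_ofReal.tendsto _).comp l).liminf_eq
          simpa [Function.comp_def] using this
  have gz : ∀ x, g x = 0 := by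
    have h1 := (lintegral_eq_zero_iff hc.measurable.ennreal_ofReal).1 (le_antisymm key zero_le)
    have h2 : g =ᵐ[volume] fun _ => 0 := by
      filter_upwards [h1] with x hx
      exact le_antisymm (ENNReal.ofReal_eq_zero.1 hx) (g0 x)
    exact fun x => congrFun ((hc.ae_eq_iff_eq volume continuous_const).1 h2) x
  have pz : ∀ x i, pd i u x = 0 := fun x i => by
    have := gz x
    simp only [hg] at this
    have h0 : pd 0 u x = 0 := by nlinarith [sq_nonneg (pd 0 u x), sq_nonneg (pd 1 u x)]
    have h1 : pd 1 u x = 0 := by nlinarith [sq_nonneg (pd 0 u x), sq_nonneg (pd 1 u x)]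
    fin_cases i <;> assumption
  have const := is_const_of_fderiv_eq_zero (𝕜 := ℝ) (differentiable_of_smooth hu)
    fun x => fderiv_eq_zero_of_pd (pz x)
  have : |u x| ≤ 0 := by
    refine ge_of_tendsto' hM fun k => ?_
    rw [const x (EuclideanSpace.single 0 ((k : ℝ) + 1))]
    refine hMu k _ ?_
    rw [PiLp.norm_single, Real.norm_of_nonneg (by positivity)]
  exact abs_nonpos_iff.1 this

/-- A square integrable weakly harmonic function vanishes. -/
theorem IsWeakHarmonic.ae_eq_zero {h : Plane → ℝ} (hh : IsWeakHarmonic h) (hm : MemLp h 2) :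
    h =ᵐ[volume] 0 := by
  have hl : LocallyIntegrable h volume := hm.locallyIntegrable (by norm_num)
  refine ae_eq_zero_of_integral_contDiff_smul_eq_zero hl fun φ h1 h2 => ?_
  have hφ : IsTestFunction φ := ⟨h1, h2⟩
  -- The convolution with the reflected `φ`, evaluated at the origin, is the pairing of `h` with
  -- `φ`.
  have hρ : IsTestFunction fun y => φ (0 - y) := hφ.reflect 0
  obtain ⟨M, hM, hMu⟩ := exists_convolution_decay hm hρ
  have := eq_zero_of_harmonic_of_decay (contDiff_convolution_test hρ hl)
    (hh.laplacian_convolution hl hρ) hM hMu 0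
  rw [convolution_test_eq] at this
  simpa [mul_comm] using this

/-! ### Square integrable gradients -/

theorem IsTestFunction.memLp_gradient {φ : Plane → ℝ} (hφ : IsTestFunction φ) :
    MemLp (∇ φ) 2 := hφ.inV.memD.memLp

theorem inner_toLp_vec {F H : Plane → Plane} (hF : MemLp F 2) (hH : MemLp H 2) :
    inner ℝ (hF.toLp F) (hH.toLp H) = ∫ x, inner ℝ (F x) (H x) := by
  rw [L2.inner_def]
  refine integral_congr_ae ?_
  filter_upwards [hF.coeFn_toLp, hH.coeFn_toLp] with x h1 h2
  rw [h1, h2]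

theorem integrable_inner {F H : Plane → Plane} (hF : MemLp F 2) (hH : MemLp H 2) :
    Integrable fun x => inner ℝ (F x) (H x) := by
  refine (L2.integrable_inner (𝕜 := ℝ) (hF.toLp F) (hH.toLp H)).congr ?_
  filter_upwards [hF.coeFn_toLp, hH.coeFn_toLp] with x h1 h2
  rw [h1, h2]

theorem integral_inner_gradient {F : Plane → Plane} (hF : MemLp F 2) {φ : Plane → ℝ}
    (hφ : IsTestFunction φ) : ∫ x, inner ℝ (F x) ((∇ φ) x) =
      (∫ x, F x 0 * pd 0 φ x) + ∫ x, F x 1 * pd 1 φ x := by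
  have m := memLp_piLp_iff.1 hF
  rw [← integral_add (integrable_mul_of_memLp (m 0) (hφ.pd 0).memLpw.memLp)
    (integrable_mul_of_memLp (m 1) (hφ.pd 1).memLpw.memLp)]
  simp_rw [inner_plane, gradient_apply]

theorem memLp_perp {F : Plane → Plane} (hF : MemLp F 2) : MemLp (fun x => perp (F x)) 2 :=
  hF.of_le_mul (c := 1) (continuous_perp.comp_aestronglyMeasurable hF.1)
    (ae_of_all _ fun x => by rw [norm_perp, one_mul])

theorem integral_inner_perp_gradient {F : Plane → Plane} (hF : MemLp F 2) {φ : Plane → ℝ}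
    (hφ : IsTestFunction φ) : ∫ x, inner ℝ (F x) (perp ((∇ φ) x)) =
      -((∫ x, F x 0 * pd 1 φ x) - ∫ x, F x 1 * pd 0 φ x) := by
  have m := memLp_piLp_iff.1 hF
  rw [← integral_sub (integrable_mul_of_memLp (m 0) (hφ.pd 1).memLpw.memLp)
    (integrable_mul_of_memLp (m 1) (hφ.pd 0).memLpw.memLp), ← integral_neg]
  simp_rw [inner_plane, perp_zero, perp_one, gradient_apply]
  congr 1; ext x; ring

/-- A square integrable vector field without divergence and curl vanishes. -/
theorem ae_eq_zero_of_div_curl {R : Plane → Plane} (hR : MemLp R 2)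
    (div : ∀ φ, IsTestFunction φ → ∫ x, inner ℝ (R x) ((∇ φ) x) = 0)
    (curl : ∀ φ, IsTestFunction φ → ∫ x, inner ℝ (R x) (perp ((∇ φ) x)) = 0) :
    R =ᵐ[volume] 0 := by
  have m := memLp_piLp_iff.1 hR
  have c01 : ∀ φ, IsTestFunction φ → pd 0 (pd 1 φ) = pd 1 (pd 0 φ) := fun φ hφ =>
    funext fun x => pd_comm hφ.1 0 1 x
  have I : ∀ (j : Fin 2) {ψ : Plane → ℝ}, IsTestFunction ψ → Integrable fun x => R x j * ψ x :=
    fun j ψ hψ => integrable_mul_of_memLp (m j) hψ.memLpw.memLp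
  -- `ΔR = ∇ div R + ∇^⊥ curl R`: testing the divergence with `∂₀φ` and the curl with `∂₁φ`, the
  -- mixed derivatives cancel and the Laplacian of `φ` is left against the first component.
  have h0 : IsWeakHarmonic fun x => R x 0 := fun φ hφ => by
    have a := div _ (hφ.pd 0)
    have b := curl _ (hφ.pd 1)
    rw [integral_inner_gradient hR (hφ.pd 0)] at a
    rw [integral_inner_perp_gradient hR (hφ.pd 1), c01 φ hφ] at b
    simp_rw [mul_add]
    rw [integral_add (I 0 ((hφ.pd 0).pd 0)) (I 0 ((hφ.pd 1).pd 1))]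
    linarith
  have h1 : IsWeakHarmonic fun x => R x 1 := fun φ hφ => by
    have a := div _ (hφ.pd 1)
    have b := curl _ (hφ.pd 0)
    rw [integral_inner_gradient hR (hφ.pd 1), c01 φ hφ] at a
    rw [integral_inner_perp_gradient hR (hφ.pd 0)] at b
    simp_rw [mul_add]
    rw [integral_add (I 1 ((hφ.pd 0).pd 0)) (I 1 ((hφ.pd 1).pd 1))]
    linarith
  filter_upwards [h0.ae_eq_zero (m 0), h1.ae_eq_zero (m 1)] with x e0 e1
  ext i
  fin_cases i
  · simpa using e0
  · simpa using e1

/-- The space of square integrable gradients. -/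
def gradSpace : Submodule ℝ (Lp Plane 2 (volume : Measure Plane)) :=
  (Submodule.span ℝ {v | ∃ φ, ∃ hφ : IsTestFunction φ, v = hφ.memLp_gradient.toLp (∇ φ)}
    ).topologicalClosure

theorem toLp_gradient_mem {φ : Plane → ℝ} (hφ : IsTestFunction φ) :
    hφ.memLp_gradient.toLp (∇ φ) ∈ gradSpace :=
  Submodule.le_topologicalClosure _ (Submodule.subset_span ⟨φ, hφ, rfl⟩)

theorem mem_gradSpace_orthogonal {v : Lp Plane 2 (volume : Measure Plane)}
    (h : ∀ φ, ∀ hφ : IsTestFunction φ, inner ℝ v (hφ.memLp_gradient.toLp (∇ φ)) = 0) :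
    v ∈ gradSpaceᗮ := by
  rw [gradSpace, Submodule.orthogonal_closure, Submodule.mem_orthogonal']
  intro u hu
  induction hu using Submodule.span_induction with
  | mem x hx => obtain ⟨φ, hφ, rfl⟩ := hx; exact h φ hφ
  | zero => simp
  | add x y _ _ h1 h2 => rw [inner_add_right, h1, h2, add_zero]
  | smul c x _ h1 => rw [inner_smul_right, h1, mul_zero]

/-- A curl-free field is controlled by any field with the same divergence. -/
theorem l2_le_of_curl_free {P F : Plane → Plane} (hP : MemLp P 2) (hF : MemLp F 2)
    (curl : ∀ φ, IsTestFunction φ → ∫ x, inner ℝ (P x) (perp ((∇ φ) x)) = 0)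
    (div : ∀ φ, IsTestFunction φ →
      ∫ x, inner ℝ (P x) ((∇ φ) x) = ∫ x, inner ℝ (F x) ((∇ φ) x)) :
    l2 P ≤ l2 F := by
  have : CompleteSpace gradSpace :=
    (Submodule.isClosed_topologicalClosure _).completeSpace_coe
  set p := hP.toLp P
  set f := hF.toLp F
  have hpf : p - f ∈ gradSpaceᗮ := mem_gradSpace_orthogonal fun φ hφ => by
    rw [inner_sub_left, inner_toLp_vec, inner_toLp_vec, div φ hφ, sub_self]
  have hperp : ∀ φ, ∀ hφ : IsTestFunction φ,
      (memLp_perp hφ.memLp_gradient).toLp _ ∈ gradSpaceᗮ := fun φ hφ =>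
    mem_gradSpace_orthogonal fun ψ hψ => by
      have := integral_inner_perp_gradient hψ.memLp_gradient hφ
      simp_rw [gradient_apply] at this
      have a := integral_pd_mul_test hψ.1 (hφ.pd 1) 0
      have b := integral_pd_mul_test hψ.1 (hφ.pd 0) 1
      rw [show pd 0 (pd 1 φ) = pd 1 (pd 0 φ) from funext fun x => pd_comm hφ.1 0 1 x] at a
      rw [real_inner_comm, inner_toLp_vec, this, a, b, sub_self, neg_zero]
  set q := gradSpace.starProjection p
  have hq : q ∈ gradSpace := Submodule.starProjection_apply_mem _ _
  have hr : p - q ∈ gradSpaceᗮ := Submodule.sub_starProjection_mem_orthogonal _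
  -- `p` is curl free by assumption and `q` because gradients are orthogonal to rotated gradients;
  -- `p - q` is also divergence free, as it is orthogonal to gradients. Hence it vanishes, and `p`
  -- is a limit of gradients.
  have r0 : p - q = 0 := by
    have hm := Lp.memLp (p - q)
    have hz : ⇑(p - q) =ᵐ[volume] 0 := by
      refine ae_eq_zero_of_div_curl hm (fun φ hφ => ?_) fun φ hφ => ?_
      · rw [← inner_toLp_vec hm hφ.memLp_gradient, Lp.toLp_coeFn]
        exact Submodule.inner_left_of_mem_orthogonal (toLp_gradient_mem hφ) hr
      · rw [← inner_toLp_vec hm (memLp_perp hφ.memLp_gradient), Lp.toLp_coeFn, inner_sub_left,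
          Submodule.inner_right_of_mem_orthogonal hq (hperp φ hφ), inner_toLp_vec, curl φ hφ,
          sub_zero]
    exact (Lp.eq_zero_iff_ae_eq_zero).2 hz
  have hp : p ∈ gradSpace := by rw [sub_eq_zero.1 r0]; exact hq
  -- So `‖p‖² = ⟨p, f⟩`: the field `p` is the orthogonal projection of `f` on the gradients.
  have h1 : inner ℝ p (p - f) = 0 := Submodule.inner_right_of_mem_orthogonal hp hpf
  rw [inner_sub_right, real_inner_self_eq_norm_sq] at h1
  have h2 := real_inner_le_norm p f
  have e1 : l2 P = ‖p‖ := (Lp.norm_toLp P hP).symm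
  have e2 : l2 F = ‖f‖ := (Lp.norm_toLp F hF).symm
  rw [e1, e2]
  by_contra hlt
  push Not at hlt
  have : 0 < ‖p‖ := (norm_nonneg f).trans_lt hlt
  nlinarith

/-! ### Uniqueness of weak derivatives of the velocity -/

theorem ae_eq_of_test {f g : Plane → ℝ} (hf : LocallyIntegrable f volume)
    (hg : LocallyIntegrable g volume)
    (h : ∀ φ, IsTestFunction φ → ∫ x, φ x * f x = ∫ x, φ x * g x) : f =ᵐ[volume] g :=
  ae_eq_of_integral_contDiff_smul_eq hf hg fun φ h1 h2 => h φ ⟨h1, h2⟩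

theorem IsWeakGradient.unique {f : Plane → ℝ} {g g' : Plane → Plane} (h : IsWeakGradient f g)
    (h' : IsWeakGradient f g') : g =ᵐ[volume] g' := by
  rw [isWeakGradient_iff] at h h'
  have := fun i => ae_eq_of_test (LocallyIntegrable_comp h.2.1 i) (LocallyIntegrable_comp h'.2.1 i)
    fun φ hφ => neg_injective ((h.2.2 φ hφ i).symm.trans (h'.2.2 φ hφ i))
  filter_upwards [this 0, this 1] with x h0 h1
  ext i; fin_cases i <;> assumption

theorem IsWeakGradient.add {f f' : Plane → ℝ} {g g' : Plane → Plane} (h : IsWeakGradient f g)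
    (h' : IsWeakGradient f' g') : IsWeakGradient (fun x => f x + f' x) (fun x => g x + g' x) := by
  rw [isWeakGradient_iff] at *
  refine ⟨h.1.add h'.1, h.2.1.add h'.2.1, fun φ hφ i => ?_⟩
  have e1 := integral_add (LocallyIntegrable.test_mul h.1 (hφ.pd i).continuous (hφ.pd i).2)
    (LocallyIntegrable.test_mul h'.1 (hφ.pd i).continuous (hφ.pd i).2)
  have e2 := integral_add
    (LocallyIntegrable.test_mul (LocallyIntegrable_comp h.2.1 i) hφ.continuous hφ.2)
    (LocallyIntegrable.test_mul (LocallyIntegrable_comp h'.2.1 i) hφ.continuous hφ.2)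
  have c : ∀ g : Plane → Plane, ∫ x, φ x * g x i = ∫ x, g x i * φ x := fun g => by
    simp_rw [mul_comm]
  have p := h.2.2 φ hφ i
  have q := h'.2.2 φ hφ i
  rw [c] at p q
  simp_rw [← add_mul] at e1 e2
  rw [e1, c, p, q]
  simp only [PiLp.add_apply]
  rw [e2]; ring

theorem velocity_apply (α : ℝ) (w : Plane → ℝ) (x : Plane) (i : Fin 2) :
    velocity α w x i = α * vG x i + biotSavart w x i := by simp [velocity]

theorem contDiff_const_vG (α : ℝ) (i : Fin 2) : ContDiff ℝ ∞ fun x => α * vG x i :=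
  contDiff_const.mul (contDiff_vG i)

theorem gradient_const_vG (α : ℝ) (i : Fin 2) (x : Plane) :
    (∇ fun x => α * vG x i) x = α • (∇ fun x => vG x i) x := by
  ext j
  rw [gradient_apply, pd_const_mul (differentiable_of_smooth (contDiff_vG i) x), PiLp.smul_apply,
    gradient_apply, smul_eq_mul]

theorem memLp_gradient_vG (i : Fin 2) : MemLp (∇ fun x => vG x i) 2 :=
  memLp_piLp_iff.2 fun j => by simp_rw [gradient_apply]; exact memLp_pd_vG j i

theorem isWeakGradient_velocity {α : ℝ} {w : Plane → ℝ} {i : Fin 2} {B : Plane → Plane}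
    (hB : IsWeakGradient (fun ξ => biotSavart w ξ i) B) :
    IsWeakGradient (fun x => velocity α w x i) fun x => α • (∇ fun x => vG x i) x + B x := by
  have := (IsTestFunction.isWeakGradient (contDiff_const_vG α i)).add hB
  simp_rw [gradient_const_vG] at this
  simpa only [velocity_apply] using this

/-- The gradient of the total vorticity, rotated: the Laplacian of the velocity. -/
def lapVel (α : ℝ) (D : Plane → Plane) (x : Plane) : Plane :=
  perp (α • (∇ G) x + curlConst • D x)

theorem integrable_pd_G (i : Fin 2) : Integrable (pd i G) := by
  have := (integrable_G_mul (hasTemperateGrowth_coord i)).const_mul (-1 / 2)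
  refine this.congr (ae_of_all _ fun x => ?_)
  simp only []
  rw [pd_G]; ring

theorem laplacian_test_eq {φ : Plane → ℝ} (hφ : IsTestFunction φ) (x : Plane) :
    (Δ φ) x = pd 0 (pd 0 φ) x + pd 1 (pd 1 φ) x := laplacian_eq hφ.1 x

theorem vG_weak_div {ψ : Plane → ℝ} (hψ : IsTestFunction ψ) :
    (∫ x, vG x 0 * pd 0 ψ x) + ∫ x, vG x 1 * pd 1 ψ x = 0 := by
  have a := fun i => integral_pd_mul_test (contDiff_vG i) hψ i
  have J : ∀ i, Integrable fun x => pd i (fun x => vG x i) x * ψ x := fun i =>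
    ((contDiff_pd (contDiff_vG i) i).continuous.mul
      hψ.continuous).integrable_of_hasCompactSupport hψ.2.mul_left
  have s := integral_add (J 0) (J 1)
  simp_rw [← add_mul, vG_div, zero_mul, integral_zero] at s
  linarith [a 0, a 1]

theorem vG_weak_curl {ψ : Plane → ℝ} (hψ : IsTestFunction ψ) :
    (∫ x, vG x 0 * pd 1 ψ x) - ∫ x, vG x 1 * pd 0 ψ x = ∫ x, G x * ψ x := by
  have a0 := integral_pd_mul_test (contDiff_vG 0) hψ 1
  have a1 := integral_pd_mul_test (contDiff_vG 1) hψ 0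
  have J : ∀ i j, Integrable fun x => pd i (fun x => vG x j) x * ψ x := fun i j =>
    ((contDiff_pd (contDiff_vG j) i).continuous.mul
      hψ.continuous).integrable_of_hasCompactSupport hψ.2.mul_left
  have s := integral_sub (J 0 1) (J 1 0)
  simp_rw [← sub_mul, vG_curl] at s
  linarith

theorem InV.velocity_weak_div {w : Plane → ℝ} {D : Plane → Plane} (h : InV w D) (α : ℝ)
    {ψ : Plane → ℝ} (hψ : IsTestFunction ψ) :
    (∫ x, velocity α w x 0 * pd 0 ψ x) + ∫ x, velocity α w x 1 * pd 1 ψ x = 0 := by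
  have I : ∀ i j, Integrable fun x => vG x j * pd i ψ x := fun i j =>
    LocallyIntegrable.test_mul (contDiff_vG j).continuous.locallyIntegrable (hψ.pd i).continuous (hψ.pd i).2
  have J : ∀ i j, Integrable fun x => biotSavart w x j * pd i ψ x := fun i j =>
    h.integrable_bs_mul j (hψ.pd i).integrable
  have e : ∀ i j, ∫ x, velocity α w x j * pd i ψ x =
      α * (∫ x, vG x j * pd i ψ x) + ∫ x, biotSavart w x j * pd i ψ x := fun i j => by
    simp_rw [velocity_apply, add_mul, mul_assoc]
    rw [integral_add ((I i j).const_mul α) (J i j), integral_const_mul]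
  rw [e, e]
  linear_combination α * vG_weak_div hψ + h.bs_weak_div hψ.1 hψ.integrable
    (fun i => (hψ.pd i).integrable) hψ.memLpw.memLp

theorem InV.velocity_weak_curl {w : Plane → ℝ} {D : Plane → Plane} (h : InV w D) (α : ℝ)
    {ψ : Plane → ℝ} (hψ : IsTestFunction ψ) :
    (∫ x, velocity α w x 0 * pd 1 ψ x) - ∫ x, velocity α w x 1 * pd 0 ψ x =
      α * (∫ x, G x * ψ x) + curlConst * ∫ x, w x * ψ x := by
  have I : ∀ i j, Integrable fun x => vG x j * pd i ψ x := fun i j =>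
    LocallyIntegrable.test_mul (contDiff_vG j).continuous.locallyIntegrable (hψ.pd i).continuous (hψ.pd i).2
  have J : ∀ i j, Integrable fun x => biotSavart w x j * pd i ψ x := fun i j =>
    h.integrable_bs_mul j (hψ.pd i).integrable
  have e : ∀ i j, ∫ x, velocity α w x j * pd i ψ x =
      α * (∫ x, vG x j * pd i ψ x) + ∫ x, biotSavart w x j * pd i ψ x := fun i j => by
    simp_rw [velocity_apply, add_mul, mul_assoc]
    rw [integral_add ((I i j).const_mul α) (J i j), integral_const_mul]
  rw [e, e]
  linear_combination α * vG_weak_curl hψ + h.bs_weak_curl hψ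

theorem InV.continuous_velocity {w : Plane → ℝ} {D : Plane → Plane} (h : InV w D) (α : ℝ)
    (i : Fin 2) : Continuous fun x => velocity α w x i := by
  simp_rw [velocity_apply]
  exact (contDiff_const_vG α i).continuous.add (h.continuous_bs_apply i)

theorem IsWeakGradient.integral_pd_test {w : Plane → ℝ} {D : Plane → Plane}
    (h : IsWeakGradient w D) {φ : Plane → ℝ} (hφ : IsTestFunction φ) (i : Fin 2) :
    ∫ x, w x * pd i φ x = - ∫ x, φ x * D x i := (isWeakGradient_iff.1 h).2.2 φ hφ i

theorem memLp_gradient_G : MemLp (∇ G) 2 := by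
  refine memLp_piLp_iff.2 fun i => ?_
  simp_rw [gradient_apply]
  have := (memLpw_G_mul ((hasTemperateGrowth_coord i).fun_mul
    (Function.HasTemperateGrowth.const (-1 / 2 : ℝ)))).memLp
  refine this.congr_norm (contDiff_pd contDiff_G i).continuous.aestronglyMeasurable
    (ae_of_all _ fun x => ?_)
  rw [pd_G]; congr 1; ring

theorem InV.memLp_lapVel {w : Plane → ℝ} {D : Plane → Plane} (h : InV w D) (α : ℝ) :
    MemLp (lapVel α D) 2 :=
  memLp_perp ((memLp_gradient_G.const_smul α).add (h.memD.memLp.const_smul curlConst))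

theorem integral_lapVel {w : Plane → ℝ} {D : Plane → Plane} (h : InV w D) (α : ℝ)
    {φ : Plane → ℝ} (hφ : IsTestFunction φ) (i : Fin 2) :
    α * (∫ x, G x * pd i φ x) + curlConst * ∫ x, w x * pd i φ x =
      - ∫ x, φ x * (α * pd i G x + curlConst * D x i) := by
  rw [h.grad.integral_pd_test hφ i, (IsTestFunction.isWeakGradient contDiff_G).integral_pd_test hφ i]
  simp_rw [gradient_apply, mul_add, mul_left_comm (φ _)]
  have I1 : Integrable fun x => φ x * pd i G x :=
    integrable_test_mul hφ (contDiff_pd contDiff_G i).continuous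
  have I2 : Integrable fun x => φ x * D x i :=
    integrable_mul_of_memLp hφ.memLpw.memLp (memLpw_vec_iff.1 h.memD i).memLp
  rw [integral_add (I1.const_mul α) (I2.const_mul _), integral_const_mul, integral_const_mul]
  ring

/-- For a divergence free field the Laplacian is the rotated gradient of the curl, and the curl of
the velocity is `α G + curlConst * w`. The pressure equation only provides some weak Laplacian; this
identifies it. -/
theorem InV.weakLaplacian_unique {w : Plane → ℝ} {D : Plane → Plane} (h : InV w D) {α : ℝ}
    {L : Plane → Plane}
    (hL : ∀ i, IsWeakLaplacian (fun x => velocity α w x i) fun x => L x i) :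
    L =ᵐ[volume] lapVel α D := by
  have mL := memLp_piLp_iff.1 (h.memLp_lapVel α)
  have key : ∀ φ, IsTestFunction φ → ∀ i, ∫ x, velocity α w x i * (Δ φ) x
      = ∫ x, φ x * lapVel α D x i := fun φ hφ i => by
    have I : ∀ i j k, Integrable fun x => velocity α w x i * pd j (pd k φ) x := fun i j k =>
      LocallyIntegrable.test_mul (h.continuous_velocity α i).locallyIntegrable
        ((hφ.pd k).pd j).continuous ((hφ.pd k).pd j).2
    have c : pd 0 (pd 1 φ) = pd 1 (pd 0 φ) := funext fun x => pd_comm hφ.1 0 1 x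
    have d0 := h.velocity_weak_div α (hφ.pd 0)
    have d1 := h.velocity_weak_div α (hφ.pd 1)
    have c0 := h.velocity_weak_curl α (hφ.pd 0)
    have c1 := h.velocity_weak_curl α (hφ.pd 1)
    rw [c] at c1 d1
    rw [integral_lapVel h α hφ] at c0 c1
    simp_rw [laplacian_test_eq hφ, mul_add]
    rw [integral_add (I i 0 0) (I i 1 1)]
    have e : ∀ x, lapVel α D x 0 = -(α * pd 1 G x + curlConst * D x 1) ∧
        lapVel α D x 1 = α * pd 0 G x + curlConst * D x 0 := fun x => by
      simp [lapVel, gradient_apply]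
    fin_cases i
    · simp only [Fin.zero_eta, (e _).1, mul_neg, integral_neg]
      linarith
    · simp only [Fin.mk_one, (e _).2]
      linarith
  have := fun i => ae_eq_of_test (hL i).locInt_lap ((mL i).locallyIntegrable (by norm_num))
    fun φ hφ => by
      rw [← key φ hφ i, (hL i).integral_eq φ hφ]
      simp_rw [mul_comm]
  filter_upwards [this 0, this 1] with x h0 h1
  ext i; fin_cases i <;> assumption

/-- Rotated gradients are divergence free by symmetry of second derivatives. Consequently `(1 + b)
Δv` acts in the pressure equation only through `b Δv`. -/
theorem InV.lapVel_div_free {w : Plane → ℝ} {D : Plane → Plane} (h : InV w D) (α : ℝ)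
    {φ : Plane → ℝ} (hφ : IsTestFunction φ) :
    ∫ x, inner ℝ (lapVel α D x) ((∇ φ) x) = 0 := by
  have a0 := integral_lapVel h α (hφ.pd 0) 1
  have a1 := integral_lapVel h α (hφ.pd 1) 0
  have c : pd 0 (pd 1 φ) = pd 1 (pd 0 φ) := funext fun x => pd_comm hφ.1 0 1 x
  rw [c] at a1
  rw [integral_inner_gradient (h.memLp_lapVel α) hφ]
  have e : ∀ x, lapVel α D x 0 = -(α * pd 1 G x + curlConst * D x 1) ∧
      lapVel α D x 1 = α * pd 0 G x + curlConst * D x 0 := fun x => by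
    simp [lapVel, gradient_apply]
  simp_rw [(e _).1, (e _).2, neg_mul, integral_neg, mul_comm _ (pd _ φ _)]
  linarith

/-! ### The pressure estimate -/

theorem IsPressureGradient.curl_free {b : Plane → ℝ} {v P : Plane → Plane}
    (h : IsPressureGradient b v P) {φ : Plane → ℝ} (hφ : IsTestFunction φ) :
    ∫ x, inner ℝ (P x) (perp ((∇ φ) x)) = 0 := by
  obtain ⟨p, hp⟩ := h.isGradient
  have a0 := hp.integral_pd_test (hφ.pd 1) 0
  have a1 := hp.integral_pd_test (hφ.pd 0) 1
  rw [show pd 0 (pd 1 φ) = pd 1 (pd 0 φ) from funext fun x => pd_comm hφ.1 0 1 x] at a0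
  rw [integral_inner_perp_gradient h.memLp hφ]
  simp_rw [mul_comm _ (pd _ φ _)]
  linarith

/-- The part of `(v · ∇) v` which does not involve the Oseen vortex only. -/
def convRem (α : ℝ) (w : Plane → ℝ) (B : Fin 2 → Plane → Plane) (x : Plane) : Plane :=
  WithLp.toLp 2 fun i => inner ℝ (velocity α w x) (B i x) +
    α * inner ℝ (biotSavart w x) ((∇ fun y => vG y i) x)

theorem convective_velocity (α : ℝ) (w : Plane → ℝ) (B : Fin 2 → Plane → Plane) (x : Plane) :
    convective (velocity α w) (fun i x => α • (∇ fun y => vG y i) x + B i x) x =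
      convRem α w B x + α ^ 2 • convG x := by
  ext i
  change inner ℝ (velocity α w x) (α • (∇ fun y => vG y i) x + B i x) =
    inner ℝ (velocity α w x) (B i x) + α * inner ℝ (biotSavart w x) ((∇ fun y => vG y i) x) +
      α ^ 2 * inner ℝ (vG x) ((∇ fun y => vG y i) x)
  rw [inner_add_right, inner_smul_right, velocity, inner_add_left, inner_add_left, inner_smul_left,
    inner_smul_left]
  simp; ring

theorem memLp_inner_bdd {a F : Plane → Plane} {C : ℝ} (ha : AEStronglyMeasurable a volume)
    (hC : ∀ x, ‖a x‖ ≤ C) (hF : MemLp F 2) :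
    MemLp (fun x => inner ℝ (a x) (F x)) 2 ∧ l2 (fun x => inner ℝ (a x) (F x)) ≤ C * l2 F := by
  have C0 : 0 ≤ C := (norm_nonneg _).trans (hC 0)
  have hb : ∀ x, ‖(inner ℝ (a x) (F x) : ℝ)‖ ≤ C * ‖F x‖ := fun x =>
    (norm_inner_le_norm _ _).trans (mul_le_mul_of_nonneg_right (hC x) (norm_nonneg _))
  exact ⟨hF.of_le_mul (ha.inner hF.1) (ae_of_all _ hb), l2_le_mul C0 hF (ae_of_all _ hb)⟩

theorem l2_smul_le {b : Plane → ℝ} {F : Plane → Plane} {C : ℝ} (C0 : 0 ≤ C)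
    (hb : AEStronglyMeasurable b volume) (hC : ∀ᵐ x, |b x| ≤ C) (hF : MemLp F 2) :
    MemLp (fun x => b x • F x) 2 ∧ l2 (fun x => b x • F x) ≤ C * l2 F := by
  have h : ∀ᵐ x, ‖b x • F x‖ ≤ C * ‖F x‖ := by
    filter_upwards [hC] with x hx
    rw [norm_smul]
    exact mul_le_mul_of_nonneg_right hx (norm_nonneg _)
  exact ⟨hF.of_le_mul (hb.smul hF.1) h, l2_le_mul C0 hF h⟩

theorem l2_smul_le' {b : Plane → ℝ} {F : Plane → Plane} {C : ℝ} (C0 : 0 ≤ C)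
    (hb : MemLp b 2) (hF : AEStronglyMeasurable F volume) (hC : ∀ x, ‖F x‖ ≤ C) :
    MemLp (fun x => b x • F x) 2 ∧ l2 (fun x => b x • F x) ≤ C * l2 b := by
  have h : ∀ x, ‖b x • F x‖ ≤ C * ‖b x‖ := fun x => by
    rw [norm_smul, mul_comm]
    exact mul_le_mul_of_nonneg_right (hC x) (norm_nonneg _)
  exact ⟨hb.of_le_mul (hb.1.smul hF) (ae_of_all _ h), l2_le_mul C0 hb (ae_of_all _ h)⟩

theorem norm_gradient_G_le (x : Plane) : ‖(∇ G) x‖ ≤ 1 := by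
  have e : (∇ G) x = (-(G x / 2)) • x := by
    ext i; rw [gradient_apply, pd_G, PiLp.smul_apply, smul_eq_mul]; ring
  rw [e, norm_smul, norm_neg, Real.norm_of_nonneg (by have := G_pos x; positivity)]
  calc G x / 2 * ‖x‖ ≤ 1 / (1 + ‖x‖ ^ 2 / 4) / 2 * ‖x‖ := by
        gcongr; exact G_le x
    _ ≤ 1 := by
        rw [div_div, one_div, inv_mul_le_iff₀ (by positivity)]
        nlinarith [sq_nonneg (‖x‖ / 2 - 1)]

/-- Every term is a bounded velocity times a square integrable velocity gradient, and at least one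
of the two comes from the perturbation. In the quadratic term `nX w ≤ 1` keeps the bound linear in
`nX D`. -/
theorem exists_convRem_bound (α : ℝ) : ∃ C ≥ 0, ∀ {w : Plane → ℝ} {D : Plane → Plane}
    {B : Fin 2 → Plane → Plane}, InV w D → nX w ≤ 1 → (∀ i, MemLp (B i) 2) →
    (∀ i, l2 (B i) ≤ 4 * curlConst * nX w) →
    MemLp (convRem α w B) 2 ∧ l2 (convRem α w B) ≤ C * nX D := by
  have κ0 := curlConst_nonneg
  have c0 := bsConst_pos
  set Γ : Fin 2 → ℝ := fun i => l2 (∇ fun x => vG x i)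
  have Γ0 : ∀ i, 0 ≤ Γ i := fun i => l2_nonneg _
  set C : Fin 2 → ℝ := fun i => |α| * (4 * curlConst) + bsConst * (4 * curlConst) +
    |α| * (bsConst * Γ i)
  have C0 : ∀ i, 0 ≤ C i := fun i => by have := Γ0 i; positivity
  refine ⟨C 0 + C 1, add_nonneg (C0 0) (C0 1), fun {w D B} h hw hB hBl => ?_⟩
  have D0 := nX_nonneg D
  have hv : ∀ x, ‖velocity α w x‖ ≤ |α| + bsConst * nX D := fun x => by
    refine (norm_add_le _ _).trans (add_le_add ?_ (h.norm_bs_le x))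
    rw [norm_smul]
    exact mul_le_of_le_one_right (norm_nonneg _) (norm_vG_le x)
  have mv : Continuous (velocity α w) := (continuous_vG.const_smul α).add h.continuous_bs
  have key : ∀ i, MemLp (fun x => convRem α w B x i) 2 ∧
      l2 (fun x => convRem α w B x i) ≤ C i * nX D := fun i => by
    obtain ⟨m1, b1⟩ := memLp_inner_bdd mv.aestronglyMeasurable hv (hB i)
    obtain ⟨m2, b2⟩ := memLp_inner_bdd h.continuous_bs.aestronglyMeasurable h.norm_bs_le
      (memLp_gradient_vG i)
    have m2' := m2.const_mul α
    refine ⟨m1.add m2', (l2_add_le m1 m2').trans ?_⟩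
    rw [l2_const_mul]
    have hw0 := nX_nonneg w
    have e1 : (|α| + bsConst * nX D) * l2 (B i) ≤
        |α| * (4 * curlConst * nX D) + bsConst * nX D * (4 * curlConst * 1) := by
      rw [add_mul]
      refine add_le_add (mul_le_mul_of_nonneg_left ((hBl i).trans ?_) (abs_nonneg _))
        (mul_le_mul_of_nonneg_left ((hBl i).trans ?_) (by positivity))
      · exact mul_le_mul_of_nonneg_left h.nX_le (by positivity)
      · exact mul_le_mul_of_nonneg_left hw (by positivity)
    have e2 := mul_le_mul_of_nonneg_left b2 (abs_nonneg α)
    calc _ ≤ |α| * (4 * curlConst * nX D) + bsConst * nX D * (4 * curlConst * 1) +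
          |α| * (bsConst * nX D * Γ i) := add_le_add (b1.trans e1) e2
      _ = C i * nX D := by simp only [C]; ring
  have hm : MemLp (convRem α w B) 2 := memLp_piLp_iff.2 fun i => (key i).1
  exact ⟨hm, (l2_vec_le hm).trans (by rw [add_mul]; exact add_le_add (key 0).2 (key 1).2)⟩

/-- The pressure gradient is, up to the explicit contribution of the Oseen vortex, controlled by
the perturbation. -/
theorem exists_pressure_bound (α : ℝ) : ∃ C ≥ 0, ∀ {w b : Plane → ℝ} {D P : Plane → Plane},
    InV w D → nX w ≤ 1 → MemLpw 2 b → (∀ᵐ x, |b x| ≤ 1 / 2) →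
    IsPressureGradient b (velocity α w) P →
    MemLp (fun x => P x + α ^ 2 • convG x) 2 ∧
      l2 (fun x => P x + α ^ 2 • convG x) ≤ C * (nX D + nX b) := by
  obtain ⟨C₁, hC₁, H⟩ := exists_convRem_bound α
  have κ0 := curlConst_nonneg
  set K := 2 * (α ^ 2 + |α| + curlConst + C₁) with hK
  refine ⟨K, by positivity, fun {w b D P} h hw hb hb' hP => ?_⟩
  have bm := hb.memLp.1
  choose B B1 B2 B3 using h.exists_bs_grad
  obtain ⟨mR, bR⟩ := H h hw B2 B3
  have mP' : MemLp (fun x => P x + α ^ 2 • convG x) 2 := hP.memLp.add (memLp_convG.const_smul (α ^ 2))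
  refine ⟨mP', ?_⟩
  set P' : Plane → Plane := fun x => P x + α ^ 2 • convG x with hP'
  obtain ⟨m1, b1⟩ := l2_smul_le (by norm_num : (0 : ℝ) ≤ 1 / 2) bm hb' mP'
  obtain ⟨m2, b2⟩ := l2_smul_le' (sq_nonneg α) hb.memLp (F := fun x => α ^ 2 • convG x)
    (continuous_convG.const_smul (α ^ 2)).aestronglyMeasurable (fun x => by
      rw [norm_smul, Real.norm_of_nonneg (sq_nonneg α)]
      exact mul_le_of_le_one_right (sq_nonneg α) (norm_convG_le x))
  have mG : MemLp (fun x => b x • (α • (∇ G) x)) 2 ∧ l2 (fun x => b x • (α • (∇ G) x)) ≤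
      |α| * l2 b := l2_smul_le' (abs_nonneg α) hb.memLp
    ((continuous_gradient contDiff_G).const_smul α).aestronglyMeasurable (fun x => by
      rw [norm_smul]
      exact mul_le_of_le_one_right (norm_nonneg _) (norm_gradient_G_le x))
  have mD : MemLp (fun x => curlConst • D x) 2 := h.memD.memLp.const_smul curlConst
  have lD : l2 (fun x => curlConst • D x) ≤ curlConst * l2 D :=
    l2_le_mul κ0 h.memD.memLp (ae_of_all _ fun x => by
      rw [norm_smul, Real.norm_of_nonneg κ0])
  obtain ⟨mbD, lbD⟩ := l2_smul_le (by norm_num : (0 : ℝ) ≤ 1 / 2) bm hb' mD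
  obtain ⟨m3, -⟩ := l2_smul_le (by norm_num : (0 : ℝ) ≤ 1 / 2) bm hb' (h.memLp_lapVel α)
  have b3 : l2 (fun x => b x • lapVel α D x) ≤ |α| * l2 b + 1 / 2 * (curlConst * l2 D) := by
    have e : l2 (fun x => b x • lapVel α D x) ≤
        1 * l2 (fun x => b x • (α • (∇ G) x) + b x • (curlConst • D x)) :=
      l2_le_mul zero_le_one (mG.1.add mbD) (ae_of_all _ fun x => by
        rw [one_mul, ← smul_add, norm_smul, norm_smul, lapVel, norm_perp])
    rw [one_mul] at e
    exact e.trans ((l2_add_le mG.1 mbD).trans (add_le_add mG.2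
      (lbD.trans (mul_le_mul_of_nonneg_left lD (by norm_num)))))
  -- With `P = P' - α² convG` and `Δv` discarded as divergence free, the pressure equation reads
  -- `div P' = div F`. The term `b P'` inside `F` has norm at most half that of `P'` and is
  -- absorbed, hence the factor `2` in `K`.
  set F : Plane → Plane := fun x => (b x • lapVel α D x - convRem α w B x) +
    (b x • (α ^ 2 • convG x) - b x • P' x) with hF
  have mF1 : MemLp (fun x => b x • lapVel α D x - convRem α w B x) 2 := m3.sub mR
  have mF2 : MemLp (fun x => b x • (α ^ 2 • convG x) - b x • P' x) 2 := m2.sub m1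
  have mF : MemLp F 2 := mF1.add mF2
  have main : l2 P' ≤ l2 F := by
    refine l2_le_of_curl_free mP' mF (fun φ hφ => ?_) fun φ hφ => ?_
    · have c1 := hP.curl_free hφ
      have c2 := integral_inner_perp_gradient memLp_convG hφ
      rw [convG_curl hφ, neg_zero] at c2
      simp_rw [hP', inner_add_left, inner_smul_left]
      rw [integral_add (integrable_inner hP.memLp (memLp_perp hφ.memLp_gradient))
        ((integrable_inner memLp_convG (memLp_perp hφ.memLp_gradient)).const_mul _), c1,
        integral_const_mul, c2]
      simp
    · obtain ⟨Dv, Lv, h1, h2, h3⟩ := hP.equation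
      have hL := h.weakLaplacian_unique h2
      have hD := fun i => (h1 i).unique (isWeakGradient_velocity (α := α) (B1 i))
      have eq := h3 φ hφ
      have g := hφ.memLp_gradient
      have e1 : ∫ x, inner ℝ ((1 + b x) • Lv x - convective (velocity α w) Dv x) ((∇ φ) x) =
          ∫ x, inner ℝ ((1 + b x) • lapVel α D x - (convRem α w B x + α ^ 2 • convG x))
            ((∇ φ) x) := by
        refine integral_congr_ae ?_
        filter_upwards [hL, hD 0, hD 1] with x a0 a1 a2
        rw [← convective_velocity, a0]
        congr 2
        ext i
        simp only [convective]
        fin_cases i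
        · simp only [Fin.zero_eta, a1]
        · simp only [Fin.mk_one, a2]
      rw [e1] at eq
      have mb : MemLp (fun x => (1 + b x) • P x) 2 := by
        have := hP.memLp.add (l2_smul_le (by norm_num : (0 : ℝ) ≤ 1 / 2) bm hb' hP.memLp).1
        refine this.congr_norm ((aestronglyMeasurable_const.add bm).smul hP.memLp.1)
          (ae_of_all _ fun x => ?_)
        simp only [Pi.add_apply, add_smul, one_smul]
      have mr : MemLp (fun x => (1 + b x) • lapVel α D x -
          (convRem α w B x + α ^ 2 • convG x)) 2 := by
        have := ((h.memLp_lapVel α).add m3).sub (mR.add (memLp_convG.const_smul (α ^ 2)))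
        refine this.congr_norm (((aestronglyMeasurable_const.add bm).smul
          (h.memLp_lapVel α).1).sub (mR.add (memLp_convG.const_smul (α ^ 2))).1)
          (ae_of_all _ fun x => ?_)
        simp only [Pi.add_apply, Pi.sub_apply, Pi.smul_apply, add_smul, one_smul]
      have z : (∫ x, inner ℝ (P' x) ((∇ φ) x)) - (∫ x, inner ℝ (F x) ((∇ φ) x)) -
          ∫ x, inner ℝ (lapVel α D x) ((∇ φ) x) = 0 := by
        rw [← integral_sub (integrable_inner mP' g) (integrable_inner mF g),
          ← integral_sub (by exact (integrable_inner mP' g).sub (integrable_inner mF g))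
            (integrable_inner (h.memLp_lapVel α) g)]
        rw [← sub_eq_zero, ← integral_sub (integrable_inner mb g) (integrable_inner mr g)] at eq
        rw [← eq]
        congr 1; ext x
        rw [← inner_sub_left, ← inner_sub_left, ← inner_sub_left]
        congr 1
        simp only [hF, hP']
        module
      rw [h.lapVel_div_free α hφ] at z
      linarith
  have f1 := l2_sub_le m3 mR
  have f2 := l2_sub_le m2 m1
  have f3 := l2_add_le mF1 mF2
  have lb := l2_le_nX hb
  have lD' := l2_le_nX h.memD
  have n1 : α ^ 2 * l2 b ≤ α ^ 2 * nX b := mul_le_mul_of_nonneg_left lb (sq_nonneg _)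
  have n2 : |α| * l2 b ≤ |α| * nX b := mul_le_mul_of_nonneg_left lb (abs_nonneg _)
  have n3 : curlConst * l2 D ≤ curlConst * nX D := mul_le_mul_of_nonneg_left lD' κ0
  have b0 := nX_nonneg b
  have D0 := nX_nonneg D
  have : l2 P' ≤ 2 * (|α| * nX b + 1 / 2 * (curlConst * nX D) + C₁ * nX D + α ^ 2 * nX b) := by
    linarith
  refine this.trans ?_
  rw [hK]
  have p1 : 0 ≤ α ^ 2 * nX D := by positivity
  have p2 : 0 ≤ |α| * nX D := by positivity
  have p3 : 0 ≤ curlConst * nX D := by positivity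
  have p4 : 0 ≤ C₁ * nX b := by positivity
  have p5 : 0 ≤ curlConst * nX b := by positivity
  nlinarith

/-! ### Estimates at a fixed time -/

/-- The Gaussian norm of a polynomially growing function. -/
def tn (φ : Plane → ℝ) : ℝ := l2 fun x => gh x * φ x

theorem tn_nonneg (φ : Plane → ℝ) : 0 ≤ tn φ := l2_nonneg _

/-- The integral of the integrable function `f` is `v`. -/
def HasInt (f : Plane → ℝ) (v : ℝ) : Prop := Integrable f ∧ ∫ x, f x = v

theorem HasInt.add {f g : Plane → ℝ} {u v : ℝ} (hf : HasInt f u) (hg : HasInt g v) :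
    HasInt (fun x => f x + g x) (u + v) :=
  ⟨hf.1.add hg.1, by rw [integral_add hf.1 hg.1, hf.2, hg.2]⟩

theorem HasInt.sub {f g : Plane → ℝ} {u v : ℝ} (hf : HasInt f u) (hg : HasInt g v) :
    HasInt (fun x => f x - g x) (u - v) :=
  ⟨hf.1.sub hg.1, by rw [integral_sub hf.1 hg.1, hf.2, hg.2]⟩

theorem HasInt.const_mul {f : Plane → ℝ} {u : ℝ} (hf : HasInt f u) (c : ℝ) :
    HasInt (fun x => c * f x) (c * u) :=
  ⟨hf.1.const_mul c, by rw [integral_const_mul, hf.2]⟩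

theorem HasInt.congr {f g : Plane → ℝ} {u : ℝ} (hf : HasInt f u) (h : ∀ x, f x = g x) :
    HasInt g u := by rwa [← show f = g from funext h]

theorem _root_.MeasureTheory.Integrable.hasInt {f : Plane → ℝ} (hf : Integrable f) :
    HasInt f (∫ x, f x) :=
  ⟨hf, rfl⟩

theorem abs_integral_bdd_le {a f φ : Plane → ℝ} {C : ℝ} (C0 : 0 ≤ C)
    (ha : AEStronglyMeasurable a volume) (hC : ∀ᵐ x, |a x| ≤ C) (hf : MemLpw 2 f)
    (hφ : MemLp (fun x => gh x * φ x) 2) :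
    Integrable (fun x => a x * (f x * φ x)) ∧ |∫ x, a x * (f x * φ x)| ≤ C * (nX f * tn φ) := by
  rw [memLpw_iff] at hf
  have e : ∀ x, f x * φ x = wt f x * (gh x * φ x) := fun x => by
    rw [wt, smul_eq_mul]; have := gh_ne_zero x; field_simp
  simp_rw [e]
  have i1 := integrable_mul_of_memLp hf hφ
  refine ⟨i1.bdd_mul (c := C) ha hC, ?_⟩
  calc |∫ x, a x * (wt f x * (gh x * φ x))| ≤ ∫ x, C * |wt f x * (gh x * φ x)| := by
        refine abs_integral_le_integral_abs.trans (integral_mono_of_nonneg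
          (ae_of_all _ fun _ => abs_nonneg _) (i1.abs.const_mul _) ?_)
        filter_upwards [hC] with x hx
        rw [abs_mul]
        exact mul_le_mul_of_nonneg_right hx (abs_nonneg _)
    _ ≤ _ := by
        rw [integral_const_mul]
        exact mul_le_mul_of_nonneg_left (integral_abs_mul_le hf hφ) C0

theorem abs_integral_mul_le_tn {f φ : Plane → ℝ} (hf : MemLpw 2 f)
    (hφ : MemLp (fun x => gh x * φ x) 2) :
    Integrable (fun x => f x * φ x) ∧ |∫ x, f x * φ x| ≤ nX f * tn φ := by
  have := abs_integral_bdd_le (a := fun _ => 1) zero_le_one aestronglyMeasurable_const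
    (ae_of_all _ fun _ => by simp) hf hφ
  simpa using this

/-- The bounds available on the solution at a given time. -/
structure Slice (α β : ℝ) (b w : Plane → ℝ) (D P : Plane → Plane) : Prop where
  inV : InV w D
  le_one : nX w ≤ 1
  b_mem : MemLpw 2 b
  b_one : nX b ≤ 1
  b_le : ∀ᵐ x, |wt b x| ≤ β
  half : β ≤ 1 / 2
  pressure : IsPressureGradient b (velocity α w) P

theorem Slice.nonneg {α β : ℝ} {b w : Plane → ℝ} {D P : Plane → Plane}
    (h : Slice α β b w D P) : 0 ≤ β := by
  obtain ⟨x, hx⟩ := h.b_le.exists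
  exact (abs_nonneg _).trans hx

theorem Slice.abs_b_le {α β : ℝ} {b w : Plane → ℝ} {D P : Plane → Plane}
    (h : Slice α β b w D P) : ∀ᵐ x, |b x| ≤ β := by
  filter_upwards [h.b_le] with x hx
  rw [← gh_smul_wt b x, smul_eq_mul, abs_mul, abs_of_pos (gh_pos x)]
  exact (mul_le_of_le_one_left (abs_nonneg _) (gh_le_one x)).trans hx

/-- The contributions of the vortex, `α ∇G` and `α² convG`, are bounded and are paired with `b` in
`L²_w`; those of the perturbation, `D` and `P'`, are paired with the sup bound `β`. Since `P'` lies
in `L²` without weight, `b P'` is written as `(G^{-1/2} b) (G^{1/2} P')`, so that `b` lends its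
weight. The sign `s` and the indices `i`, `j` cover both components of `perp P`. -/
theorem exists_flux_bound (α : ℝ) : ∃ C ≥ 0, ∀ {β : ℝ} {b w : Plane → ℝ} {D P : Plane → Plane},
    Slice α β b w D P → ∀ (i j : Fin 2) (s : ℝ), |s| = 1 → ∀ φ : Plane → ℝ,
    MemLp (fun x => gh x * φ x) 2 →
    Integrable (fun x => b x * ((α * pd i G x + D x i + s * P x j) * φ x)) ∧
    |∫ x, b x * ((α * pd i G x + D x i + s * P x j) * φ x)|
      ≤ C * (nX b + β * nX D) * tn φ := by
  obtain ⟨C₁, hC₁, H⟩ := exists_pressure_bound α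
  refine ⟨|α| + C₁ + α ^ 2 + 1, by positivity, fun {β b w D P} h i j s hs φ hφ => ?_⟩
  have β0 := h.nonneg
  have hDi := memLpw_vec_iff.1 h.inV.memD i
  obtain ⟨mP, bP⟩ := H h.inV h.le_one h.b_mem
    (h.abs_b_le.mono fun x hx => hx.trans h.half) h.pressure
  set P' : Plane → Plane := fun x => P x + α ^ 2 • convG x
  have mPj := memLp_piLp_iff.1 mP j
  have lPj : l2 (fun x => P' x j) ≤ l2 P' := by
    have := l2_le_mul zero_le_one mP (f := fun x => P' x j)
      (ae_of_all _ fun x => by rw [one_mul]; exact abs_apply_le_norm _ j)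
    rwa [one_mul] at this
  have hw : wt (fun x => gh x * P' x j) = fun x => P' x j := by
    ext x; rw [wt, smul_eq_mul]; have := gh_ne_zero x; field_simp
  have mg : MemLpw 2 fun x => gh x * P' x j := by rw [memLpw_iff, hw]; exact mPj
  have ng : nX (fun x => gh x * P' x j) ≤ l2 P' := by rw [nX, hw]; exact lPj
  have bwt := ((memLpw_iff 2 b).1 h.b_mem).1
  obtain ⟨i1, b1⟩ := abs_integral_bdd_le (abs_nonneg α) (a := fun x => α * pd i G x)
    (continuous_const.mul (contDiff_pd contDiff_G i).continuous).aestronglyMeasurable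
    (ae_of_all _ fun x => by
      rw [abs_mul, ← gradient_apply]
      exact mul_le_of_le_one_right (abs_nonneg _)
        ((abs_apply_le_norm _ i).trans (norm_gradient_G_le x))) h.b_mem hφ
  obtain ⟨i2, b2⟩ := abs_integral_bdd_le β0 h.b_mem.memLp.1 h.abs_b_le hDi hφ
  obtain ⟨i3, b3⟩ := abs_integral_bdd_le β0 bwt h.b_le mg hφ
  obtain ⟨i4, b4⟩ := abs_integral_bdd_le (sq_nonneg α) (a := fun x => α ^ 2 * convG x j)
    (continuous_const.mul ((continuous_coord j).comp continuous_convG)).aestronglyMeasurable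
    (ae_of_all _ fun x => by
      rw [abs_mul, abs_of_nonneg (sq_nonneg α)]
      exact mul_le_of_le_one_right (sq_nonneg _)
        ((abs_apply_le_norm _ j).trans (norm_convG_le x))) h.b_mem hφ
  obtain ⟨k1, k2⟩ := ((i1.hasInt.add i2.hasInt).add ((i3.hasInt.sub i4.hasInt).const_mul s)).congr
    (g := fun x => b x * ((α * pd i G x + D x i + s * P x j) * φ x)) fun x => by
      have := gh_smul_wt b x
      rw [smul_eq_mul] at this
      simp only [P', PiLp.add_apply, PiLp.smul_apply, smul_eq_mul]
      linear_combination (s * P x j * φ x + s * φ x * α ^ 2 * convG x j) * this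
  refine ⟨k1, ?_⟩
  rw [k2]
  have t0 := tn_nonneg φ
  have nb := nX_nonneg b
  have nD := nX_nonneg D
  have e2 : β * (nX (fun x => D x i) * tn φ) ≤ β * (nX D * tn φ) :=
    mul_le_mul_of_nonneg_left (mul_le_mul_of_nonneg_right (nX_comp_le h.inV.memD i) t0) β0
  have e3 : β * (nX (fun x => gh x * P' x j) * tn φ) ≤ β * ((C₁ * (nX D + nX b)) * tn φ) :=
    mul_le_mul_of_nonneg_left (mul_le_mul_of_nonneg_right (ng.trans bP) t0) β0
  have e4 : β * ((C₁ * (nX D + nX b)) * tn φ) ≤ C₁ * (β * nX D + nX b) * tn φ := by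
    have : β * (C₁ * nX b * tn φ) ≤ 1 * (C₁ * nX b * tn φ) :=
      mul_le_mul_of_nonneg_right (by linarith [h.half]) (by positivity)
    nlinarith
  have tri : ∀ p q r t : ℝ, |p + q + s * (r - t)| ≤ |p| + |q| + (|r| + |t|) := fun p q r t => by
    refine (abs_add_le _ _).trans (add_le_add (abs_add_le _ _) ?_)
    rw [abs_mul, hs, one_mul]
    exact abs_sub r t
  refine (tri _ _ _ _).trans ?_
  have f1 : 0 ≤ |α| * (β * nX D) * tn φ := by positivity
  have f2 : 0 ≤ α ^ 2 * (β * nX D) * tn φ := by positivity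
  have f3 : 0 ≤ nX b * tn φ := by positivity
  calc _ ≤ |α| * (nX b * tn φ) + β * (nX D * tn φ) +
        (C₁ * (β * nX D + nX b) * tn φ + α ^ 2 * (nX b * tn φ)) :=
        add_le_add (add_le_add b1 (b2.trans e2)) (add_le_add (b3.trans (e3.trans e4)) b4)
    _ ≤ _ := by linarith

/-- The raising operator in the `i`-th variable. -/
def rs (i : Fin 2) (φ : Plane → ℝ) (x : Plane) : ℝ := x i / 2 * φ x - pd i φ x

theorem hasTemperateGrowth_rs {φ : Plane → ℝ} (hφ : φ.HasTemperateGrowth) (i : Fin 2) :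
    (rs i φ).HasTemperateGrowth := by
  have : rs i φ = fun x => -(pd i φ x - x i / 2 * φ x) := by ext x; rw [rs]; ring
  rw [this]
  exact (hasTemperateGrowth_pd_sub hφ i).fun_neg

theorem hasTemperateGrowth_coord_mul {φ : Plane → ℝ} (hφ : φ.HasTemperateGrowth) (i : Fin 2) :
    (fun x : Plane => x i * φ x).HasTemperateGrowth := (hasTemperateGrowth_coord i).fun_mul hφ

theorem nX_G : nX G = 1 := by
  have : wt G = gh := by
    ext x; rw [wt, smul_eq_mul, G_eq]; have := gh_ne_zero x; field_simp
  rw [nX, this, l2_gh]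

theorem memLpw_G : MemLpw 2 G := by
  simpa using memLpw_G_mul (Q := fun _ => 1) (by simp)

section Split

variable {α β : ℝ} {b w : Plane → ℝ} {D P : Plane → Plane} {φ : Plane → ℝ}

/-- The linear part `∫ 𝓛 w φ`. -/
def linTerm (w : Plane → ℝ) (D : Plane → Plane) (φ : Plane → ℝ) : ℝ :=
  (∫ x, w x * φ x) + ((∫ x, D x 0 * rs 0 φ x) + ∫ x, D x 1 * rs 1 φ x)

/-- The part `∫ Λ w φ`. -/
def vortexTerm (w : Plane → ℝ) (D : Plane → Plane) (φ : Plane → ℝ) : ℝ :=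
  ((∫ x, vG x 0 * (D x 0 * φ x)) + ∫ x, vG x 1 * (D x 1 * φ x)) -
    1 / 2 * ((∫ x, biotSavart w x 0 * (G x * (x 0 * φ x))) +
      ∫ x, biotSavart w x 1 * (G x * (x 1 * φ x)))

/-- The transport term. -/
def transTerm (w : Plane → ℝ) (D : Plane → Plane) (φ : Plane → ℝ) : ℝ :=
  (∫ x, biotSavart w x 0 * (D x 0 * φ x)) + ∫ x, biotSavart w x 1 * (D x 1 * φ x)

/-- The term coming from the density. -/
def fluxTerm (α : ℝ) (b : Plane → ℝ) (D P : Plane → Plane) (φ : Plane → ℝ) : ℝ :=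
  (∫ x, b x * ((α * pd 0 G x + D x 0 + (-1) * P x 1) * pd 0 φ x)) +
    ∫ x, b x * ((α * pd 1 G x + D x 1 + 1 * P x 0) * pd 1 φ x)

theorem Slice.trans_bound (h : Slice α β b w D P) (hφ : MemLp (fun x => gh x * φ x) 2)
    (i : Fin 2) : Integrable (fun x => biotSavart w x i * (D x i * φ x)) ∧
      |∫ x, biotSavart w x i * (D x i * φ x)| ≤ bsConst * nX D * (nX D * tn φ) := by
  have c0 := bsConst_pos
  have n0 := nX_nonneg D
  obtain ⟨i1, b1⟩ := abs_integral_bdd_le (mul_nonneg c0.le n0)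
    (h.inV.continuous_bs_apply i).aestronglyMeasurable (ae_of_all _ (h.inV.bs_apply_le i))
    (memLpw_vec_iff.1 h.inV.memD i) hφ
  exact ⟨i1, b1.trans (mul_le_mul_of_nonneg_left (mul_le_mul_of_nonneg_right
    (nX_comp_le h.inV.memD i) (tn_nonneg _)) (mul_nonneg c0.le n0))⟩

theorem Slice.vG_bound (h : Slice α β b w D P) (hφ : MemLp (fun x => gh x * φ x) 2)
    (i : Fin 2) : Integrable (fun x => vG x i * (D x i * φ x)) ∧
      |∫ x, vG x i * (D x i * φ x)| ≤ nX D * tn φ := by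
  obtain ⟨i1, b1⟩ := abs_integral_bdd_le zero_le_one
    (contDiff_vG i).continuous.aestronglyMeasurable (ae_of_all _ fun x => abs_vG_apply_le x i)
    (memLpw_vec_iff.1 h.inV.memD i) hφ
  rw [one_mul] at b1
  exact ⟨i1, b1.trans (mul_le_mul_of_nonneg_right
    (nX_comp_le h.inV.memD i) (tn_nonneg _))⟩

theorem Slice.bsG_bound (h : Slice α β b w D P) {f : Plane → ℝ} (hf : MemLpw 2 f)
    (hφ : MemLp (fun x => gh x * φ x) 2)
    (i : Fin 2) : Integrable (fun x => biotSavart w x i * (f x * φ x)) ∧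
      |∫ x, biotSavart w x i * (f x * φ x)| ≤ bsConst * nX D * (nX f * tn φ) :=
  abs_integral_bdd_le (mul_nonneg bsConst_pos.le (nX_nonneg D))
    (h.inV.continuous_bs_apply i).aestronglyMeasurable (ae_of_all _ (h.inV.bs_apply_le i)) hf hφ

/-- A pointwise regrouping, with no integration by parts: `-∇w · ∇φ + (1/2) (ξ · ∇w) φ` is the sum
of `D i * rs i φ`, and `∇G = -(ξ/2) G`. The content is the integrability of each piece against a
tempered `φ`. -/
theorem Slice.pairing (h : Slice α β b w D P) (hφ : φ.HasTemperateGrowth) :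
    HasInt (vorticityPairing α b w D P φ) (linTerm w D φ - α * vortexTerm w D φ -
      transTerm w D φ - fluxTerm α b D P φ) := by
  obtain ⟨C, -, H⟩ := exists_flux_bound α
  have hD := memLpw_vec_iff.1 h.inV.memD
  have m := memLp_gh_mul hφ
  have m1 := fun i => memLp_gh_mul (hasTemperateGrowth_pd hφ i)
  have m2 := fun i => memLp_gh_mul (hasTemperateGrowth_coord_mul hφ i)
  have A1 := (h.inV.mem.integrable_mul hφ).hasInt
  have A2 := fun i => ((hD i).integrable_mul (hasTemperateGrowth_rs hφ i)).hasInt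
  have A3 := fun i => (h.vG_bound m i).1.hasInt
  have A4 := fun i => (h.bsG_bound memLpw_G (m2 i) i).1.hasInt
  have A5 := fun i => (h.trans_bound m i).1.hasInt
  have A6 := (H h 0 1 (-1) (by simp) _ (m1 0)).1.hasInt
  have A7 := (H h 1 0 1 (by simp) _ (m1 1)).1.hasInt
  refine ((((A1.add ((A2 0).add (A2 1))).sub ((((A3 0).add (A3 1)).sub
    (((A4 0).add (A4 1)).const_mul (1 / 2))).const_mul α)).sub ((A5 0).add (A5 1))).sub
    (A6.add A7)).congr fun x => ?_
  simp only [vorticityPairing, LPairing, Lambda, inner_plane, gradient_apply, rs, pd_G,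
    PiLp.add_apply, PiLp.smul_apply, smul_eq_mul, perp_zero, perp_one]
  ring

end Split

/-! ### The energy identity at a fixed time -/

theorem tn_sum_sq (S : Finset (Fin 2 → ℕ)) (c : (Fin 2 → ℕ) → ℝ)
    {σ : (Fin 2 → ℕ) → (Fin 2 → ℕ)} (hσ : Function.Injective σ) :
    tn (fun x => ∑ n ∈ S, c n * hermite (σ n) x) ^ 2 = ∑ n ∈ S, c n ^ 2 := by
  have hm := memLp_gh_mul (hasTemperateGrowth_sum S c σ)
  have e := sum_hermiteLp S c σ hm
  have h1 : tn (fun x => ∑ n ∈ S, c n * hermite (σ n) x) = ‖∑ n ∈ S, c n • hermiteLp (σ n)‖ := by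
    rw [e, Lp.norm_toLp]; rfl
  rw [h1, ← real_inner_self_eq_norm_sq]
  have := (orthonormal_hermiteLp.comp σ hσ).inner_sum c c S
  simp only [Function.comp] at this
  rw [this]
  exact Finset.sum_congr rfl fun n _ => by simp [sq]

theorem tn_partialSum_sq (w : Plane → ℝ) (S : Finset (Fin 2 → ℕ)) :
    tn (partialSum w S) ^ 2 = ∑ n ∈ S, coef w n ^ 2 :=
  tn_sum_sq S (coef w) Function.injective_id

theorem tn_partialSum_le {w : Plane → ℝ} (hw : MemLpw 2 w) (S : Finset (Fin 2 → ℕ)) :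
    tn (partialSum w S) ≤ nX w := by
  refine le_of_sq_le_sq ?_ (nX_nonneg w)
  rw [tn_partialSum_sq]
  exact sum_le_hasSum S (fun n _ => sq_nonneg _) (hasSum_coef_sq hw)

theorem rs_partialSum (w : Plane → ℝ) (S : Finset (Fin 2 → ℕ)) (i : Fin 2) :
    rs i (partialSum w S) =
      fun x => ∑ n ∈ S, ladder (n i + 1) * coef w n * hermite (raise i n) x := by
  ext x
  have h1 := pd_G_mul (differentiable_of_smooth (hasTemperateGrowth_partialSum w S).1) i x
  rw [pd_G_partialSum] at h1
  have h2 := mul_left_cancel₀ (G_pos x).ne' h1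
  rw [rs, ← neg_sub, ← h2, ← Finset.sum_neg_distrib]
  exact Finset.sum_congr rfl fun n _ => by ring

/-- The partial sums of the coercive part of the energy. -/
def modeEnergy (w : Plane → ℝ) (S : Finset (Fin 2 → ℕ)) : ℝ :=
  ∑ n ∈ S, ((n 0 : ℝ) + n 1) / 2 * coef w n ^ 2

theorem modeEnergy_nonneg (w : Plane → ℝ) (S : Finset (Fin 2 → ℕ)) : 0 ≤ modeEnergy w S :=
  Finset.sum_nonneg fun n _ => by positivity

theorem InV.hasSum_modeEnergy {w : Plane → ℝ} {D : Plane → Plane} (h : InV w D) :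
    HasSum (fun n => ((n 0 : ℝ) + n 1) / 2 * coef w n ^ 2) (nX D ^ 2 - nX w ^ 2) := by
  refine (h.hasSum_grad_sq.sub (hasSum_coef_sq h.mem)).congr_fun fun n => ?_
  ring

theorem InV.modeEnergy_le {w : Plane → ℝ} {D : Plane → Plane} (h : InV w D)
    (S : Finset (Fin 2 → ℕ)) : modeEnergy w S ≤ nX D ^ 2 := by
  have := sum_le_hasSum S (fun n _ => by positivity) h.hasSum_modeEnergy
  exact this.trans (by linarith [sq_nonneg (nX w)])

theorem InV.tendsto_modeEnergy {w : Plane → ℝ} {D : Plane → Plane} (h : InV w D) :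
    Tendsto (modeEnergy w) atTop (𝓝 (nX D ^ 2 - nX w ^ 2)) := by
  have := h.hasSum_modeEnergy
  unfold HasSum at this
  simp only [SummationFilter.unconditional_filter] at this
  exact this

theorem integral_mul_finset_sum {f : Plane → ℝ} (hf : MemLpw 2 f) (S : Finset (Fin 2 → ℕ))
    (c : (Fin 2 → ℕ) → ℝ) (σ : (Fin 2 → ℕ) → (Fin 2 → ℕ)) :
    ∫ x, f x * ∑ n ∈ S, c n * hermite (σ n) x = ∑ n ∈ S, c n * coef f (σ n) := by
  simp_rw [Finset.mul_sum, mul_left_comm (f _)]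
  rw [integral_finsetSum S fun n _ =>
    (hf.integrable_mul (hasTemperateGrowth_hermite (σ n))).const_mul (c n)]
  exact Finset.sum_congr rfl fun n _ => by rw [integral_const_mul, coef]

/-- On the mode `n` the two gradient components contribute `-(nᵢ + 1)/2` each and the zeroth order
term `+1`, which leaves the eigenvalue `-(n₀ + n₁)/2`. -/
theorem InV.linTerm_partialSum {w : Plane → ℝ} {D : Plane → Plane} (h : InV w D)
    (S : Finset (Fin 2 → ℕ)) : linTerm w D (partialSum w S) = - modeEnergy w S := by
  have hD := memLpw_vec_iff.1 h.memD
  have e1 : ∀ i, ∫ x, D x i * rs i (partialSum w S) x =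
      ∑ n ∈ S, -(((n i : ℝ) + 1) / 2 * coef w n ^ 2) := fun i => by
    rw [rs_partialSum, integral_mul_finset_sum (hD i)]
    refine Finset.sum_congr rfl fun n _ => ?_
    rw [h.coef_grad_raise]
    have := ladder_sq (n i + 1)
    push_cast at this
    linear_combination (- coef w n ^ 2) * this
  have e2 : ∫ x, w x * partialSum w S x = ∑ n ∈ S, coef w n ^ 2 := by
    have := integral_mul_finset_sum h.mem S (coef w) id
    simp only [id] at this
    unfold partialSum
    rw [this]
    exact Finset.sum_congr rfl fun n _ => (sq _).symm
  rw [linTerm, e1, e1, e2, modeEnergy, ← Finset.sum_add_distrib, ← Finset.sum_add_distrib,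
    ← Finset.sum_neg_distrib]
  exact Finset.sum_congr rfl fun n _ => by ring

theorem tn_sq {φ : Plane → ℝ} (hφ : φ.HasTemperateGrowth) :
    tn φ ^ 2 = ∫ x, G x * (φ x * φ x) := by
  rw [tn, l2_sq (memLp_gh_mul hφ)]
  congr 1; ext x
  rw [Real.norm_eq_abs, sq_abs, G_eq]; ring

/-- `rs i` is the adjoint of `∂ᵢ` in `L²(G dx)` and their commutator is `1/2`, whence `‖rs i φ‖² =
‖∂ᵢ φ‖² + ‖φ‖²/2`. -/
theorem tn_pd_le {φ : Plane → ℝ} (hφ : φ.HasTemperateGrowth) (i : Fin 2) :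
    tn (pd i φ) ≤ tn (rs i φ) := by
  have hp := hasTemperateGrowth_pd hφ i
  have hr := hasTemperateGrowth_rs hφ i
  have dφ := differentiable_of_smooth hφ.1
  refine le_of_sq_le_sq ?_ (tn_nonneg _)
  have h1 := integral_G_pd_mul hφ hp i
  have h2 := integral_G_pd_mul hr hφ i
  have e : ∀ x, pd i (rs i φ) x = φ x / 2 + (x i / 2 * pd i φ x - pd i (pd i φ) x) := fun x => by
    have dx : DifferentiableAt ℝ (fun y : Plane => 1 / 2 * y i) x :=
      ((differentiable_coord i) x).const_mul _
    have e0 : rs i φ = fun y => (1 / 2 * y i) * φ y - pd i φ y := by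
      ext y; rw [rs]; ring
    rw [e0, pd_sub (dx.fun_mul (dφ x)) ((differentiable_of_smooth hp.1) x), pd_mul dx (dφ x),
      pd_const_mul ((differentiable_coord i) x), pd_coord, if_pos rfl]
    ring
  have h3 : ∫ x, G x * (pd i (rs i φ) x * φ x) = 1 / 2 * (∫ x, G x * (φ x * φ x)) +
      ∫ x, G x * (φ x * (x i / 2 * pd i φ x - pd i (pd i φ) x)) := by
    have j : (fun x : Plane => x i / 2 * pd i φ x - pd i (pd i φ) x).HasTemperateGrowth :=
      hasTemperateGrowth_rs hp i
    rw [← integral_const_mul, ← integral_add ((integrable_G_mul (hφ.fun_mul hφ)).const_mul _)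
      (integrable_G_mul (hφ.fun_mul j))]
    congr 1; ext x; rw [e]; ring
  have h4 : ∫ x, G x * (rs i φ x * (x i / 2 * φ x - pd i φ x)) = tn (rs i φ) ^ 2 :=
    (tn_sq hr).symm
  rw [tn_sq hp, h1]
  have := tn_sq hφ
  have := sq_nonneg (tn φ)
  linarith

theorem InV.tn_rs_partialSum_le {w : Plane → ℝ} {D : Plane → Plane} (h : InV w D)
    (S : Finset (Fin 2 → ℕ)) (i : Fin 2) : tn (rs i (partialSum w S)) ≤ nX D := by
  refine le_trans (le_of_sq_le_sq ?_ (nX_nonneg _)) (nX_comp_le h.memD i)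
  rw [rs_partialSum, tn_sum_sq S _ (raise_injective i)]
  refine le_trans (le_of_eq ?_)
    (sum_le_hasSum S (fun n _ => by positivity) (h.hasSum_grad_comp_sq i))
  exact Finset.sum_congr rfl fun n _ => by rw [mul_pow, ladder_sq]

theorem InV.tn_pd_partialSum_le {w : Plane → ℝ} {D : Plane → Plane} (h : InV w D)
    (S : Finset (Fin 2 → ℕ)) (i : Fin 2) : tn (pd i (partialSum w S)) ≤ nX D :=
  (tn_pd_le (hasTemperateGrowth_partialSum w S) i).trans (h.tn_rs_partialSum_le S i)

theorem nX_G_mul (Q : Plane → ℝ) : nX (fun x => G x * Q x) = tn Q := by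
  rw [nX, wt_G_mul]; rfl

/-- The remainder of the Hermite expansion. -/
def rem (w : Plane → ℝ) (S : Finset (Fin 2 → ℕ)) (x : Plane) : ℝ := w x - G x * partialSum w S x

theorem memLpw_rem {w : Plane → ℝ} (hw : MemLpw 2 w) (S : Finset (Fin 2 → ℕ)) :
    MemLpw 2 (rem w S) := hw.sub (memLpw_G_mul (hasTemperateGrowth_partialSum w S))

theorem nX_rem_le {w : Plane → ℝ} (hw : MemLpw 2 w) (S : Finset (Fin 2 → ℕ)) :
    nX (rem w S) ≤ 2 * nX w := by
  have h1 := nX_sub_le hw (memLpw_G_mul (hasTemperateGrowth_partialSum w S))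
  rw [nX_G_mul] at h1
  have h2 := tn_partialSum_le hw S
  exact h1.trans (by linarith)

/-- If `G * partialSum w S` were `w`, both parts would vanish by `InV.integral_vG_transport` and
`InV.integral_bs_moment`. Subtracting these identities leaves the same integrals with `rem w S` in
place of `w`, which tend to zero as `S` grows. -/
theorem Slice.vortexTerm_le {α β : ℝ} {b w : Plane → ℝ} {D P : Plane → Plane}
    (h : Slice α β b w D P) (S : Finset (Fin 2 → ℕ)) :
    |vortexTerm w D (partialSum w S)| ≤
      (2 + bsConst * (tn (fun x => x 0) + tn fun x => x 1)) * (nX D * nX (rem w S)) := by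
  have hD := memLpw_vec_iff.1 h.inV.memD
  have hw := h.inV.mem
  have he := memLpw_rem hw S
  have hT := hasTemperateGrowth_partialSum w S
  have c0 := bsConst_pos
  have mvG := fun i => (contDiff_vG i).continuous.aestronglyMeasurable (μ := volume)
  have bvG := fun (i : Fin 2) (x : Plane) => abs_vG_apply_le x i
  have mx := fun i => memLp_gh_mul (hasTemperateGrowth_coord i)
  have V1 := fun i => abs_integral_wt_le (mvG i) (bvG i) hw (hD i)
  have V2 := fun i => abs_integral_wt_le (mvG i) (bvG i) he (hD i)
  have B1 := fun i => h.bsG_bound hw (mx i) i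
  have B2 := fun i => h.bsG_bound he (mx i) i
  have z1 := h.inV.integral_vG_transport
  have z2 := h.inV.integral_bs_moment
  have z1' : (∫ x, vG x 0 * (wt w x * wt (fun x => D x 0) x)) +
      ∫ x, vG x 1 * (wt w x * wt (fun x => D x 1) x) = 0 := by
    rw [← integral_add (V1 0).1 (V1 1).1, ← z1]
    congr 1; ext x; ring
  have z2' : (∫ x, biotSavart w x 0 * (w x * x 0)) + ∫ x, biotSavart w x 1 * (w x * x 1) = 0 := by
    rw [← integral_add (B1 0).1 (B1 1).1, ← z2]
    congr 1; ext x; rw [inner_plane]; ring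
  have e1 : ∀ i, ∫ x, vG x i * (D x i * partialSum w S x) =
      (∫ x, vG x i * (wt w x * wt (fun x => D x i) x)) -
        ∫ x, vG x i * (wt (rem w S) x * wt (fun x => D x i) x) := fun i => by
    rw [← integral_sub (V1 i).1 (V2 i).1]
    congr 1; ext x
    have := gh_ne_zero x
    simp only [wt, rem, smul_eq_mul, G_eq]
    field_simp
    ring
  have e2 : ∀ i, ∫ x, biotSavart w x i * (G x * (x i * partialSum w S x)) =
      (∫ x, biotSavart w x i * (w x * x i)) - ∫ x, biotSavart w x i * (rem w S x * x i) :=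
    fun i => by
      rw [← integral_sub (B1 i).1 (B2 i).1]
      congr 1; ext x; simp only [rem]; ring
  rw [vortexTerm, e1, e1, e2, e2]
  have n0 := nX_nonneg D
  have n1 := nX_nonneg (rem w S)
  have a1 : ∀ i, |∫ x, vG x i * (wt (rem w S) x * wt (fun x => D x i) x)| ≤
      nX D * nX (rem w S) := fun i => by
    refine (V2 i).2.trans ?_
    rw [one_mul, mul_comm]
    exact mul_le_mul_of_nonneg_right (nX_comp_le h.inV.memD i) n1
  have a2 := fun i => (B2 i).2
  have t := fun i : Fin 2 => tn_nonneg fun x => x i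
  have p0 : 0 ≤ bsConst * nX D * (nX (rem w S) * tn fun x => x 0) := by
    have := t 0; positivity
  have p1 : 0 ≤ bsConst * nX D * (nX (rem w S) * tn fun x => x 1) := by
    have := t 1; positivity
  have q0 := abs_le.1 (a1 0)
  have q1 := abs_le.1 (a1 1)
  have r0 := abs_le.1 (a2 0)
  have r1 := abs_le.1 (a2 1)
  rw [abs_le]
  constructor <;> nlinarith

theorem Slice.transTerm_le {α β : ℝ} {b w : Plane → ℝ} {D P : Plane → Plane} {φ : Plane → ℝ}
    (h : Slice α β b w D P) (hφ : φ.HasTemperateGrowth) :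
    |transTerm w D φ| ≤ 2 * bsConst * nX D ^ 2 * tn φ := by
  refine (abs_add_le _ _).trans ((add_le_add (h.trans_bound (memLp_gh_mul hφ) 0).2
    (h.trans_bound (memLp_gh_mul hφ) 1).2).trans (le_of_eq ?_))
  ring

theorem exists_fluxTerm_le (α : ℝ) : ∃ C ≥ 0, ∀ {β : ℝ} {b w : Plane → ℝ} {D P : Plane → Plane}
    {φ : Plane → ℝ}, Slice α β b w D P → φ.HasTemperateGrowth →
    |fluxTerm α b D P φ| ≤ C * (nX b + β * nX D) * (tn (pd 0 φ) + tn (pd 1 φ)) := by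
  obtain ⟨C, hC, H⟩ := exists_flux_bound α
  refine ⟨C, hC, fun {β b w D P φ} h hφ => ?_⟩
  refine (abs_add_le _ _).trans ((add_le_add
    (H h 0 1 (-1) (by simp) _ (memLp_gh_mul (hasTemperateGrowth_pd hφ 0))).2
    (H h 1 0 1 (by simp) _ (memLp_gh_mul (hasTemperateGrowth_pd hφ 1))).2).trans (le_of_eq ?_))
  ring

/-- The energy identity at a fixed time, up to controlled errors. -/
theorem exists_pairing_partialSum (α : ℝ) : ∃ C ≥ 0, ∀ {β : ℝ} {b w : Plane → ℝ}
    {D P : Plane → Plane}, Slice α β b w D P → ∀ S : Finset (Fin 2 → ℕ),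
    |(∫ x, vorticityPairing α b w D P (partialSum w S) x) + modeEnergy w S| ≤
      C * (nX D * nX (rem w S) + nX D ^ 2 * nX w + (nX b + β * nX D) * nX D) := by
  obtain ⟨C, hC, H⟩ := exists_fluxTerm_le α
  have c0 := bsConst_pos
  have t := fun i : Fin 2 => tn_nonneg fun x => x i
  set C₁ := 2 + bsConst * (tn (fun x => x 0) + tn fun x => x 1)
  have hC₁ : 0 ≤ C₁ := by have := t 0; have := t 1; positivity
  refine ⟨|α| * C₁ + 2 * bsConst + 2 * C, by positivity, fun {β b w D P} h S => ?_⟩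
  have hT := hasTemperateGrowth_partialSum w S
  have β0 := h.nonneg
  have n0 := nX_nonneg D
  have n1 := nX_nonneg (rem w S)
  have n2 := nX_nonneg w
  have n3 := nX_nonneg b
  rw [(h.pairing hT).2, h.inV.linTerm_partialSum]
  have e1 := h.vortexTerm_le S
  have e2 := h.transTerm_le hT
  have e2' : 2 * bsConst * nX D ^ 2 * tn (partialSum w S) ≤ 2 * bsConst * nX D ^ 2 * nX w :=
    mul_le_mul_of_nonneg_left (tn_partialSum_le h.inV.mem S) (by positivity)
  have e3 := H h hT
  have e3' : C * (nX b + β * nX D) * (tn (pd 0 (partialSum w S)) + tn (pd 1 (partialSum w S))) ≤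
      C * (nX b + β * nX D) * (nX D + nX D) :=
    mul_le_mul_of_nonneg_left (add_le_add (h.inV.tn_pd_partialSum_le S 0)
      (h.inV.tn_pd_partialSum_le S 1)) (by positivity)
  have e1' : |α * vortexTerm w D (partialSum w S)| ≤ |α| * (C₁ * (nX D * nX (rem w S))) := by
    rw [abs_mul]; exact mul_le_mul_of_nonneg_left e1 (abs_nonneg _)
  have q1 := abs_le.1 e1'
  have q2 := abs_le.1 (e2.trans e2')
  have q3 := abs_le.1 (e3.trans e3')
  have p1 : 0 ≤ nX D * nX (rem w S) := by positivity
  have p2 : 0 ≤ nX D ^ 2 * nX w := by positivity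
  have p3 : 0 ≤ (nX b + β * nX D) * nX D := by positivity
  have r1 : 0 ≤ |α| * C₁ * (nX D ^ 2 * nX w) := by positivity
  have r2 : 0 ≤ |α| * C₁ * ((nX b + β * nX D) * nX D) := by positivity
  have r3 : 0 ≤ bsConst * (nX D * nX (rem w S)) := by positivity
  have r4 : 0 ≤ bsConst * ((nX b + β * nX D) * nX D) := by positivity
  have r5 : 0 ≤ C * (nX D * nX (rem w S)) := by positivity
  have r6 : 0 ≤ C * (nX D ^ 2 * nX w) := by positivity
  rw [abs_le]
  constructor <;> linarith

/-! ### The pairing with tempered functions, and conservation of the mean -/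

/-- The norm of a test function which controls all the terms of the vorticity equation. -/
def testNorm (φ : Plane → ℝ) : ℝ :=
  tn φ + (tn (fun x => x 0 * φ x) + tn (fun x => x 1 * φ x)) + (tn (pd 0 φ) + tn (pd 1 φ))

theorem tn_rs_le {φ : Plane → ℝ} (hφ : φ.HasTemperateGrowth) (i : Fin 2) :
    tn (rs i φ) ≤ tn (fun x => x i * φ x) + tn (pd i φ) := by
  have h1 := memLp_gh_mul (hasTemperateGrowth_coord_mul hφ i)
  have h2 := memLp_gh_mul (hasTemperateGrowth_pd hφ i)
  have h3 := l2_sub_le (h1.const_mul (1 / 2)) h2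
  rw [l2_const_mul] at h3
  have e : tn (rs i φ) = l2 fun x => 1 / 2 * (gh x * (x i * φ x)) - gh x * pd i φ x := by
    rw [tn]; congr 1; ext x; rw [rs]; ring
  rw [e]
  refine h3.trans (add_le_add ?_ le_rfl)
  exact mul_le_of_le_one_left (l2_nonneg _) (by rw [abs_of_pos] <;> norm_num)

/-- The factor `1 + nX D ^ 2` is integrable in time, so convergence of test functions in `testNorm`
passes through the time integral of the weak formulation. -/
theorem exists_pairing_bound (α : ℝ) : ∃ C ≥ 0, ∀ {β : ℝ} {b w : Plane → ℝ}
    {D P : Plane → Plane} {φ : Plane → ℝ}, Slice α β b w D P → φ.HasTemperateGrowth →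
    |∫ x, vorticityPairing α b w D P φ x| ≤ C * (1 + nX D ^ 2) * testNorm φ := by
  obtain ⟨C, hC, H⟩ := exists_fluxTerm_le α
  have c0 := bsConst_pos
  refine ⟨2 + |α| * (2 + bsConst) + 2 * bsConst + 2 * C, by positivity,
    fun {β b w D P φ} h hφ => ?_⟩
  have hD := memLpw_vec_iff.1 h.inV.memD
  have n0 := nX_nonneg D
  have β0 := h.nonneg
  set T := testNorm φ with hT
  have t0 := tn_nonneg φ
  have tx := fun i : Fin 2 => tn_nonneg fun x => x i * φ x
  have tp := fun i : Fin 2 => tn_nonneg (pd i φ)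
  have lT : T = tn φ + (tn (fun x => x 0 * φ x) + tn (fun x => x 1 * φ x)) +
    (tn (pd 0 φ) + tn (pd 1 φ)) := rfl
  have T0 : 0 ≤ T := by have := tx 0; have := tx 1; have := tp 0; have := tp 1; rw [lT]; positivity
  have hd : nX D ≤ (1 + nX D ^ 2) / 2 := by nlinarith [sq_nonneg (nX D - 1)]
  have hd' : nX D ≤ 1 + nX D ^ 2 := by nlinarith
  rw [(h.pairing hφ).2]
  -- the linear term
  have a0 := (abs_integral_mul_le_tn h.inV.mem (memLp_gh_mul hφ)).2
  have a1 := fun i => (abs_integral_mul_le_tn (hD i) (memLp_gh_mul (hasTemperateGrowth_rs hφ i))).2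
  have a1' : ∀ i, |∫ x, D x i * rs i φ x| ≤ nX D * (tn (fun x => x i * φ x) + tn (pd i φ)) :=
    fun i => (a1 i).trans (mul_le_mul (nX_comp_le h.inV.memD i) (tn_rs_le hφ i) (tn_nonneg _) n0)
  have lin : |linTerm w D φ| ≤ 2 * (1 + nX D ^ 2) * T := by
    have s1 : |linTerm w D φ| ≤ tn φ + nX D * T := by
      refine (abs_add_le _ _).trans (add_le_add (a0.trans (mul_le_of_le_one_left t0 h.le_one))
        ((abs_add_le _ _).trans ((add_le_add (a1' 0) (a1' 1)).trans ?_)))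
      rw [← mul_add]
      exact mul_le_mul_of_nonneg_left (by rw [lT]; linarith) n0
    have s2 : tn φ ≤ T := by have := tx 0; have := tx 1; have := tp 0; have := tp 1; rw [lT]; linarith
    nlinarith [mul_le_mul_of_nonneg_right hd' T0, mul_nonneg (sq_nonneg (nX D)) T0]
  -- the vortex term
  have vor : |vortexTerm w D φ| ≤ (2 + bsConst) * (1 + nX D ^ 2) * T := by
    have v1 := fun i => (h.vG_bound (memLp_gh_mul hφ) i).2
    have v2 := fun i => (h.bsG_bound memLpw_G (memLp_gh_mul (hasTemperateGrowth_coord_mul hφ i)) i).2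
    simp_rw [nX_G, one_mul] at v2
    have s1 : |vortexTerm w D φ| ≤ 2 * (nX D * T) + bsConst * (nX D * T) := by
      have u0 := abs_le.1 (v1 0)
      have u1 := abs_le.1 (v1 1)
      have w0 := abs_le.1 (v2 0)
      have w1 := abs_le.1 (v2 1)
      have k1 : nX D * tn φ ≤ nX D * T := mul_le_mul_of_nonneg_left
        (by have := tx 0; have := tx 1; have := tp 0; have := tp 1; rw [lT]; linarith) n0
      have k2 : bsConst * nX D * tn (fun x => x 0 * φ x) + bsConst * nX D * tn (fun x => x 1 * φ x)
          ≤ bsConst * (nX D * T) := by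
        rw [← mul_add, ← mul_assoc]
        exact mul_le_mul_of_nonneg_left (by have := tp 0; have := tp 1; rw [lT]; linarith)
          (by positivity)
      have k3 : 0 ≤ bsConst * (nX D * T) := by positivity
      rw [vortexTerm, abs_le]
      constructor <;> linarith
    refine s1.trans ?_
    rw [← add_mul, mul_assoc]
    exact mul_le_mul_of_nonneg_left (mul_le_mul_of_nonneg_right hd' T0) (by positivity)
  have sT : tn φ ≤ T := by have := tx 0; have := tx 1; have := tp 0; have := tp 1; rw [lT]; linarith
  have tra : |transTerm w D φ| ≤ 2 * bsConst * (1 + nX D ^ 2) * T :=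
    (h.transTerm_le hφ).trans (mul_le_mul (mul_le_mul_of_nonneg_left (by linarith) (by positivity))
      sT t0 (by positivity))
  have flu : |fluxTerm α b D P φ| ≤ 2 * C * (1 + nX D ^ 2) * T := by
    have m1 : nX b + β * nX D ≤ 2 * (1 + nX D ^ 2) := by
      have := h.b_one
      have : β * nX D ≤ 1 * nX D := mul_le_mul_of_nonneg_right (by linarith [h.half]) n0
      nlinarith
    have m2 : tn (pd 0 φ) + tn (pd 1 φ) ≤ T := by
      have := tx 0; have := tx 1; rw [lT]; linarith
    refine (H h hφ).trans (mul_le_mul ?_ m2 (add_nonneg (tp 0) (tp 1)) (by positivity))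
    nlinarith
  have vor' : |α * vortexTerm w D φ| ≤ |α| * ((2 + bsConst) * (1 + nX D ^ 2) * T) := by
    rw [abs_mul]; exact mul_le_mul_of_nonneg_left vor (abs_nonneg _)
  have q1 := abs_le.1 lin
  have q2 := abs_le.1 vor'
  have q3 := abs_le.1 tra
  have q4 := abs_le.1 flu
  rw [abs_le]
  constructor <;> linarith

/-- The mass is conserved. -/
theorem Slice.pairing_one {α β : ℝ} {b w : Plane → ℝ} {D P : Plane → Plane}
    (h : Slice α β b w D P) : ∫ x, vorticityPairing α b w D P (fun _ => 1) x = 0 := by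
  have hT : (fun _ : Plane => (1 : ℝ)).HasTemperateGrowth := .const 1
  have hD := memLpw_vec_iff.1 h.inV.memD
  have pd1 : ∀ i, pd i (fun _ : Plane => (1 : ℝ)) = fun _ => 0 := fun i => by
    ext x; exact pd_const _ _ _
  rw [(h.pairing hT).2]
  have l : linTerm w D (fun _ => 1) = 0 := by
    have k := fun i => h.inV.integral_pd (hasTemperateGrowth_coord i) i
    simp_rw [pd_coord, if_true, mul_one] at k
    have e : ∀ i, ∫ x, D x i * rs i (fun _ => 1) x = 1 / 2 * ∫ x, D x i * x i := fun i => by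
      rw [← integral_const_mul]; congr 1; ext x; rw [rs, pd1]; ring
    simp only [linTerm, mul_one, e]
    linarith [k 0, k 1]
  have v : vortexTerm w D (fun _ => 1) = 0 := by
    have i1 := fun i => (h.vG_bound (memLp_gh_mul hT) i).1
    simp only [mul_one] at i1
    have a := h.inV.integral_vG_grad
    simp_rw [inner_plane] at a
    rw [integral_add (i1 0) (i1 1)] at a
    have g := h.inV.bs_weak_div contDiff_G integrable_G integrable_pd_G memLpw_G.memLp
    have e : ∀ i, ∫ x, biotSavart w x i * pd i G x =
        -(1 / 2) * ∫ x, biotSavart w x i * (G x * x i) := fun i => by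
      rw [← integral_const_mul]; congr 1; ext x; rw [pd_G]; ring
    rw [e, e] at g
    simp only [vortexTerm, mul_one]
    linarith
  have t : transTerm w D (fun _ => 1) = 0 := by
    simp only [transTerm, mul_one]
    exact h.inV.integral_bs_grad
  have f : fluxTerm α b D P (fun _ => 1) = 0 := by simp [fluxTerm, pd1]
  rw [l, v, t, f]; ring

/-- The pairing is linear in the test function. -/
theorem pairing_sum (α : ℝ) (b w : Plane → ℝ) (D P : Plane → Plane) (S : Finset (Fin 2 → ℕ))
    (c : (Fin 2 → ℕ) → ℝ) (x : Plane) :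
    vorticityPairing α b w D P (fun x => ∑ n ∈ S, c n * hermite n x) x =
      ∑ n ∈ S, c n * vorticityPairing α b w D P (hermite n) x := by
  have hd := fun n => differentiable_of_smooth (hasTemperateGrowth_hermite n).1
  have e : ∀ i, pd i (fun x => ∑ n ∈ S, c n * hermite n x) x = ∑ n ∈ S, c n * pd i (hermite n) x :=
    fun i => by
      rw [pd_sum S (fun n _ => ((hd n) x).const_mul _)]
      exact Finset.sum_congr rfl fun n _ => pd_const_mul (hd n x) _ _
  simp only [vorticityPairing, LPairing, inner_plane, gradient_apply, e, Finset.mul_sum,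
    ← Finset.sum_neg_distrib, ← Finset.sum_add_distrib, ← Finset.sum_sub_distrib]
  exact Finset.sum_congr rfl fun n _ => by ring

theorem Slice.sum_pairing {α β : ℝ} {b w : Plane → ℝ} {D P : Plane → Plane}
    (h : Slice α β b w D P) (S : Finset (Fin 2 → ℕ)) :
    ∑ n ∈ S, coef w n * ∫ x, vorticityPairing α b w D P (hermite n) x =
      ∫ x, vorticityPairing α b w D P (partialSum w S) x := by
  have e : ∀ x, vorticityPairing α b w D P (partialSum w S) x =
      ∑ n ∈ S, coef w n * vorticityPairing α b w D P (hermite n) x :=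
    pairing_sum α b w D P S (coef w)
  simp_rw [e]
  rw [integral_finsetSum S fun n _ => (h.pairing (hasTemperateGrowth_hermite n)).1.const_mul _]
  simp_rw [integral_const_mul]

/-! ### Integral inequalities in time -/

/-- A Gronwall lemma for `Y` not known to be continuous. The hypothesis makes `Y` nonincreasing, so
its integral over `[s, t]` is at least `(t - s) Y t` and `Y t (1 + c (t - s)) ≤ Y s`. Iterating over
`n` equal steps and using `(1 + cT/n)^n → e^{cT}` gives the claim. -/
theorem le_exp_of_le_sub_integral {Y : ℝ → ℝ} {c T : ℝ} (hc : 0 ≤ c) (hT : 0 ≤ T)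
    (Y0 : ∀ t ∈ Icc 0 T, 0 ≤ Y t) (hY : IntervalIntegrable Y volume 0 T)
    (h : ∀ s t, 0 ≤ s → s ≤ t → t ≤ T → Y t ≤ Y s - c * ∫ τ in s..t, Y τ) :
    Y T ≤ Y 0 * Real.exp (-(c * T)) := by
  have sub : ∀ s t, 0 ≤ s → s ≤ t → t ≤ T → IntervalIntegrable Y volume s t :=
    fun s t hs hst ht => hY.mono_set (by
      rw [uIcc_of_le hst, uIcc_of_le hT]; exact Icc_subset_Icc hs ht)
  have anti : ∀ s t, 0 ≤ s → s ≤ t → t ≤ T → Y t ≤ Y s := fun s t hs hst ht => by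
    have : 0 ≤ ∫ τ in s..t, Y τ := intervalIntegral.integral_nonneg hst fun u hu =>
      Y0 u ⟨hs.trans hu.1, hu.2.trans ht⟩
    nlinarith [h s t hs hst ht]
  have step : ∀ s t, 0 ≤ s → s ≤ t → t ≤ T → Y t * (1 + c * (t - s)) ≤ Y s :=
    fun s t hs hst ht => by
      have : ∫ τ in s..t, Y t ≤ ∫ τ in s..t, Y τ :=
        intervalIntegral.integral_mono_on hst intervalIntegrable_const (sub s t hs hst ht)
          fun u hu => anti u t (hs.trans hu.1) hu.2 ht
      rw [intervalIntegral.integral_const, smul_eq_mul] at this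
      nlinarith [h s t hs hst ht, mul_le_mul_of_nonneg_left this hc]
  have iter : ∀ n : ℕ, 0 < n → Y T * (1 + c * T / n) ^ n ≤ Y 0 := fun n hn => by
    have n0 : (0 : ℝ) < n := Nat.cast_pos.2 hn
    have key : ∀ k : ℕ, k ≤ n → Y (k * (T / n)) * (1 + c * T / n) ^ k ≤ Y 0 := fun k => by
      induction k with
      | zero => intro _; simp
      | succ k ih =>
        intro hk
        have hk' : ((k : ℝ) + 1) ≤ n := by exact_mod_cast hk
        have d0 : 0 ≤ T / n := by positivity
        have e : (n : ℝ) * (T / n) = T := by field_simp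
        have := step (k * (T / n)) ((k + 1) * (T / n)) (by positivity) (by linarith)
          (by rw [← e]; gcongr; field_simp; exact le_rfl)
        have e2 : c * ((k + 1) * (T / n) - k * (T / n)) = c * T / n := by ring
        rw [e2] at this
        have i := ih (by omega)
        push_cast
        calc _ = Y ((k + 1) * (T / n)) * (1 + c * T / n) * (1 + c * T / n) ^ k := by ring
          _ ≤ Y (k * (T / n)) * (1 + c * T / n) ^ k := by gcongr
          _ ≤ Y 0 := i
    have := key n le_rfl
    rwa [show (n : ℝ) * (T / n) = T by field_simp] at this
  have lim := (Real.tendsto_one_add_div_pow_exp (c * T)).const_mul (Y T)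
  have : Y T * Real.exp (c * T) ≤ Y 0 := le_of_tendsto lim
    ((eventually_gt_atTop 0).mono fun n hn => iter n hn)
  rw [Real.exp_neg, ← div_eq_mul_inv, le_div_iff₀ (Real.exp_pos _)]
  exact this

/-- With `A = m / (1 - 2γ)`, the corrected function `E + A e^{-t}` satisfies the inequality without
source: the derivative of `A e^{-t}` is `-2γ A e^{-t} - m e^{-t}`. -/
theorem le_exp_of_le_add_integral {E : ℝ → ℝ} {γ m T : ℝ} (hγ : 0 ≤ γ) (hγ' : γ < 1 / 2)
    (hm : 0 ≤ m) (hT : 0 ≤ T) (E0 : ∀ t ∈ Icc 0 T, 0 ≤ E t)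
    (hE : IntervalIntegrable E volume 0 T)
    (h : ∀ s t, 0 ≤ s → s ≤ t → t ≤ T →
      E t ≤ E s + ∫ τ in s..t, (-(2 * γ) * E τ + m * Real.exp (-τ))) :
    E T ≤ (E 0 + m / (1 - 2 * γ)) * Real.exp (-(2 * γ * T)) := by
  have g0 : 0 < 1 - 2 * γ := by linarith
  set A := m / (1 - 2 * γ) with hA
  have A0 : 0 ≤ A := by positivity
  have hm' : m = A * (1 - 2 * γ) := by rw [hA]; field_simp
  have iexp : ∀ s t, IntervalIntegrable (fun τ => Real.exp (-τ)) volume s t :=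
    fun s t => (Real.continuous_exp.comp continuous_neg).intervalIntegrable s t
  have vexp : ∀ s t : ℝ, ∫ τ in s..t, Real.exp (-τ) = Real.exp (-s) - Real.exp (-t) :=
    fun s t => by
      rw [intervalIntegral.integral_comp_neg (fun τ => Real.exp τ), integral_exp]
  have := le_exp_of_le_sub_integral (Y := fun t => E t + A * Real.exp (-t)) (c := 2 * γ)
    (by linarith) hT (fun t ht => add_nonneg (E0 t ht) (by positivity))
    (hE.add ((iexp 0 T).const_mul A)) fun s t hs hst ht => by
      have iE : IntervalIntegrable E volume s t := hE.mono_set (by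
        rw [uIcc_of_le hst, uIcc_of_le hT]; exact Icc_subset_Icc hs ht)
      have := h s t hs hst ht
      rw [intervalIntegral.integral_add (iE.const_mul _) ((iexp s t).const_mul m),
        intervalIntegral.integral_const_mul, intervalIntegral.integral_const_mul, vexp] at this
      rw [intervalIntegral.integral_add iE ((iexp s t).const_mul A),
        intervalIntegral.integral_const_mul, vexp]
      rw [hm'] at this
      linarith
  have e0 : 0 ≤ A * Real.exp (-T) := by positivity
  simp only [neg_zero, Real.exp_zero, mul_one] at this
  linarith

/-- The product rule for absolutely continuous functions. As `a` is prescribed only on `[0, T]`, it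
is replaced by the primitive `f`, with which it agrees on `[s, t]`. -/
theorem sq_sub_sq_eq_integral {a r : ℝ → ℝ} {a₀ T : ℝ} (hr : IntervalIntegrable r volume 0 T)
    (ha : ∀ t ∈ Icc 0 T, a t = a₀ + ∫ τ in (0 : ℝ)..t, r τ) {s t : ℝ} (hs : 0 ≤ s) (hst : s ≤ t)
    (ht : t ≤ T) : IntervalIntegrable (fun τ => a τ * r τ) volume s t ∧
      a t ^ 2 - a s ^ 2 = ∫ τ in s..t, 2 * (a τ * r τ) := by
  have rst : IntervalIntegrable r volume s t := hr.mono_set (by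
    rw [uIcc_of_le hst, uIcc_of_le (hs.trans (hst.trans ht))]; exact Icc_subset_Icc hs ht)
  set f : ℝ → ℝ := fun x => a s + ∫ τ in s..x, r τ
  have hac : AbsolutelyContinuousOnInterval f s t :=
    (LipschitzWith.const (a s)).lipschitzOnWith.absolutelyContinuousOnInterval.add
      (rst.absolutelyContinuousOnInterval_intervalIntegral left_mem_uIcc)
  have haf : ∀ x ∈ Icc s t, a x = f x := fun x hx => by
    have r1 : IntervalIntegrable r volume 0 s := hr.mono_set (by
      rw [uIcc_of_le hs, uIcc_of_le (hs.trans (hst.trans ht))]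
      exact Icc_subset_Icc le_rfl (hst.trans ht))
    have r2 : IntervalIntegrable r volume s x := rst.mono_set (by
      rw [uIcc_of_le hx.1, uIcc_of_le hst]
      exact Icc_subset_Icc le_rfl hx.2)
    show a x = a s + ∫ τ in s..x, r τ
    rw [ha x ⟨hs.trans hx.1, hx.2.trans ht⟩, ha s ⟨hs, hst.trans ht⟩, add_assoc,
      intervalIntegral.integral_add_adjacent_intervals r1 r2]
  have hd : ∀ᵐ x, x ∈ uIoc s t → deriv f x = r x := by
    filter_upwards [rst.ae_hasDerivAt_integral] with x hx hxm
    exact ((hx (uIoc_subset_uIcc hxm) s left_mem_uIcc).const_add (a s)).deriv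
  have key := hac.integral_deriv_mul_eq_sub hac
  have e : ∀ᵐ x, x ∈ uIoc s t → deriv f x * f x + f x * deriv f x = 2 * (a x * r x) := by
    filter_upwards [hd] with x hx hxm
    rw [hx hxm, haf x (by rw [uIoc_of_le hst] at hxm; exact ⟨hxm.1.le, hxm.2⟩)]
    ring
  rw [intervalIntegral.integral_congr_ae e] at key
  refine ⟨?_, ?_⟩
  · refine (rst.continuousOn_mul hac.continuousOn).congr_ae ?_
    rw [EventuallyEq, ae_restrict_iff' measurableSet_uIoc]
    refine ae_of_all _ fun x hx => ?_
    rw [uIoc_of_le hst] at hx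
    rw [haf x ⟨hx.1.le, hx.2⟩]
  · rw [key, haf t (right_mem_Icc.2 hst), haf s (left_mem_Icc.2 hst)]; ring

/-- The exact balance for a finite set of modes is passed to the limit along finite subsets. Only an
upper bound is wanted, so it suffices that the positive part of the excess over `U` tends to zero,
dominated by `H + |U|`. Countability of `ι` makes the filter on finite subsets countably generated,
as dominated convergence requires. -/
theorem energy_le_of_modes {ι : Type*} [Countable ι] {a r : ι → ℝ → ℝ} {a₀ : ι → ℝ}
    {E U H : ℝ → ℝ} {T : ℝ}
    (hr : ∀ n, IntervalIntegrable (r n) volume 0 T)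
    (ha : ∀ n, ∀ t ∈ Icc 0 T, a n t = a₀ n + ∫ τ in (0 : ℝ)..t, r n τ)
    (hE : ∀ t ∈ Icc 0 T, HasSum (fun n => a n t ^ 2) (E t))
    (hU : IntervalIntegrable U volume 0 T) (hH : IntervalIntegrable H volume 0 T)
    (hdom : ∀ᵐ τ ∂volume.restrict (Ioc 0 T), ∀ S : Finset ι, |∑ n ∈ S, a n τ * r n τ| ≤ H τ)
    (hlim : ∀ᵐ τ ∂volume.restrict (Ioc 0 T),
      Tendsto (fun S : Finset ι => max ((∑ n ∈ S, a n τ * r n τ) - U τ) 0) atTop (𝓝 0))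
    {s t : ℝ} (hs : 0 ≤ s) (hst : s ≤ t) (ht : t ≤ T) :
    E t ≤ E s + ∫ τ in s..t, 2 * U τ := by
  have sub : uIcc s t ⊆ uIcc 0 T := by
    rw [uIcc_of_le hst, uIcc_of_le (hs.trans (hst.trans ht))]; exact Icc_subset_Icc hs ht
  have sub' : Ioc s t ⊆ Ioc 0 T := Ioc_subset_Ioc hs ht
  have hdom' := ae_restrict_of_ae_restrict_of_subset sub' hdom
  have hlim' := ae_restrict_of_ae_restrict_of_subset sub' hlim
  have iU := hU.mono_set sub
  have iH := hH.mono_set sub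
  set R : Finset ι → ℝ → ℝ := fun S τ => ∑ n ∈ S, a n τ * r n τ with hR
  have iR : ∀ S, IntervalIntegrable (R S) volume s t := fun S =>
    (IntervalIntegrable.sum S fun n _ => (sq_sub_sq_eq_integral (hr n) (ha n) hs hst ht).1).congr_ae
      (ae_of_all _ fun τ => by simp [R])
  have eS : ∀ S : Finset ι, ∑ n ∈ S, a n t ^ 2 = ∑ n ∈ S, a n s ^ 2 + ∫ τ in s..t, 2 * R S τ :=
    fun S => by
      rw [← sub_eq_iff_eq_add', ← Finset.sum_sub_distrib]
      simp_rw [R, Finset.mul_sum]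
      rw [intervalIntegral.integral_finsetSum fun n _ =>
        (sq_sub_sq_eq_integral (hr n) (ha n) hs hst ht).1.const_mul 2]
      exact Finset.sum_congr rfl fun n _ => (sq_sub_sq_eq_integral (hr n) (ha n) hs hst ht).2
  have iM : ∀ S, IntervalIntegrable (fun τ => max (R S τ - U τ) 0) volume s t := fun S => by
    rw [intervalIntegrable_iff_integrableOn_Ioc_of_le hst]
    exact (((intervalIntegrable_iff_integrableOn_Ioc_of_le hst).1 ((iR S).sub iU))).pos_part
  have lim : Tendsto (fun S => ∫ τ in s..t, max (R S τ - U τ) 0) atTop (𝓝 0) := by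
    have := intervalIntegral.tendsto_integral_filter_of_dominated_convergence
      (μ := volume) (a := s) (b := t) (l := (atTop : Filter (Finset ι)))
      (F := fun S τ => max (R S τ - U τ) 0) (f := fun _ => 0) (fun τ => H τ + |U τ|)
      (Eventually.of_forall fun S => by
        rw [uIoc_of_le hst]
        exact ((intervalIntegrable_iff_integrableOn_Ioc_of_le hst).1 (iM S)).aestronglyMeasurable)
      (Eventually.of_forall fun S => by
        rw [uIoc_of_le hst, ← ae_restrict_iff' measurableSet_Ioc]
        filter_upwards [hdom'] with τ hτ
        have h1 := (abs_le.1 (hτ S)).2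
        have h0 := (abs_nonneg _).trans (hτ S)
        rw [Real.norm_eq_abs, abs_of_nonneg (le_max_right _ _)]
        refine max_le ?_ (by positivity)
        linarith [neg_abs_le (U τ)])
      (iH.add iU.abs)
      (by
        rw [uIoc_of_le hst, ← ae_restrict_iff' measurableSet_Ioc]
        exact hlim')
    simpa using this
  have ineq : ∀ S : Finset ι, ∑ n ∈ S, a n t ^ 2 ≤
      ∑ n ∈ S, a n s ^ 2 + ((∫ τ in s..t, 2 * U τ) + 2 * ∫ τ in s..t, max (R S τ - U τ) 0) :=
    fun S => by
      rw [eS S, ← intervalIntegral.integral_const_mul, ← intervalIntegral.integral_add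
        (iU.const_mul 2) ((iM S).const_mul 2)]
      gcongr
      exact intervalIntegral.integral_mono_on hst ((iR S).const_mul 2)
        ((iU.const_mul 2).add ((iM S).const_mul 2)) fun τ _ => by
          have := le_max_left (R S τ - U τ) 0
          linarith
  have l1 := hE t ⟨hs.trans hst, ht⟩
  have l2 := hE s ⟨hs, hst.trans ht⟩
  unfold HasSum at l1 l2
  simp only [SummationFilter.unconditional_filter] at l1 l2
  have := le_of_tendsto_of_tendsto' l1 (l2.add ((lim.const_mul 2).const_add _)) ineq
  simpa using this

/-! ### Approximation by test functions -/

theorem tn_neg (φ : Plane → ℝ) : tn (fun x => -φ x) = tn φ := by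
  have : (fun x => gh x * -φ x) = -fun x => gh x * φ x := by ext x; simp
  rw [tn, this, l2, eLpNorm_neg]; rfl

theorem exists_tendsto_testNorm {φ : Plane → ℝ} (hφ : φ.HasTemperateGrowth) :
    ∃ ψ : ℕ → Plane → ℝ, (∀ k, IsTestFunction (ψ k)) ∧
      Tendsto (fun k => testNorm fun x => φ x - ψ k x) atTop (𝓝 0) := by
  have hψ : ∀ k : ℕ, IsTestFunction fun x => cutoff (k + 1) x * φ x := fun k =>
    (isTestFunction_cutoff (by positivity)).mul_left hφ.1
  refine ⟨fun k x => cutoff (k + 1) x * φ x, hψ, ?_⟩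
  have key : ∀ {Q : Plane → ℝ}, Q.HasTemperateGrowth →
      Tendsto (fun k : ℕ => tn fun x => Q x - cutoff (k + 1) x * Q x) atTop (𝓝 0) := fun hQ => by
    refine (tendsto_nX_cutoff hQ).congr fun k => ?_
    rw [← nX_G_mul]
    congr 1; ext x; ring
  have key' : ∀ i, Tendsto (fun k : ℕ => tn fun x => x i * (φ x - cutoff (k + 1) x * φ x))
      atTop (𝓝 0) := fun i =>
    (key (hasTemperateGrowth_coord_mul hφ i)).congr fun k => by congr 1; ext x; ring
  have hR : ∀ k : ℕ, (fun x => φ x - cutoff (k + 1) x * φ x).HasTemperateGrowth := fun k =>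
    hφ.fun_sub (hψ k).tempered
  have key'' : ∀ i, Tendsto (fun k : ℕ => tn (pd i fun x => φ x - cutoff (k + 1) x * φ x))
      atTop (𝓝 0) := fun i => by
    refine squeeze_zero (fun _ => tn_nonneg _) (fun k => tn_pd_le (hR k) i)
      ((tendsto_nX_pd_cutoff hφ i).congr fun k => ?_)
    rw [← tn_neg, ← nX_G_mul]
    congr 1; ext x
    have d1 : Differentiable ℝ fun x => G x * φ x := differentiable_of_smooth (contDiff_G.mul hφ.1)
    have d2 : Differentiable ℝ fun x => cutoff (k + 1) x * (G x * φ x) :=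
      differentiable_of_smooth ((contDiff_cutoff _).mul (contDiff_G.mul hφ.1))
    rw [← pd_sub (d1 x) (d2 x)]
    have e : (fun y => G y * φ y - cutoff (k + 1) y * (G y * φ y)) =
        fun y => G y * (φ y - cutoff (k + 1) y * φ y) := by ext y; ring
    rw [e, pd_G_mul (differentiable_of_smooth (hR k).1), rs]
    ring
  have := ((key hφ).add ((key' 0).add (key' 1))).add ((key'' 0).add (key'' 1))
  simpa [testNorm] using this

theorem tn_le_testNorm (φ : Plane → ℝ) : tn φ ≤ testNorm φ := by
  have h1 := tn_nonneg fun x => x 0 * φ x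
  have h2 := tn_nonneg fun x => x 1 * φ x
  have h3 := tn_nonneg (pd 0 φ)
  have h4 := tn_nonneg (pd 1 φ)
  rw [testNorm]; linarith

theorem pairing_sub (α : ℝ) (b w : Plane → ℝ) (D P : Plane → Plane) {φ ψ : Plane → ℝ}
    (hφ : Differentiable ℝ φ) (hψ : Differentiable ℝ ψ) (x : Plane) :
    vorticityPairing α b w D P (fun x => φ x - ψ x) x =
      vorticityPairing α b w D P φ x - vorticityPairing α b w D P ψ x := by
  simp only [vorticityPairing, LPairing, inner_plane, gradient_apply, pd_sub (hφ x) (hψ x)]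
  ring

/-! ### Measurability in time -/

section Measurability

variable {F : Type*} [NormedAddCommGroup F] [NormedSpace ℝ F]

theorem wnorm_two_sq (f : Plane → F) : wnorm 2 f ^ 2 = ∫⁻ x, ‖wt f x‖ₑ ^ 2 := by
  have := eLpNorm_nnreal_pow_eq_lintegral (f := wt f) (μ := volume) (p := 2) two_ne_zero
  rw [wnorm_eq]
  simpa using this

theorem aemeasurable_wnorm_sq {f : ℝ → Plane → F} {μ : Measure ℝ} [SFinite μ]
    (hf : AEStronglyMeasurable (Function.uncurry f) (μ.prod volume)) :
    AEMeasurable (fun s => wnorm 2 (f s) ^ 2) μ := by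
  simp_rw [wnorm_two_sq]
  have h : AEStronglyMeasurable (fun z : ℝ × Plane => (gh z.2)⁻¹ • Function.uncurry f z)
      (μ.prod volume) :=
    ((contDiff_gh_inv.continuous.comp continuous_snd).aestronglyMeasurable).smul hf
  exact (h.enorm.pow_const 2).lintegral_prod_right'

theorem nX_sq_eq (f : Plane → F) : nX f ^ 2 = (wnorm 2 f ^ 2).toReal := by
  rw [nX_eq, ENNReal.toReal_pow]

theorem ofReal_nX {f : Plane → F} (hf : MemLpw 2 f) : ENNReal.ofReal (nX f) = wnorm 2 f := by
  have h : wnorm 2 f ≠ ⊤ := hf.2.ne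
  rw [nX_eq, ENNReal.ofReal_toReal h]

end Measurability

/-! ### Small solutions -/

/-- A solution which satisfies the a priori bounds used in the energy estimate. -/
structure SmallSolution (α β κ ε : ℝ) (b₀ w₀ : Plane → ℝ) (b w : ℝ → Plane → ℝ)
    (Dw P : ℝ → Plane → Plane) : Prop where
  sol : IsSolution α b₀ w₀ b w Dw P
  mean : ∫ ξ, w₀ ξ = 0
  w_le : ∀ t > 0, nX (w t) ≤ ε
  grad_lt : ∀ t > 0, ∫⁻ s in Ioc 0 t, wnorm 2 (Dw s) ^ 2 < ⊤
  b_le : ∀ t > 0, nX (b t) ≤ κ * Real.exp (-t / 2)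
  b_sup : ∀ t > 0, ∀ᵐ x, |wt (b t) x| ≤ β
  ε_le : ε ≤ 1
  κ_le : κ ≤ 1
  β_le : β ≤ 1 / 2

/-- The pairing of the right-hand side of the vorticity equation with `φ`, at time `s`. -/
def rate (α : ℝ) (b w : ℝ → Plane → ℝ) (Dw P : ℝ → Plane → Plane) (φ : Plane → ℝ) (s : ℝ) : ℝ :=
  ∫ ξ, vorticityPairing α (b s) (w s) (Dw s) (P s) φ ξ

namespace SmallSolution

variable {α β κ ε : ℝ} {b₀ w₀ : Plane → ℝ} {b w : ℝ → Plane → ℝ} {Dw P : ℝ → Plane → Plane}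

theorem b_le_one (h : SmallSolution α β κ ε b₀ w₀ b w Dw P) {t : ℝ} (ht : 0 < t) :
    nX (b t) ≤ 1 := by
  have h1 := h.b_le t ht
  have e1 : Real.exp (-t / 2) ≤ 1 := Real.exp_le_one_iff.2 (by linarith)
  have e0 := Real.exp_pos (-t / 2)
  have hκ := h.κ_le
  nlinarith

theorem ae_slice (h : SmallSolution α β κ ε b₀ w₀ b w Dw P) {T : ℝ} (hT : 0 < T) :
    ∀ᵐ s ∂volume.restrict (Ioc 0 T), Slice α β (b s) (w s) (Dw s) (P s) := by
  have sub : Ioc 0 T ⊆ Ioi 0 := Ioc_subset_Ioi_self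
  have m : AEMeasurable (fun s => wnorm 2 (Dw s) ^ 2) (volume.restrict (Ioc 0 T)) :=
    (aemeasurable_wnorm_sq h.sol.Dw_meas).mono_measure (Measure.restrict_mono sub le_rfl)
  filter_upwards [ae_restrict_of_ae_restrict_of_subset sub h.sol.gradient,
    ae_restrict_of_ae_restrict_of_subset sub h.sol.pressure,
    ae_restrict_of_ae_restrict_of_subset sub h.sol.Dw_meas.prodMk_left,
    -- The finite dissipation integral places the gradient in `L²_w` for almost every time.
    ae_lt_top' m (h.grad_lt T hT).ne, ae_restrict_mem measurableSet_Ioc] with s h1 h2 h3 h4 hs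
  refine ⟨⟨h.sol.w_mem s hs.1, ⟨?_, ?_⟩, h1⟩, (h.w_le s hs.1).trans h.ε_le,
    (h.sol.b_mem s hs.1).1, h.b_le_one hs.1, h.b_sup s hs.1, h.β_le, h2⟩
  · have : AEStronglyMeasurable (wt (Dw s)) volume :=
      contDiff_gh_inv.continuous.aestronglyMeasurable.smul h3
    refine this.congr (ae_of_all _ fun x => ?_)
    simp only [wt, G_rpow]
  · exact lt_top_iff_ne_top.2 fun e => by
      have e' : wnorm 2 (Dw s) = ⊤ := e
      rw [e'] at h4; simp at h4

theorem integrableOn_grad (h : SmallSolution α β κ ε b₀ w₀ b w Dw P) {T : ℝ} (hT : 0 < T) :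
    IntegrableOn (fun s => nX (Dw s) ^ 2) (Ioc 0 T) := by
  simp_rw [nX_sq_eq]
  exact integrable_toReal_of_lintegral_ne_top ((aemeasurable_wnorm_sq h.sol.Dw_meas).mono_measure
    (Measure.restrict_mono Ioc_subset_Ioi_self le_rfl)) (h.grad_lt T hT).ne

theorem integrableOn_w_sq (h : SmallSolution α β κ ε b₀ w₀ b w Dw P) (T : ℝ) :
    IntegrableOn (fun s => nX (w s) ^ 2) (Ioc 0 T) := by
  have m : AEStronglyMeasurable (fun s => nX (w s) ^ 2) (volume.restrict (Ioc 0 T)) := by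
    simp_rw [nX_sq_eq]
    exact ((aemeasurable_wnorm_sq h.sol.w_meas).mono_measure
      (Measure.restrict_mono Ioc_subset_Ioi_self le_rfl)).ennreal_toReal.aestronglyMeasurable
  refine Integrable.of_bound m 1 ?_
  filter_upwards [ae_restrict_mem measurableSet_Ioc] with s hs
  rw [Real.norm_of_nonneg (sq_nonneg _)]
  exact pow_le_one₀ (nX_nonneg _) ((h.w_le s hs.1).trans h.ε_le)

/-- The weak formulation holds for test functions of tempered growth. -/
theorem weak_formulation (h : SmallSolution α β κ ε b₀ w₀ b w Dw P) {φ : Plane → ℝ}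
    (hφ : φ.HasTemperateGrowth) {T : ℝ} (hT : 0 < T) :
    IntegrableOn (rate α b w Dw P φ) (Ioc 0 T) ∧
      ∫ ξ, w T ξ * φ ξ = (∫ ξ, w₀ ξ * φ ξ) + ∫ s in Ioc 0 T, rate α b w Dw P φ s := by
  obtain ⟨ψ, hψ, lim⟩ := exists_tendsto_testNorm hφ
  obtain ⟨C, hC, H⟩ := exists_pairing_bound α
  have hR : ∀ k, (fun x => φ x - ψ k x).HasTemperateGrowth := fun k => hφ.fun_sub (hψ k).tempered
  have bound : ∀ᵐ s ∂volume.restrict (Ioc 0 T), ∀ k,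
      |rate α b w Dw P (ψ k) s - rate α b w Dw P φ s| ≤
        C * (1 + nX (Dw s) ^ 2) * testNorm fun x => φ x - ψ k x := by
    filter_upwards [h.ae_slice hT] with s hs k
    have := H hs (hR k)
    simp_rw [pairing_sub α (b s) (w s) (Dw s) (P s) (differentiable_of_smooth hφ.1)
      (differentiable_of_smooth (hψ k).1)] at this
    rw [integral_sub (hs.pairing hφ).1 (hs.pairing (hψ k).tempered).1] at this
    rw [abs_sub_comm]
    exact this
  have iψ : ∀ k, IntegrableOn (rate α b w Dw P (ψ k)) (Ioc 0 T) := fun k =>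
    (h.sol.vorticity_integrable (ψ k) (hψ k) T hT).integral_prod_left
  have iD : IntegrableOn (fun s => C * (1 + nX (Dw s) ^ 2)) (Ioc 0 T) :=
    ((integrableOn_const (by simp)).add (h.integrableOn_grad hT)).const_mul C
  have ptw : ∀ᵐ s ∂volume.restrict (Ioc 0 T),
      Tendsto (fun k => rate α b w Dw P (ψ k) s) atTop (𝓝 (rate α b w Dw P φ s)) := by
    filter_upwards [bound] with s hs
    exact tendsto_of_dist_le hs (by simpa using lim.const_mul (C * (1 + nX (Dw s) ^ 2)))
  have mφ : AEStronglyMeasurable (rate α b w Dw P φ) (volume.restrict (Ioc 0 T)) :=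
    aestronglyMeasurable_of_tendsto_ae atTop (fun k => (iψ k).aestronglyMeasurable) ptw
  have iφ : IntegrableOn (rate α b w Dw P φ) (Ioc 0 T) := by
    refine ((iψ 0).abs.add (iD.mul_const (testNorm fun x => φ x - ψ 0 x))).mono' mφ ?_
    filter_upwards [bound] with s hs
    have := hs 0
    have t := abs_sub_abs_le_abs_sub (rate α b w Dw P φ s) (rate α b w Dw P (ψ 0) s)
    rw [abs_sub_comm] at this
    rw [Real.norm_eq_abs, Pi.add_apply]
    linarith
  refine ⟨iφ, ?_⟩
  have pair : ∀ {f : Plane → ℝ}, MemLpw 2 f →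
      Tendsto (fun k => ∫ ξ, f ξ * ψ k ξ) atTop (𝓝 (∫ ξ, f ξ * φ ξ)) := fun {f} hf => by
    refine tendsto_of_dist_le (ε := fun k => nX f * testNorm fun x => φ x - ψ k x)
      (fun k => ?_) (by simpa using lim.const_mul (nX f))
    rw [abs_sub_comm, ← integral_sub (hf.integrable_mul hφ) (hf.integrable_mul (hψ k).tempered)]
    simp_rw [← mul_sub]
    exact (abs_integral_mul_le_tn hf (memLp_gh_mul (hR k))).2.trans
      (mul_le_mul_of_nonneg_left (tn_le_testNorm _) (nX_nonneg f))
  have l1 := pair (h.sol.w_mem T hT)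
  have l2 := pair h.sol.w₀_mem
  have l3 : Tendsto (fun k => ∫ s in Ioc 0 T, rate α b w Dw P (ψ k) s) atTop
      (𝓝 (∫ s in Ioc 0 T, rate α b w Dw P φ s)) := by
    refine tendsto_of_dist_le (ε := fun k => (∫ s in Ioc 0 T, C * (1 + nX (Dw s) ^ 2)) *
      testNorm fun x => φ x - ψ k x) (fun k => ?_)
      (by simpa using lim.const_mul (∫ s in Ioc 0 T, C * (1 + nX (Dw s) ^ 2)))
    rw [← integral_sub (iψ k) iφ, ← integral_mul_const]
    refine abs_integral_le_integral_abs.trans (integral_mono_of_nonneg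
      (ae_of_all _ fun _ => abs_nonneg _) (iD.mul_const _) ?_)
    filter_upwards [bound] with s hs using hs k
  exact tendsto_nhds_unique l1 ((l2.add l3).congr fun k =>
    (h.sol.vorticity_eq (ψ k) (hψ k) T hT).symm)

end SmallSolution

/-! ### Energy estimate -/

/-- The spectral gap on functions of vanishing mean. -/
theorem InV.spectral_gap {w : Plane → ℝ} {D : Plane → Plane} (h : InV w D)
    (h0 : coef w 0 = 0) : nX w ^ 2 ≤ 2 * (nX D ^ 2 - nX w ^ 2) := by
  refine hasSum_le (fun n => ?_) (hasSum_coef_sq h.mem) (h.hasSum_modeEnergy.mul_left 2)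
  by_cases hn : n = 0
  · simp [hn, h0]
  have : (1 : ℝ) ≤ (n 0 : ℝ) + n 1 := by
    have : 1 ≤ n 0 + n 1 := by
      by_contra hc
      exact hn (funext fun i => by fin_cases i <;> simp <;> omega)
    exact_mod_cast this
  nlinarith [mul_le_mul_of_nonneg_right this (sq_nonneg (coef w n))]

/-- The solution, extended by the initial data. -/
def extend (w₀ : Plane → ℝ) (w : ℝ → Plane → ℝ) (t : ℝ) : Plane → ℝ := if 0 < t then w t else w₀

theorem extend_of_pos {w₀ : Plane → ℝ} {w : ℝ → Plane → ℝ} {t : ℝ} (ht : 0 < t) :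
    extend w₀ w t = w t := if_pos ht

theorem extend_zero (w₀ : Plane → ℝ) (w : ℝ → Plane → ℝ) : extend w₀ w 0 = w₀ :=
  if_neg (lt_irrefl 0)

namespace SmallSolution

variable {α β κ ε : ℝ} {b₀ w₀ : Plane → ℝ} {b w : ℝ → Plane → ℝ} {Dw P : ℝ → Plane → Plane}

theorem memLpw_extend (h : SmallSolution α β κ ε b₀ w₀ b w Dw P) (t : ℝ) :
    MemLpw 2 (extend w₀ w t) := by
  unfold extend; split_ifs with ht
  · exact h.sol.w_mem t ht
  · exact h.sol.w₀_mem

theorem coef_extend (h : SmallSolution α β κ ε b₀ w₀ b w Dw P) (n : Fin 2 → ℕ) {t : ℝ}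
    (ht : 0 ≤ t) : coef (extend w₀ w t) n =
      coef w₀ n + ∫ s in (0 : ℝ)..t, rate α b w Dw P (hermite n) s := by
  rcases ht.eq_or_lt with rfl | ht
  · rw [extend_zero, intervalIntegral.integral_same, add_zero]
  · rw [extend_of_pos ht, intervalIntegral.integral_of_le ht.le]
    exact (h.weak_formulation (hasTemperateGrowth_hermite n) ht).2

theorem coef_zero (h : SmallSolution α β κ ε b₀ w₀ b w Dw P) {t : ℝ} (ht : 0 < t) :
    coef (w t) 0 = 0 := by
  have e : hermite 0 = fun _ => 1 := funext hermite_zero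
  have := (h.weak_formulation (hasTemperateGrowth_hermite 0) ht).2
  have r : ∫ s in Ioc 0 t, rate α b w Dw P (hermite 0) s = ∫ _ in Ioc 0 t, (0 : ℝ) :=
    integral_congr_ae ((h.ae_slice ht).mono fun s hs => by
      simp only [rate, e]; exact hs.pairing_one)
  rw [r] at this
  rw [coef, this, e]
  simp [h.mean]

/-- Each of three error terms is allowed `δ ‖∇w‖²`: the transport term through `C ε ≤ δ`, the part
of the flux proportional to `β` through `C β ≤ δ`, and the part proportional to `‖b‖` through
Young's inequality, which leaves the source in `κ² e^{-τ}`. The term with `rem` tends to zero with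
`S`. -/
theorem energy_inequality (h : SmallSolution α β κ ε b₀ w₀ b w Dw P) {C γ δ : ℝ} (hC : 0 ≤ C)
    (hP : ∀ {β : ℝ} {b w : Plane → ℝ} {D P : Plane → Plane}, Slice α β b w D P →
      ∀ S : Finset (Fin 2 → ℕ),
      |(∫ x, vorticityPairing α b w D P (partialSum w S) x) + modeEnergy w S| ≤
        C * (nX D * nX (rem w S) + nX D ^ 2 * nX w + (nX b + β * nX D) * nX D))
    (hγ : 0 ≤ γ) (hδ : 0 < δ) (hγδ : 9 * δ ≤ 1 - 2 * γ)
    (hε : C * ε ≤ δ) (hβ : C * β ≤ δ) {T s t : ℝ} (hT : 0 < T)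
    (hs : 0 ≤ s) (hst : s ≤ t) (ht : t ≤ T) :
    nX (extend w₀ w t) ^ 2 ≤ nX (extend w₀ w s) ^ 2 + ∫ τ in s..t,
      (-(2 * γ) * nX (extend w₀ w τ) ^ 2 + C ^ 2 * κ ^ 2 / (2 * δ) * Real.exp (-τ)) := by
  have hw := h.ae_slice hT
  have iE : IntervalIntegrable (fun τ => nX (extend w₀ w τ) ^ 2) volume 0 T := by
    rw [intervalIntegrable_iff_integrableOn_Ioc_of_le hT.le]
    refine (h.integrableOn_w_sq T).congr_fun (fun τ hτ => ?_) measurableSet_Ioc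
    simp only [extend_of_pos hτ.1]
  have iD : IntegrableOn (fun τ => 1 + nX (Dw τ) ^ 2) (Ioc 0 T) :=
    (integrableOn_const (by simp)).add (h.integrableOn_grad hT)
  have iexp : ∀ s t, IntervalIntegrable (fun τ => Real.exp (-τ)) volume s t :=
    fun s t => (Real.continuous_exp.comp continuous_neg).intervalIntegrable s t
  have sum_eq : ∀ᵐ τ ∂volume.restrict (Ioc 0 T), ∀ S : Finset (Fin 2 → ℕ),
      ∑ n ∈ S, coef (extend w₀ w τ) n * rate α b w Dw P (hermite n) τ =
        ∫ x, vorticityPairing α (b τ) (w τ) (Dw τ) (P τ) (partialSum (w τ) S) x := by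
    filter_upwards [hw, ae_restrict_mem measurableSet_Ioc] with τ hτ hm S
    rw [← hτ.sum_pairing S, extend_of_pos hm.1]
    rfl
  have key := energy_le_of_modes (a := fun n t => coef (extend w₀ w t) n)
    (r := fun n => rate α b w Dw P (hermite n)) (a₀ := coef w₀)
    (E := fun t => nX (extend w₀ w t) ^ 2)
    (U := fun τ => -γ * nX (extend w₀ w τ) ^ 2 + C ^ 2 * κ ^ 2 / (4 * δ) * Real.exp (-τ))
    (H := fun τ => (1 + 5 * C) * (1 + nX (Dw τ) ^ 2)) (T := T)
    (fun n => (intervalIntegrable_iff_integrableOn_Ioc_of_le hT.le).2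
      (h.weak_formulation (hasTemperateGrowth_hermite n) hT).1)
    (fun n t ht => h.coef_extend n ht.1)
    (fun t _ => hasSum_coef_sq (h.memLpw_extend t))
    ((iE.const_mul _).add ((iexp _ _).const_mul _))
    ((intervalIntegrable_iff_integrableOn_Ioc_of_le hT.le).2
      (iD.const_mul _))
    ?_ ?_ hs hst ht
  · refine key.trans (le_of_eq ?_)
    congr 2; ext τ
    field_simp; ring
  · filter_upwards [hw, sum_eq] with τ hτ he S
    rw [he S]
    have h1 := hP hτ S
    have h2 := modeEnergy_nonneg (w τ) S
    have h3 := hτ.inV.modeEnergy_le S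
    have h4 := nX_rem_le hτ.inV.mem S
    have D0 := nX_nonneg (Dw τ)
    have w0 := nX_nonneg (w τ)
    have w1 := hτ.le_one
    have b1 := hτ.b_one
    have hb := hτ.half
    set D := nX (Dw τ)
    have e1 : D * nX (rem (w τ) S) ≤ D * 2 := mul_le_mul_of_nonneg_left (by linarith) D0
    have e2 : D ^ 2 * nX (w τ) ≤ D ^ 2 * 1 := mul_le_mul_of_nonneg_left w1 (sq_nonneg D)
    have e3 : (nX (b τ) + β * D) * D ≤ (1 + 1 / 2 * D) * D := by gcongr
    have e4 : D * nX (rem (w τ) S) + D ^ 2 * nX (w τ) + (nX (b τ) + β * D) * D ≤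
        5 * (1 + D ^ 2) := by nlinarith [sq_nonneg (D - 1)]
    have e5 := mul_le_mul_of_nonneg_left e4 hC
    have e6 := abs_le.1 (h1.trans e5)
    rw [abs_le]
    constructor <;> nlinarith [e6.1, e6.2]
  · filter_upwards [hw, sum_eq, ae_restrict_mem measurableSet_Ioc] with τ hτ he hm
    have gap := hτ.inV.spectral_gap (h.coef_zero hm.1)
    have lim : Tendsto (fun S => -modeEnergy (w τ) S + C * (nX (Dw τ) * nX (rem (w τ) S)))
        atTop (𝓝 (-(nX (Dw τ) ^ 2 - nX (w τ) ^ 2) + C * (nX (Dw τ) * 0))) :=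
      hτ.inV.tendsto_modeEnergy.neg.add
        (((tendsto_nX_partialSum hτ.inV.mem).const_mul _).const_mul _)
    have w1 := h.w_le τ hm.1
    have b1 := h.b_le τ hm.1
    have D0 := nX_nonneg (Dw τ)
    have exp2 : Real.exp (-τ / 2) ^ 2 = Real.exp (-τ) := by
      rw [← Real.exp_nat_mul]; congr 1; push_cast; ring
    simp only [extend_of_pos hm.1] at he ⊢
    simp only [he]
    set D := nX (Dw τ)
    set e := Real.exp (-τ / 2)
    set W := nX (w τ)
    have f1 : C * (D ^ 2 * W) ≤ δ * D ^ 2 := by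
      have := mul_le_mul_of_nonneg_left w1 hC
      nlinarith [sq_nonneg D]
    have f2 : C * (β * D * D) ≤ δ * D ^ 2 := by nlinarith [sq_nonneg D]
    -- Young's inequality with `‖b‖ ≤ κ e^{-τ/2}`, by completing the square of `D - C κ e / (2δ)`.
    have f3 : C * (nX (b τ) * D) ≤ δ * D ^ 2 + C ^ 2 * κ ^ 2 / (4 * δ) * Real.exp (-τ) := by
      have g1 : C * (nX (b τ) * D) ≤ C * (κ * e * D) := by gcongr
      have g2 : C ^ 2 * κ ^ 2 / (4 * δ) * Real.exp (-τ) = (C * κ * e / (2 * δ)) ^ 2 * δ := by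
        rw [← exp2]; field_simp; ring
      have g3 : C * (κ * e * D) = 2 * (C * κ * e / (2 * δ)) * D * δ := by field_simp
      rw [g2]
      nlinarith [mul_nonneg hδ.le (sq_nonneg (D - C * κ * e / (2 * δ)))]
    refine squeeze_zero (g := fun S => max ((-modeEnergy (w τ) S + C * (D * nX (rem (w τ) S))) -
      (-(D ^ 2 - W ^ 2) + C * (D * 0))) 0) (fun S => le_max_right _ _) (fun S => ?_) ?_
    · refine max_le_max ?_ le_rfl
      have h1 := (abs_le.1 (hP hτ S)).2
      -- The spectral gap reads `D² ≥ (3/2) W²`, so the requirement is `(3/2)(1 - 3δ) ≥ 1 + γ`,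
      -- which is exactly `9δ ≤ 1 - 2γ`.
      have : γ * W ^ 2 + 3 * δ * D ^ 2 ≤ D ^ 2 - W ^ 2 := by nlinarith
      nlinarith
    · have := (lim.sub_const (-(D ^ 2 - W ^ 2) + C * (D * 0))).max
        (tendsto_const_nhds (x := (0 : ℝ)))
      simpa using this

theorem decay (h : SmallSolution α β κ ε b₀ w₀ b w Dw P) {C γ δ : ℝ} (hC : 0 ≤ C)
    (hP : ∀ {β : ℝ} {b w : Plane → ℝ} {D P : Plane → Plane}, Slice α β b w D P →
      ∀ S : Finset (Fin 2 → ℕ),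
      |(∫ x, vorticityPairing α b w D P (partialSum w S) x) + modeEnergy w S| ≤
        C * (nX D * nX (rem w S) + nX D ^ 2 * nX w + (nX b + β * nX D) * nX D))
    (hγ : 0 ≤ γ) (hδ : 0 < δ) (hγδ : 9 * δ = 1 - 2 * γ)
    (hε : C * ε ≤ δ) (hβ : C * β ≤ δ) (hκ : 0 ≤ κ) {t : ℝ} (ht : 0 < t) :
    nX (w t) ≤ Real.exp (-γ * t) * (nX w₀ + C / δ * κ) := by
  have iE : IntervalIntegrable (fun τ => nX (extend w₀ w τ) ^ 2) volume 0 t := by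
    rw [intervalIntegrable_iff_integrableOn_Ioc_of_le ht.le]
    refine (h.integrableOn_w_sq t).congr_fun (fun τ hτ => ?_) measurableSet_Ioc
    simp only [extend_of_pos hτ.1]
  have := le_exp_of_le_add_integral (E := fun τ => nX (extend w₀ w τ) ^ 2) (γ := γ)
    (m := C ^ 2 * κ ^ 2 / (2 * δ)) hγ (by linarith) (by positivity) ht.le
    (fun _ _ => sq_nonneg _) iE fun s r hs hsr hr =>
      h.energy_inequality hC hP hγ hδ hγδ.le hε hβ ht hs hsr hr
  simp only [extend_of_pos ht, extend_zero, ← hγδ] at this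
  have w0 := nX_nonneg w₀
  have hexp : Real.exp (-(2 * γ * t)) = Real.exp (-γ * t) ^ 2 := by
    rw [← Real.exp_nat_mul]; congr 1; push_cast; ring
  refine le_of_sq_le_sq ?_ (by positivity)
  have e1 : C ^ 2 * κ ^ 2 / (2 * δ) / (9 * δ) ≤ (C / δ * κ) ^ 2 := by
    have : C ^ 2 * κ ^ 2 / (2 * δ) / (9 * δ) = (C / δ * κ) ^ 2 / 18 := by field_simp; ring
    rw [this]
    exact div_le_self (sq_nonneg _) (by norm_num)
  have e2 : 0 ≤ C / δ * κ := by positivity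
  rw [mul_pow, mul_comm, ← hexp]
  refine this.trans (mul_le_mul_of_nonneg_right ?_ (Real.exp_pos _).le)
  nlinarith [mul_nonneg w0 e2]

end SmallSolution

/-! ### Conversion of the norms and choice of the constants -/

theorem nX_le_of_wnorm_le {F : Type*} [NormedAddCommGroup F] [NormedSpace ℝ F] {f : Plane → F}
    {c : ℝ} (hc : 0 ≤ c) (h : wnorm 2 f ≤ ENNReal.ofReal c) : nX f ≤ c := by
  rw [nX_eq]; exact ENNReal.toReal_le_of_le_ofReal hc h

theorem abs_wt_le_of_wnorm_le {f : Plane → ℝ} {c : ℝ} (hc : 0 ≤ c)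
    (h : wnorm ∞ f ≤ ENNReal.ofReal c) : ∀ᵐ x, |wt f x| ≤ c := by
  rw [wnorm_eq, eLpNorm_exponent_top] at h
  filter_upwards [ae_le_eLpNormEssSup (f := wt f) (μ := volume)] with x hx
  have := hx.trans h
  rwa [← ofReal_norm, ENNReal.ofReal_le_ofReal_iff hc, Real.norm_eq_abs] at this

end OseenVortex

end

theorem theorem2 (α γ : ℝ) (hγ₀ : 0 < γ) (hγ₁ : γ < 1 / 2) (K : ℝ) (hK : 0 < K) :
    ∃ ε₀ > (0 : ℝ), ∃ K' > (0 : ℝ),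
      ∀ (b₀ w₀ : Plane → ℝ) (b w : ℝ → Plane → ℝ) (Dw P : ℝ → Plane → Plane),
        IsSolution α b₀ w₀ b w Dw P →
        ∫ ξ, w₀ ξ = 0 →
        wnorm 2 b₀ ≤ ENNReal.ofReal ε₀ →
        wnorm ∞ b₀ ≤ ENNReal.ofReal ε₀ →
        (∀ t > 0, wnorm 2 (w t) ^ 2 + ∫⁻ s in Ioc 0 t, wnorm 2 (Dw s) ^ 2
          ≤ ENNReal.ofReal ε₀) →
        (∀ t > 0, wnorm 2 (b t) ≤ ENNReal.ofReal (K * Real.exp (-t / 2)) * wnorm 2 b₀) →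
        (∀ t > 0, wnorm ∞ (b t) ≤ ENNReal.ofReal K * wnorm ∞ b₀) →
        ∀ t > 0, wnorm 2 (w t) ≤
          ENNReal.ofReal (K' * Real.exp (-γ * t)) * (wnorm 2 w₀ + wnorm 2 b₀) := by
  obtain ⟨C, hC, hP⟩ := exists_pairing_partialSum α
  obtain ⟨δ, hδ⟩ : ∃ δ, δ = (1 - 2 * γ) / 9 := ⟨_, rfl⟩
  have δ0 : 0 < δ := by rw [hδ]; linarith
  obtain ⟨e, he⟩ : ∃ e, e = min 1 (δ / (C + 1)) := ⟨_, rfl⟩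
  have e0 : 0 < e := by rw [he]; positivity
  have Ce : C * e ≤ δ := by
    have h1 : e ≤ δ / (C + 1) := he ▸ min_le_right _ _
    rw [le_div_iff₀ (by positivity)] at h1
    linarith
  -- `e ^ 2`, since the hypothesis bounds the square of the norm of `w`; `K ε₀ ≤ e`, so that the sup
  -- bound of `b` can be absorbed like `w`; `K ε₀ ≤ 1/2`, for the pressure estimate.
  obtain ⟨ε₀, hε₀⟩ : ∃ ε₀, ε₀ = min (e ^ 2) (min (e / (K + 1)) (1 / (2 * (K + 1)))) := ⟨_, rfl⟩
  have ε0 : 0 < ε₀ := by rw [hε₀]; positivity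
  have ε1 : ε₀ ≤ e ^ 2 := hε₀ ▸ min_le_left _ _
  have ε2 : K * ε₀ ≤ e := by
    have h1 : ε₀ ≤ e / (K + 1) := hε₀ ▸ (min_le_right _ _).trans (min_le_left _ _)
    rw [le_div_iff₀ (by positivity)] at h1
    linarith
  have ε3 : K * ε₀ ≤ 1 / 2 := by
    have h1 : ε₀ ≤ 1 / (2 * (K + 1)) := hε₀ ▸ (min_le_right _ _).trans (min_le_right _ _)
    rw [le_div_iff₀ (by positivity)] at h1
    linarith
  refine ⟨ε₀, ε0, 1 + C / δ * K, by positivity, ?_⟩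
  intro b₀ w₀ b w Dw P sol mean hb₀ hb₀' hw hb hb' t ht
  have nb : nX b₀ ≤ ε₀ := nX_le_of_wnorm_le ε0.le hb₀
  have nb0 := nX_nonneg b₀
  -- The sup norm of `b` is only needed small, whereas `κ` is kept equal to `K * nX b₀`: the final
  -- estimate must be linear in the norm of `b₀`.
  have small : SmallSolution α (K * ε₀) (K * nX b₀) e b₀ w₀ b w Dw P :=
    { sol := sol
      mean := mean
      w_le := fun s hs => by
        have h1 : wnorm 2 (w s) ^ 2 ≤ ENNReal.ofReal ε₀ := le_self_add.trans (hw s hs)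
        have h2 : nX (w s) ^ 2 ≤ ε₀ := by
          rw [nX_sq_eq]; exact ENNReal.toReal_le_of_le_ofReal ε0.le h1
        exact le_of_sq_le_sq (h2.trans ε1) e0.le
      grad_lt := fun s hs => (le_add_self.trans (hw s hs)).trans_lt ENNReal.ofReal_lt_top
      b_le := fun s hs => by
        refine nX_le_of_wnorm_le (by positivity) ((hb s hs).trans (le_of_eq ?_))
        rw [← ofReal_nX sol.b₀_mem.1, ← ENNReal.ofReal_mul (by positivity)]
        congr 1; ring
      b_sup := fun s hs => by
        refine abs_wt_le_of_wnorm_le (by positivity) ((hb' s hs).trans ?_)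
        rw [ENNReal.ofReal_mul hK.le]
        gcongr
      ε_le := he ▸ min_le_left _ _
      κ_le := by nlinarith
      β_le := ε3 }
  have key := small.decay hC hP hγ₀.le δ0 (by rw [hδ]; ring) Ce
    ((mul_le_mul_of_nonneg_left ε2 hC).trans Ce) (by positivity) ht
  have w0 := nX_nonneg w₀
  rw [← ofReal_nX (sol.w_mem t ht), ← ofReal_nX sol.w₀_mem, ← ofReal_nX sol.b₀_mem.1,
    ← ENNReal.ofReal_add w0 nb0, ← ENNReal.ofReal_mul (by positivity)]
  refine ENNReal.ofReal_le_ofReal (key.trans ?_)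
  have h1 : 0 ≤ C / δ * K := by positivity
  have h2 : nX w₀ + C / δ * (K * nX b₀) ≤ (1 + C / δ * K) * (nX w₀ + nX b₀) := by
    nlinarith [mul_nonneg h1 w0]
  calc _ ≤ Real.exp (-γ * t) * ((1 + C / δ * K) * (nX w₀ + nX b₀)) :=
        mul_le_mul_of_nonneg_left h2 (Real.exp_pos _).le
    _ = _ := by ring
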